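/- **Conventions.** Let $K$ be a field, $\mathcal C$ a unital operad in chain complexes of $K$-modules (homological grading by $\mathbb Z$, Koszul signs; structure maps $\gamma:\mathcal C(n_1)\otimes\dots\otimes\mathcal C(n_k)\otimes\mathcal C(k)\to\mathcal C(n_1+\dots+n_k)$ and $\gamma_i(b,c)=\gamma(1,\dots,1,b,1,\dots,1;c)$ with $b$ in the $i$-th place), and $A$ a DG-$\mathcal C$-algebra with operations $\theta:A^{\otimes n}\otimes\mathcal C(n)\to A$. No cofibrancy of $\mathcal C$ is needed. For a graded $K$-module $N$ put $CN=\bigoplus_{n\ge0}N^{\otimes n}\otimes_{\Sigma_n}\mathcal C(n)$, with its $\mathcal C$-algebra structure coming from the monad $C$. A *$\mathcal C$-D-structure* is a chain complex $(N,d)$ with a $K$-linear map $\delta:N\to CN$ of degree $-1$, written $\delta(x)=\sum_m\delta'_m(x)_1\otimes\dots\otimes\delta'_m(x)_m\otimes\delta''_m(x)$, such that the map $\Delta:CN\to CN$, $$\begin{aligned}\Delta(x_1\otimes\dots\otimes x_n\otimes x_{n+1})&=\sum_{i=1}^{n+1}(-1)^{|x_1|+\dots+|x_{i-1}|}x_1\otimes\dots\otimes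 dx_i\otimes\dots\otimes x_{n+1}\\&+\sum_{i=1}^n\sum_{m\ge0}(-1)^{|x_1|+\dots+|x_i|+|\delta''_m(x_i)|(|x_{i+1}|+\dots+|x_n|)}x_1\otimes\dots\otimes x_{i-1}\otimes\delta'_m(x_i)_1\otimes\dots\otimes\delta'_m(x_i)_m\\&\qquad\otimes x_{i+1}\otimes\dots\otimes x_n\otimes\gamma_i(\delta''_m(x_i),x_{n+1})\end{aligned}$$ (with $x_{n+1}\in\mathcal C(n)$) is well defined, satisfies $\Delta\Delta=0$, and makes $CN$ a DG-$\mathcal C$-algebra, denoted $C_\Delta(N)$. *Augmented bar construction.* Consider finite planar rooted trees with each vertex either a leaf, labelled by a homogeneous element of $A$, or an inner vertex, of some valency $k\ge0$, labelled by a homogeneous element of $\mathcal C(k)$. Order the vertices of a tree so that the successor trees of a vertex come, from left to right, before the vertex; the root is last. The labelled tree stands for $\prod_ie_i\prod_jf_j\otimes\bigotimes_jx_j$, where $e_i$ is an exterior generator for each inner vertex $i$ (root included), $f_j$ is a Clifford generator ($f_j^2=1$) for each vertex $j$ with label $x_j$ of odd degree, all $e$'s and $f$'s (for distinct indices) anticommute,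 and products are in the order of the vertices. $\widetilde B_{\mathcal C}(A)$ is the $K$-module generated by labelled trees, modulo linearity in each label and modulo simultaneously permuting the successor trees of a vertex and acting by the permutation on its label, with the sign of the induced permutation of the $e$'s and $f$'s. The degree of a tree is the number of inner vertices plus the sum of the degrees of the labels. The differential is $d=-d_{\rm edge}+d_{\rm leaf}+d_{\rm int}$, as follows. Each term of $d_{\rm edge}$ contracts an edge between two inner vertices $q$ and $s(q)$, with $q$ above $s(q)$ and in $i$-th place there; it composes the labels by $\gamma_i$, applies $\partial/\partial e_q$ and replaces $f_q$ by $f_{s(q)}$. Each term of $d_{\rm leaf}$ replaces an inner vertex $q$ (possibly the root) all of whose $k\ge 0$ successors are leaves, together with them, by one leaf labelled by the value of $\theta$; it applies $\partial/\partial e_q$ and replaces the $f$'s of the merged vertices by that of the new leaf. Each term of $d_{\rm int}$ applies the internal differential to the label of one vertex $i$ and multiplies by $f_i$ from the left. *Bar construction.* $A\subseteq\widetilde B_{\mathcal C}(A)$ is spanned by the trees consisting of one leaf, and $B_{\mathcal C}(A)=(\widetilde B_{\mathcal C}(A)/A)[-1]$, where $X[-1]_k=X_{k+1}$, with the induced differential.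 The shift is taken by moving $e_{\rm root}$ to the right of all $e$'s and $f$'s and dropping it. The $\mathcal C$-algebra structure of $B_{\mathcal C}(A)$ sends trees $t_1,\dots,t_m$ with root labels $b_1,\dots,b_m$ and $c\in\mathcal C(m)$ to the tree whose root has label $\gamma(b_1,\dots,b_m;c)$ and whose successor trees are those of $t_1,\dots,t_m$ in order, with the sign of the corresponding reordering of $e$'s and $f$'s. **Proposition.** The formulas above give a well-defined differential $d$ on $\widetilde B_{\mathcal C}(A)$ with $dd=0$ and make $B_{\mathcal C}(A)$ a DG-$\mathcal C$-algebra. There is a $K$-linear map of degree $-1$ $$\delta:\widetilde B_{\mathcal C}(A)\to C\big(\widetilde B_{\mathcal C}(A)\big)$$ which vanishes on $A$ and splits off the root of every other tree: if the root is labelled by $c\in\mathcal C(k)$ and the successor trees are $t_1,\dots,t_k$, then the tree is sent to $\pm\,t_1\otimes\dots\otimes t_k\otimes c$, where the sign is that of the reordering $$e(t_1)\cdots e(t_k)\,e_{\rm root}\,f(t_1)\cdots f(t_k)f_{\rm root}\mapsto e(t_1)f(t_1)\cdots e(t_k)f(t_k)\,f_{\rm root}\,e_{\rm root}$$ of the products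 of generators belonging to the $t_i$ and to the root. With this $\delta$, $(\widetilde B_{\mathcal C}(A),d)$ is a $\mathcal C$-D-structure, and $C_\Delta(\widetilde B_{\mathcal C}(A))=B_{\mathcal C}(A)$: there is an isomorphism of DG-$\mathcal C$-algebras $\Phi:B_{\mathcal C}(A)\to C_\Delta(\widetilde B_{\mathcal C}(A))$ whose composition with the projection $\widetilde B_{\mathcal C}(A)\to B_{\mathcal C}(A)$ is $\delta$. -/

import Mathlib

open scoped TensorProduct DirectSum

universe u v w

noncomputable section

/-! ## Graded modules and chain complexes

A graded `K`-module is a `K`-module `M` with submodules `gr i`, `i : ℤ`, of which it is the direct sum.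
Differentials have degree `-1`.  The sign `(-1) ^ n` is Mathlib's `n.negOnePow`. -/

/-- `(M, gr, d)` is a chain complex of `K`-modules. -/
structure IsDGModule {K : Type u} [Field K] {M : Type w} [AddCommGroup M] [Module K M]
    (gr : ℤ → Submodule K M) (d : M →ₗ[K] M) : Prop where
  internal : DirectSum.IsInternal gr
  d_mem : ∀ (i : ℤ) (x : M), x ∈ gr i → d x ∈ gr (i - 1)
  d_d : ∀ x : M, d (d x) = 0

/-- Homogeneous elements, recorded together with their degree. -/
abbrev Homog {K : Type u} [Field K] {M : Type w} [AddCommGroup M] [Module K M]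
    (gr : ℤ → Submodule K M) : Type w := Σ i : ℤ, gr i

/-- The exponent of the Koszul sign of the permutation `(x_0, …, x_{n-1}) ↦ (x_{σ 0}, …, x_{σ (n-1)})`
of homogeneous elements of degrees `e_0, …, e_{n-1}`. -/
def koszulExp {n : ℕ} (σ : Equiv.Perm (Fin n)) (e : Fin n → ℤ) : ℤ :=
  ∑ i, ∑ j ∈ Finset.Ioi i, if σ j < σ i then e (σ i) * e (σ j) else 0

/-- The exponent of the sign of the shuffle `f_0 e_0 f_1 e_1 ⋯ ↦ e_0 e_1 ⋯ f_0 f_1 ⋯` of symbols of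
the given degrees: each `f_i` passes all `e_j` with `j > i`. -/
def shuffleExp {n : ℕ} (f e : Fin n → ℤ) : ℤ :=
  ∑ i, ∑ j ∈ Finset.Ioi i, f i * e j

/-- The `i`-th block of `n_0 + ⋯ + n_{k-1}` letters is moved to the place of the `i`-th block of
the reordered word: `(i, q) ↦ (σ i, q)`. -/
def blockPerm {k : ℕ} (n : Fin k → ℕ) (σ : Equiv.Perm (Fin k)) :
    Fin (∑ i, n (σ i)) ≃ Fin (∑ i, n i) :=
  (finSigmaFinEquiv.symm.trans (Equiv.sigmaCongrLeft (β := fun i => Fin (n i)) σ)).trans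
    finSigmaFinEquiv

/-- The block sum of permutations, `(i, q) ↦ (i, τ_i q)`. -/
def blockSum {k : ℕ} (n : Fin k → ℕ) (τ : ∀ i, Equiv.Perm (Fin (n i))) :
    Fin (∑ i, n i) ≃ Fin (∑ i, n i) :=
  (finSigmaFinEquiv.symm.trans (Equiv.sigmaCongrRight τ)).trans finSigmaFinEquiv

/-- Concatenation of `k` finite sequences. -/
def concat {k : ℕ} {n : Fin k → ℕ} {T : Type w} (x : ∀ i, Fin (n i) → T) : Fin (∑ i, n i) → T :=
  fun p => x (finSigmaFinEquiv.symm p).1 (finSigmaFinEquiv.symm p).2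

theorem sum_concat_arity {k : ℕ} (n : Fin k → ℕ) (m : ∀ i, Fin (n i) → ℕ) :
    ∑ p, concat m p = ∑ i, ∑ j, m i j := by
  rw [← Fintype.sum_sigma' (fun i j => m i j)]
  exact Fintype.sum_equiv finSigmaFinEquiv.symm _ _ (fun _ => rfl)

/-! ## Operads and their algebras -/

/-- A unital operad in chain complexes of `K`-modules, with structure maps
`C(n_0) ⊗ ⋯ ⊗ C(n_{k-1}) ⊗ C(k) → C(n_0 + ⋯ + n_{k-1})`, `b_0 ⊗ ⋯ ⊗ b_{k-1} ⊗ c ↦ γ(b; c)`.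
The actions of the symmetric groups are written as an action of all bijections `Fin m ≃ Fin n`
(there are such only for `m = n`); this is the same as an action of each `Perm (Fin n)`,
and includes the transport along equalities of arities. The axioms are those of
`Hom(M ^ ⊗ n, M)`, the operation `c` being written to the right of its arguments and
`(act e c)(x) = ± c (x ∘ e)`. -/
structure DGOperad (K : Type u) [Field K] where
  obj : ℕ → Type v
  [grp : ∀ n, AddCommGroup (obj n)]
  [mod : ∀ n, Module K (obj n)]
  gr : ∀ n, ℤ → Submodule K (obj n)
  d : ∀ n, obj n →ₗ[K] obj n
  isDG : ∀ n, IsDGModule (gr n) (d n)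
  act : ∀ {m n : ℕ}, (Fin m ≃ Fin n) → (obj m →ₗ[K] obj n)
  act_refl : ∀ (n : ℕ) (c : obj n), act (Equiv.refl (Fin n)) c = c
  act_trans : ∀ {l m n : ℕ} (e : Fin l ≃ Fin m) (f : Fin m ≃ Fin n) (c : obj l),
    act (e.trans f) c = act f (act e c)
  act_mem : ∀ {m n : ℕ} (e : Fin m ≃ Fin n) (i : ℤ) (c : obj m), c ∈ gr m i → act e c ∈ gr n i
  d_act : ∀ {m n : ℕ} (e : Fin m ≃ Fin n) (c : obj m), d n (act e c) = act e (d m c)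
  one : obj 1
  one_mem : one ∈ gr 1 0
  d_one : d 1 one = 0
  γ : ∀ {k : ℕ} (n : Fin k → ℕ),
    MultilinearMap K (fun i => obj (n i)) (obj k →ₗ[K] obj (∑ i, n i))
  γ_mem : ∀ {k : ℕ} (n : Fin k → ℕ) (b : ∀ i, obj (n i)) (c : obj k) (e : Fin k → ℤ) (q : ℤ),
    (∀ i, b i ∈ gr (n i) (e i)) → c ∈ gr k q → γ n b c ∈ gr (∑ i, n i) ((∑ i, e i) + q)
  d_γ : ∀ {k : ℕ} (n : Fin k → ℕ) (b : ∀ i, obj (n i)) (c : obj k) (e : Fin k → ℤ),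
    (∀ i, b i ∈ gr (n i) (e i)) →
    d _ (γ n b c) =
      ∑ i, (∑ j ∈ Finset.Iio i, e j).negOnePow •
        γ n (Function.update b i (d (n i) (b i))) c
      + (∑ j, e j).negOnePow • γ n b (d k c)
  γ_one_left : ∀ {k : ℕ} (c : obj k),
    act (finCongr (by simp : ∑ _i : Fin k, 1 = k)) (γ (fun _ : Fin k => 1) (fun _ => one) c) = c
  γ_one_right : ∀ {n : ℕ} (b : obj n),
    act (finCongr (by simp : ∑ _i : Fin 1, n = n)) (γ (fun _ : Fin 1 => n) (fun _ => b) one) = b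
  γ_assoc : ∀ {k : ℕ} (n : Fin k → ℕ) (m : ∀ i, Fin (n i) → ℕ)
    (a : ∀ i j, obj (m i j)) (b : ∀ i, obj (n i)) (c : obj k)
    (ea : ∀ i, Fin (n i) → ℤ) (eb : Fin k → ℤ),
    (∀ i j, a i j ∈ gr (m i j) (ea i j)) → (∀ i, b i ∈ gr (n i) (eb i)) →
    γ (fun i => ∑ j, m i j) (fun i => γ (m i) (a i) (b i)) c =
      (shuffleExp eb (fun i => ∑ j, ea i j)).negOnePow •
        act (finCongr (sum_concat_arity n m))
          (γ (concat m)
            (fun p => a (finSigmaFinEquiv.symm p).1 (finSigmaFinEquiv.symm p).2) (γ n b c))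
  γ_perm : ∀ {k : ℕ} (n : Fin k → ℕ) (b : ∀ i, obj (n i)) (c : obj k) (e : Fin k → ℤ)
    (σ : Equiv.Perm (Fin k)), (∀ i, b i ∈ gr (n i) (e i)) →
    γ n b (act σ c) =
      (koszulExp σ e).negOnePow • act (blockPerm n σ) (γ (fun i => n (σ i)) (fun i => b (σ i)) c)
  γ_perm_inner : ∀ {k : ℕ} (n : Fin k → ℕ) (b : ∀ i, obj (n i)) (c : obj k)
    (τ : ∀ i, Equiv.Perm (Fin (n i))),
    γ n (fun i => act (τ i) (b i)) c = act (blockSum n τ) (γ n b c)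

attribute [instance] DGOperad.grp DGOperad.mod

namespace DGOperad

variable {K : Type u} [Field K] (C : DGOperad.{u, v} K)

/-- Homogeneous operations of arity `n`. -/
abbrev HOp (n : ℕ) : Type v := Homog (C.gr n)

/-- The operad composition on homogeneous operations. -/
def γH {k : ℕ} {n : Fin k → ℕ} (b : ∀ i, C.HOp (n i)) (c : C.HOp k) : C.HOp (∑ i, n i) :=
  ⟨(∑ i, (b i).1) + c.1, C.γ n (fun i => (b i).2) c.2,
    C.γ_mem n _ _ _ _ (fun i => (b i).2.2) c.2.2⟩

/-- The unit as a homogeneous operation. -/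
def oneH : C.HOp 1 := ⟨0, C.one, C.one_mem⟩

/-- The differential of a homogeneous operation. -/
def dH {n : ℕ} (c : C.HOp n) : C.HOp n := ⟨c.1 - 1, C.d n c.2, (C.isDG n).d_mem _ _ c.2.2⟩

/-- The symmetric group action on homogeneous operations. -/
def actH {n : ℕ} (σ : Equiv.Perm (Fin n)) (c : C.HOp n) : C.HOp n :=
  ⟨c.1, C.act σ c.2, C.act_mem σ _ _ c.2.2⟩

end DGOperad

/-- `(M, gr, d)` with the operations `θ : M ^ ⊗ n ⊗ C(n) → M` is a DG-`C`-algebra. -/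
structure IsDGAlgebra {K : Type u} [Field K] (C : DGOperad.{u, v} K) {M : Type w}
    [AddCommGroup M] [Module K M] (gr : ℤ → Submodule K M) (d : M →ₗ[K] M)
    (θ : ∀ n : ℕ, MultilinearMap K (fun _ : Fin n => M) (C.obj n →ₗ[K] M)) : Prop where
  isDG : IsDGModule gr d
  θ_mem : ∀ (n : ℕ) (x : Fin n → M) (c : C.obj n) (e : Fin n → ℤ) (q : ℤ),
    (∀ i, x i ∈ gr (e i)) → c ∈ C.gr n q → θ n x c ∈ gr ((∑ i, e i) + q)
  d_θ : ∀ (n : ℕ) (x : Fin n → M) (c : C.obj n) (e : Fin n → ℤ), (∀ i, x i ∈ gr (e i)) →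
    d (θ n x c) =
      ∑ i, (∑ j ∈ Finset.Iio i, e j).negOnePow • θ n (Function.update x i (d (x i))) c
      + (∑ j, e j).negOnePow • θ n x (C.d n c)
  θ_one : ∀ x : M, θ 1 (fun _ => x) C.one = x
  θ_assoc : ∀ (k : ℕ) (n : Fin k → ℕ) (x : ∀ i, Fin (n i) → M) (b : ∀ i, C.obj (n i))
    (c : C.obj k) (e : ∀ i, Fin (n i) → ℤ) (eb : Fin k → ℤ),
    (∀ i j, x i j ∈ gr (e i j)) → (∀ i, b i ∈ C.gr (n i) (eb i)) →
    θ k (fun i => θ (n i) (x i) (b i)) c =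
      (shuffleExp eb (fun i => ∑ j, e i j)).negOnePow • θ (∑ i, n i) (concat x) (C.γ n b c)
  θ_perm : ∀ (n : ℕ) (x : Fin n → M) (c : C.obj n) (e : Fin n → ℤ) (σ : Equiv.Perm (Fin n)),
    (∀ i, x i ∈ gr (e i)) →
    θ n x (C.act σ c) = (koszulExp σ e).negOnePow • θ n (fun i => x (σ i)) c

/-- A DG-`C`-algebra structure on `M`. -/
structure DGAlgebra {K : Type u} [Field K] (C : DGOperad.{u, v} K) (M : Type w)
    [AddCommGroup M] [Module K M] where
  gr : ℤ → Submodule K M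
  d : M →ₗ[K] M
  θ : ∀ n : ℕ, MultilinearMap K (fun _ : Fin n => M) (C.obj n →ₗ[K] M)
  isDGAlgebra : IsDGAlgebra C gr d θ

/-! ## Corollas: an operation with its inputs -/

/-- A homogeneous operation `op` of `C` whose inputs are labelled by elements of `T`. -/
structure Corolla {K : Type u} [Field K] (C : DGOperad.{u, v} K) (T : Type w) where
  arity : ℕ
  inp : Fin arity → T
  op : C.HOp arity

namespace Corolla

variable {K : Type u} [Field K] {C : DGOperad.{u, v} K} {T : Type w}

/-- Compose the operations `w_i` with `c` and concatenate their inputs. -/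
def graft {k : ℕ} (w : Fin k → Corolla C T) (c : C.HOp k) : Corolla C T :=
  ⟨∑ i, (w i).arity, concat (fun i => (w i).inp), C.γH (fun i => (w i).op) c⟩

/-- Replace the `i`-th input of `(x; c)` by the corolla `w = (y; b)`: the operation becomes
`γ_i(b, c) = γ(1, …, 1, b, 1, …, 1; c)` and the inputs become
`x_0, …, x_{i-1}, y_0, …, y_{m-1}, x_{i+1}, …, x_{k-1}`. -/
def splice {k : ℕ} (x : Fin k → T) (c : C.HOp k) (i : Fin k) (w : Corolla C T) : Corolla C T :=
  graft (fun j => if j = i then w else ⟨1, fun _ => x j, C.oneH⟩) c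

end Corolla

/-! ## The monad `C N = ⨁ N ^ ⊗ n ⊗_{Σ_n} C(n)` -/

/-- `⨁ N ^ ⊗ n ⊗ C(n)`. -/
def PreFree {K : Type u} [Field K] (C : DGOperad.{u, v} K) (N : Type w)
    [AddCommGroup N] [Module K N] : Type (max u v w) :=
  ⨁ n : ℕ, (⨂[K] _i : Fin n, N) ⊗[K] C.obj n

instance {K : Type u} [Field K] (C : DGOperad.{u, v} K) (N : Type w)
    [AddCommGroup N] [Module K N] : AddCommGroup (PreFree C N) :=
  inferInstanceAs (AddCommGroup (⨁ n : ℕ, (⨂[K] _i : Fin n, N) ⊗[K] C.obj n))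

instance {K : Type u} [Field K] (C : DGOperad.{u, v} K) (N : Type w)
    [AddCommGroup N] [Module K N] : Module K (PreFree C N) :=
  inferInstanceAs (Module K (⨁ n : ℕ, (⨂[K] _i : Fin n, N) ⊗[K] C.obj n))

/-- The element `x_0 ⊗ ⋯ ⊗ x_{n-1} ⊗ c`. -/
def PreFree.pure {K : Type u} [Field K] (C : DGOperad.{u, v} K) {N : Type w}
    [AddCommGroup N] [Module K N] {n : ℕ} (x : Fin n → N) (c : C.obj n) : PreFree C N :=
  DirectSum.lof K ℕ (fun n => (⨂[K] _i : Fin n, N) ⊗[K] C.obj n) n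
    (PiTensorProduct.tprod K x ⊗ₜ[K] c)

/-- The relations defining the coinvariants, where `Σ_n` acts on `N ^ ⊗ n` with Koszul signs. -/
def freeRel {K : Type u} [Field K] (C : DGOperad.{u, v} K) {N : Type w}
    [AddCommGroup N] [Module K N] (gr : ℤ → Submodule K N) : Submodule K (PreFree C N) :=
  Submodule.span K {z | ∃ (n : ℕ) (σ : Equiv.Perm (Fin n)) (x : Fin n → Homog gr) (c : C.obj n),
    z = PreFree.pure C (fun i => ((x i).2 : N)) (C.act σ c)
      - (koszulExp σ fun i => (x i).1).negOnePow •
          PreFree.pure C (fun i => ((x (σ i)).2 : N)) c}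

/-- `C N = ⨁ N ^ ⊗ n ⊗_{Σ_n} C(n)` for a graded module `(N, gr)`. -/
def FreeAlg {K : Type u} [Field K] (C : DGOperad.{u, v} K) {N : Type w}
    [AddCommGroup N] [Module K N] (gr : ℤ → Submodule K N) : Type (max u v w) :=
  PreFree C N ⧸ freeRel C gr

instance {K : Type u} [Field K] (C : DGOperad.{u, v} K) {N : Type w}
    [AddCommGroup N] [Module K N] (gr : ℤ → Submodule K N) : AddCommGroup (FreeAlg C gr) :=
  inferInstanceAs (AddCommGroup (PreFree C N ⧸ freeRel C gr))

instance {K : Type u} [Field K] (C : DGOperad.{u, v} K) {N : Type w}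
    [AddCommGroup N] [Module K N] (gr : ℤ → Submodule K N) : Module K (FreeAlg C gr) :=
  inferInstanceAs (Module K (PreFree C N ⧸ freeRel C gr))

namespace FreeAlg

variable {K : Type u} [Field K] {C : DGOperad.{u, v} K} {N : Type w}
  [AddCommGroup N] [Module K N]

/-- The class of `x_0 ⊗ ⋯ ⊗ x_{n-1} ⊗ c`. -/
def pure (gr : ℤ → Submodule K N) {n : ℕ} (x : Fin n → N) (c : C.obj n) : FreeAlg C gr :=
  (freeRel C gr).mkQ (PreFree.pure C x c)

/-- The class of a corolla of homogeneous elements. -/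
def cls {gr : ℤ → Submodule K N} (z : Corolla C (Homog gr)) : FreeAlg C gr :=
  pure gr (fun i => ((z.inp i).2 : N)) (z.op.2 : C.obj z.arity)

/-- The grading of `C N`. -/
def deg (C : DGOperad.{u, v} K) (gr : ℤ → Submodule K N) (m : ℤ) : Submodule K (FreeAlg C gr) :=
  Submodule.span K {y | ∃ z : Corolla C (Homog gr), (∑ i, (z.inp i).1) + z.op.1 = m ∧ y = cls z}

end FreeAlg

section DStructure

variable {K : Type u} [Field K] (C : DGOperad.{u, v} K) {N : Type w}
  [AddCommGroup N] [Module K N] (gr : ℤ → Submodule K N)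

/-- `θ` is the `C`-algebra structure of `C N` given by the product of the monad: on pure tensors
the operations are composed, after they have been moved to the right of all inputs. -/
def IsMonadAction
    (θ : ∀ n : ℕ, MultilinearMap K (fun _ : Fin n => FreeAlg C gr)
      (C.obj n →ₗ[K] FreeAlg C gr)) : Prop :=
  ∀ (k : ℕ) (z : Fin k → Corolla C (Homog gr)) (c : C.HOp k),
    θ k (fun i => FreeAlg.cls (z i)) c.2 =
      (shuffleExp (fun i => (z i).op.1) (fun i => ∑ q, ((z i).inp q).1)).negOnePow •
        FreeAlg.cls (Corolla.graft z c)

/-- `Δ : C N → C N` is the map given by the formula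
`Δ(x_1 ⊗ ⋯ ⊗ x_n ⊗ c) = ∑_i (-1)^(|x_1| + ⋯ + |x_{i-1}|) x_1 ⊗ ⋯ ⊗ d x_i ⊗ ⋯ ⊗ x_n ⊗ c`
`+ (-1)^(|x_1| + ⋯ + |x_n|) x_1 ⊗ ⋯ ⊗ x_n ⊗ d c`
`+ ∑_i (-1)^(|x_1| + ⋯ + |x_i| + |δ''(x_i)| (|x_{i+1}| + ⋯ + |x_n|))`
`x_1 ⊗ ⋯ ⊗ x_{i-1} ⊗ δ'(x_i)_1 ⊗ ⋯ ⊗ δ'(x_i)_m ⊗ x_{i+1} ⊗ ⋯ ⊗ x_n ⊗ γ_i(δ''(x_i), c)`,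
whatever expansions `δ(x_i) = ∑ δ'(x_i)_1 ⊗ ⋯ ⊗ δ'(x_i)_m ⊗ δ''(x_i)`, with homogeneous
factors, are chosen. -/
def IsDelta (d : N →ₗ[K] N) (δ : N →ₗ[K] FreeAlg C gr)
    (Δ : FreeAlg C gr →ₗ[K] FreeAlg C gr) : Prop :=
  ∀ (n : ℕ) (x : Fin n → Homog gr) (c : C.HOp n)
    (r : Fin n → ℕ) (z : ∀ i, Fin (r i) → Corolla C (Homog gr)),
    (∀ i, δ (x i).2 = ∑ t, FreeAlg.cls (z i t)) →
    Δ (FreeAlg.pure gr (fun i => ((x i).2 : N)) (c.2 : C.obj n)) =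
      ∑ i, (∑ j ∈ Finset.Iio i, (x j).1).negOnePow •
        FreeAlg.pure gr (Function.update (fun j => ((x j).2 : N)) i (d (x i).2)) (c.2 : C.obj n)
      + (∑ j, (x j).1).negOnePow •
        FreeAlg.pure gr (fun i => ((x i).2 : N)) (C.d n c.2)
      + ∑ i, ∑ t,
        (∑ j ∈ Finset.Iic i, (x j).1
            + (z i t).op.1 * ∑ j ∈ Finset.Ioi i, (x j).1).negOnePow •
          FreeAlg.cls (Corolla.splice x c i (z i t))

/-- A D-structure with respect to `C`: a DG-module `(N, gr, d)` with a graded map `δ : N → C N`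
(it lowers the degree by one, as `Δ` does) such that the map `Δ` given by the above formula is
(well defined and) a differential which makes `C N`, with the `C`-algebra structure coming from
the monad, a DG-`C`-algebra. -/
structure IsDStructure (d : N →ₗ[K] N) (δ : N →ₗ[K] FreeAlg C gr) : Prop where
  isDG : IsDGModule gr d
  δ_mem : ∀ (m : ℤ) (x : N), x ∈ gr m → δ x ∈ FreeAlg.deg C gr (m - 1)
  exists_Δ : ∃ (Δ : FreeAlg C gr →ₗ[K] FreeAlg C gr)
    (θ : ∀ n : ℕ, MultilinearMap K (fun _ : Fin n => FreeAlg C gr)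
      (C.obj n →ₗ[K] FreeAlg C gr)),
    IsDelta C gr d δ Δ ∧ IsMonadAction C gr θ ∧ IsDGAlgebra C (FreeAlg.deg C gr) Δ θ

end DStructure

/-! ## Labelled trees -/

/-- Planar rooted trees in which leaves are labelled by homogeneous elements of `A` and every
other vertex, of valency `k ≥ 0`, by a homogeneous element of `C(k)`.

The vertices of a tree are ordered so that the vertices of the successor trees of a vertex come,
from left to right, before that vertex; so the root is the last one. A labelled tree stands for the
generator `∏ e_i · ∏ f_j · ⊗ x_i`, where `e_i` (exterior generators) run over the vertices that are
not leaves, the `f_j` (Clifford generators) over the vertices `j` with a label `x_j` of odd degree,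
and the products are taken in the order of the vertices. -/
inductive LTree {K : Type u} [Field K] (C : DGOperad.{u, v} K) {M : Type w} [AddCommGroup M]
    [Module K M] (gr : ℤ → Submodule K M) : Type (max v w)
  | leaf (a : Homog gr) : LTree C gr
  | node (k : ℕ) (ch : Fin k → LTree C gr) (c : C.HOp k) : LTree C gr

namespace LTree

variable {K : Type u} [Field K] {C : DGOperad.{u, v} K} {M : Type w} [AddCommGroup M] [Module K M]

/-- The tree whose root has the given label and successor trees. -/
def ofCorolla {gr : ℤ → Submodule K M} (z : Corolla C (LTree C gr)) : LTree C gr :=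
  node z.arity z.inp z.op

/-- The number of vertices that are not leaves. -/
def inner {gr : ℤ → Submodule K M} : LTree C gr → ℤ
  | leaf _ => 0
  | node _ ch _ => (∑ i, (ch i).inner) + 1

/-- The sum of the degrees of all labels. -/
def intDeg {gr : ℤ → Submodule K M} : LTree C gr → ℤ
  | leaf a => a.1
  | node _ ch c => (∑ i, (ch i).intDeg) + c.1

/-- The degree in the augmented bar construction. -/
def deg {gr : ℤ → Submodule K M} (t : LTree C gr) : ℤ := t.inner + t.intDeg

def isLeaf {gr : ℤ → Submodule K M} : LTree C gr → Bool
  | leaf _ => true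
  | node _ _ _ => false

/-- The label of a leaf (and `0` for other trees, where it is not used). -/
def leafLabel {gr : ℤ → Submodule K M} : LTree C gr → Homog gr
  | leaf a => a
  | node _ _ _ => ⟨0, 0⟩

/-- Apply a formal linear combination of trees in the place of the `i`-th successor tree. -/
def atChild {gr : ℤ → Submodule K M} {k : ℕ} (ch : Fin k → LTree C gr) (c : C.HOp k) (i : Fin k)
    (f : LTree C gr →₀ K) : LTree C gr →₀ K :=
  Finsupp.mapDomain (fun t => node k (Function.update ch i t) c) f

/-- Contraction of the edge between the root and the root of its `i`-th successor tree `t`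
(zero if `t` is a leaf). The generator `e` of the contracted vertex is removed by `∂/∂e`, which
passes the generators of the vertices before it; its `f` is moved past those of the successor trees
further to the right, next to the `f` of the root. -/
def rootEdge {gr : ℤ → Submodule K M} {k : ℕ} (ch : Fin k → LTree C gr) (c : C.HOp k) (i : Fin k) :
    LTree C gr → (LTree C gr →₀ K)
  | leaf _ => 0
  | node m u b =>
      (∑ j ∈ Finset.Iic i, (ch j).inner - 1
          + b.1 * ∑ j ∈ Finset.Ioi i, (ch j).intDeg).negOnePow •
        Finsupp.single (ofCorolla (Corolla.splice ch c i ⟨m, u, b⟩)) 1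

/-- The sum of all edge contractions. -/
def edgeContr {gr : ℤ → Submodule K M} : LTree C gr → (LTree C gr →₀ K)
  | leaf _ => 0
  | node _ ch c =>
      ∑ i, ((∑ j ∈ Finset.Iio i, (ch j).inner).negOnePow • atChild ch c i (ch i).edgeContr
        + rootEdge ch c i (ch i))

/-- The sum of all leaf contractions: a vertex all of whose successor trees are leaves (there may
be none) is replaced by a leaf labelled by the value of the operation. Its generator `e` is removed
by `∂/∂e`. -/
def leafContr (A : DGAlgebra C M) : LTree C A.gr → (LTree C A.gr →₀ K)
  | leaf _ => 0
  | node k ch c =>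
      ∑ i, (∑ j ∈ Finset.Iio i, (ch j).inner).negOnePow • atChild ch c i ((ch i).leafContr A)
        + if ∀ i, (ch i).isLeaf = true then
            Finsupp.single (leaf ⟨(∑ i, (ch i).leafLabel.1) + c.1,
              A.θ k (fun i => ((ch i).leafLabel.2 : M)) c.2,
              A.isDGAlgebra.θ_mem k _ _ _ _ (fun i => (ch i).leafLabel.2.2) c.2.2⟩) 1
          else 0

/-- The sum over all vertices of the internal differential of the label, multiplied by `f_i` from
the left of the product of the `f_j`. -/
def labelDiff (A : DGAlgebra C M) : LTree C A.gr → (LTree C A.gr →₀ K)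
  | leaf a => Finsupp.single (leaf ⟨a.1 - 1, A.d a.2, A.isDGAlgebra.isDG.d_mem _ _ a.2.2⟩) 1
  | node k ch c =>
      ∑ i, (∑ j ∈ Finset.Iio i, (ch j).intDeg).negOnePow • atChild ch c i ((ch i).labelDiff A)
        + (∑ j, (ch j).intDeg).negOnePow • Finsupp.single (node k ch (C.dH c)) 1

/-- The differential of a labelled tree. In the last summand the `f_i` multiplied from the left
has also passed all the generators `e`. -/
def diff (A : DGAlgebra C M) (t : LTree C A.gr) : LTree C A.gr →₀ K :=
  -t.edgeContr + t.leafContr A + t.inner.negOnePow • t.labelDiff A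

/-- The relations between labelled trees: additivity and homogeneity in each label, and, for each
vertex, invariance under simultaneous permutation of its successor trees and the action on its
label, with the signs of the induced permutations of the generators `e` and `f`. -/
inductive Rel (C : DGOperad.{u, v} K) (gr : ℤ → Submodule K M) : (LTree C gr →₀ K) → Prop
  | leaf_add (i : ℤ) (a b : gr i) : Rel C gr
      (Finsupp.single (leaf ⟨i, a + b⟩) 1
        - (Finsupp.single (leaf ⟨i, a⟩) 1 + Finsupp.single (leaf ⟨i, b⟩) 1))
  | leaf_smul (i : ℤ) (r : K) (a : gr i) : Rel C gr
      (Finsupp.single (leaf ⟨i, r • a⟩) 1 - r • Finsupp.single (leaf ⟨i, a⟩) 1)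
  | node_add (k : ℕ) (ch : Fin k → LTree C gr) (q : ℤ) (a b : C.gr k q) : Rel C gr
      (Finsupp.single (node k ch ⟨q, a + b⟩) 1
        - (Finsupp.single (node k ch ⟨q, a⟩) 1 + Finsupp.single (node k ch ⟨q, b⟩) 1))
  | node_smul (k : ℕ) (ch : Fin k → LTree C gr) (q : ℤ) (r : K) (a : C.gr k q) : Rel C gr
      (Finsupp.single (node k ch ⟨q, r • a⟩) 1 - r • Finsupp.single (node k ch ⟨q, a⟩) 1)
  | perm (k : ℕ) (ch : Fin k → LTree C gr) (c : C.HOp k) (σ : Equiv.Perm (Fin k)) : Rel C gr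
      (Finsupp.single (node k ch (C.actH σ c)) 1
        - ((koszulExp σ fun i => (ch i).inner)
            + koszulExp σ fun i => (ch i).intDeg).negOnePow •
          Finsupp.single (node k (fun i => ch (σ i)) c) 1)
  | context (k : ℕ) (ch : Fin k → LTree C gr) (c : C.HOp k) (i : Fin k) (f : LTree C gr →₀ K)
      (h : Rel C gr f) : Rel C gr (atChild ch c i f)

end LTree

/-! ## The bar constructions -/

section Bar

variable {K : Type u} [Field K] {C : DGOperad.{u, v} K} {M : Type w} [AddCommGroup M] [Module K M]

/-- The augmented bar construction `B̃_C(A)`, as a `K`-module: the direct sum over all planar trees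
of the tensor products of the modules of labels (with sign lines), modulo permutation of successor
trees. -/
def AugBar (A : DGAlgebra C M) : Type (max u v w) :=
  (LTree C A.gr →₀ K) ⧸ Submodule.span K {f | LTree.Rel C A.gr f}

instance (A : DGAlgebra C M) : AddCommGroup (AugBar A) :=
  inferInstanceAs (AddCommGroup (_ ⧸ Submodule.span K {f | LTree.Rel C A.gr f}))

instance (A : DGAlgebra C M) : Module K (AugBar A) :=
  inferInstanceAs (Module K (_ ⧸ Submodule.span K {f | LTree.Rel C A.gr f}))

namespace AugBar

/-- The class of a formal linear combination of labelled trees. -/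
def mk (A : DGAlgebra C M) : (LTree C A.gr →₀ K) →ₗ[K] AugBar A :=
  (Submodule.span K {f | LTree.Rel C A.gr f}).mkQ

/-- The class of a labelled tree. -/
def cls (A : DGAlgebra C M) (t : LTree C A.gr) : AugBar A := mk A (Finsupp.single t 1)

/-- The grading of `B̃_C(A)`. -/
def deg (A : DGAlgebra C M) (m : ℤ) : Submodule K (AugBar A) :=
  Submodule.span K {y | ∃ t : LTree C A.gr, t.deg = m ∧ y = cls A t}

/-- `d` is the differential of `B̃_C(A)`. -/
def IsDifferential (A : DGAlgebra C M) (d : AugBar A →ₗ[K] AugBar A) : Prop :=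
  ∀ t : LTree C A.gr, d (cls A t) = mk A (t.diff A)

/-- The summand `A` of `B̃_C(A)` given by the trees with one vertex, a leaf. -/
def leaves (A : DGAlgebra C M) : Submodule K (AugBar A) :=
  Submodule.span K (Set.range fun a : Homog A.gr => cls A (LTree.leaf a))

/-- `δ` vanishes on the summand `A` and splits off the root of every other tree. The sign is that
of the shuffle
`e(t_1) ⋯ e(t_k) e_root f(t_1) ⋯ f(t_k) f_root ↦ e(t_1) f(t_1) ⋯ e(t_k) f(t_k) f_root e_root`,
where `e(t_i)`, `f(t_i)` are the products of generators for the `i`-th successor tree; then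
`e_root` is dropped. -/
def SplitsRoot (A : DGAlgebra C M) (δ : AugBar A →ₗ[K] FreeAlg C (deg A)) : Prop :=
  (∀ a : Homog A.gr, δ (cls A (LTree.leaf a)) = 0) ∧
  ∀ (k : ℕ) (t : Fin k → LTree C A.gr) (c : C.HOp k),
    δ (cls A (LTree.node k t c)) =
      ((LTree.node k t c).intDeg
          + shuffleExp (fun i => (t i).intDeg) (fun i => (t i).inner)).negOnePow •
        FreeAlg.pure (deg A) (fun i => cls A (t i)) (c.2 : C.obj k)

end AugBar

/-- The bar construction `B_C(A) = (B̃_C(A) / A)[-1]`, as a `K`-module. -/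
def Bar (A : DGAlgebra C M) : Type (max u v w) := AugBar A ⧸ AugBar.leaves A

instance (A : DGAlgebra C M) : AddCommGroup (Bar A) :=
  inferInstanceAs (AddCommGroup (AugBar A ⧸ AugBar.leaves A))

instance (A : DGAlgebra C M) : Module K (Bar A) :=
  inferInstanceAs (Module K (AugBar A ⧸ AugBar.leaves A))

namespace Bar

/-- The projection `B̃_C(A) → B_C(A)`, which lowers the degree by one. -/
def proj (A : DGAlgebra C M) : AugBar A →ₗ[K] Bar A := (AugBar.leaves A).mkQ

/-- The grading of `B_C(A)`. -/
def deg (A : DGAlgebra C M) (m : ℤ) : Submodule K (Bar A) := (AugBar.deg A (m + 1)).map (proj A)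

/-- `dB` is the differential of `B_C(A)`, induced by that of `B̃_C(A)`. -/
def IsDifferential (A : DGAlgebra C M) (dB : Bar A →ₗ[K] Bar A) : Prop :=
  ∃ d : AugBar A →ₗ[K] AugBar A, AugBar.IsDifferential A d ∧ ∀ x, dB (proj A x) = proj A (d x)

/-- The `C`-algebra structure of `B_C(A)`: for trees `t_i` with roots labelled `b_i`, and `c ∈ C(k)`,
a tree is built whose successor trees are all those of `t_1, …, t_k`, and whose root is labelled
`γ(b_1, …, b_k; c)`.

The shift by `-1` drops `e_root`, after it has been moved to the right: this is the sign
`(-1) ^ intDeg` of `e' e_root f ↦ e' f e_root`, where `e'` is the product of the other `e_i`. It occurs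
for each `t_i` and for the result, together `(-1) ^ |c|`. The remaining signs come from moving
`e'(t_j)` past `f(t_i)`, and the `f` of the successor trees of the root of `t_j` past the `f` of the
root of `t_i`, for `i < j`. -/
def IsGrafting (A : DGAlgebra C M)
    (θ : ∀ n : ℕ, MultilinearMap K (fun _ : Fin n => Bar A) (C.obj n →ₗ[K] Bar A)) : Prop :=
  ∀ (k : ℕ) (z : Fin k → Corolla C (LTree C A.gr)) (c : C.HOp k),
    θ k (fun i => proj A (AugBar.cls A (LTree.ofCorolla (z i)))) c.2 =
      (c.1
        + shuffleExp (fun i => (LTree.ofCorolla (z i)).intDeg)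
            (fun i => (LTree.ofCorolla (z i)).inner - 1)
        + shuffleExp (fun i => (z i).op.1) (fun i => ∑ q, ((z i).inp q).intDeg)).negOnePow •
      proj A (AugBar.cls A (LTree.ofCorolla (Corolla.graft z c)))

end Bar

end Bar

end

noncomputable section

/-! ## Signs -/

/-! A tree is either a leaf or a root operation with successor trees as inputs. So the augmented bar
construction B̃ is the sum of A and a copy of its own free algebra C(B̃), shifted by one. The maps
`leafIncl`, `leafProj`, `joinRoot`, `splitRoot` realise this splitting (`leafIncl_leafProj_add`),
and δ is `splitRoot`. The statement thereby becomes one about a free algebra, whose derivations and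
morphisms are determined by their values on generators.

Let Δ be the derivation of C(B̃) with Δx = dx + (-1)^|x| δx on generators, and let ε : C(B̃) → A be
the algebra morphism extending the projection to the leaves (`evalLeaves`). The tree formula for d
amounts to two rules: on leaves it is the differential of A, and d(join y) = join(Δy) + (-1)^|y|
ε(y) (`differential_joinRoot`). Everything that happens inside a successor tree gives the dx part of
Δ, contraction of the edges at the root gives the δ part, and contraction of a root with only leaves
above it gives ε. This is proved in `mk_diff_node`, where the signs of the generators e and f are
compared with Koszul signs.

Since Δ involves d on successor trees, the second rule cannot serve as a definition of d. It is
first stated as an expression `diffMultilinear` in pairs (x_i, d x_i), multilinear in these pairs.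
Compatibility of the tree formula with the relations follows by induction on the context in which a
relation is applied (`linearCombination_mk_diff`).

The two rules give δd = Δδ and εΔ = d_A ε. On generators ΔΔx = ddx, because the two terms with δ
have opposite signs. The square of an odd derivation obeys a Leibniz rule without signs
(`leibniz_leibniz`), so ΔΔ vanishes on a tensor of trees for which dd vanishes. Now dd = 0 by
induction on trees: dd(join y) is join(ΔΔy) plus two terms d_A ε(y) of opposite signs. Then ΔΔ = 0
as well. Finally δ kills A and `joinRoot` inverts it modulo A, so B is isomorphic to C(B̃); the
structure of C(B̃) is transported to B and recognised as the one given by trees.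

Linear and multilinear maps out of the quotients are obtained from presentations by generators and
relations (`IsPresentation`). Signs are compared through their exponents: it suffices that these
differ by 2k, and the integer k passed to the lemma below records which terms occur twice. -/

theorem negOnePow_eq_of_eq_add {a b : ℤ} (k : ℤ) (h : a = b + 2 * k) :
    a.negOnePow = b.negOnePow := by
  rw [h, Int.negOnePow_add, Int.negOnePow_two_mul, mul_one]

/-- Signs are their own inverses, so a summand of an exponent may change sides. -/
theorem negOnePow_add_eq_of_eq {a b c d : ℤ} (h : (a + b).negOnePow = (c + d).negOnePow) :
    (a + c).negOnePow = (b + d).negOnePow := by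
  rw [show a + c = a + b + (c - b) by ring, Int.negOnePow_add, h, ← Int.negOnePow_add]
  exact negOnePow_eq_of_eq_add (c - b) (by ring)

theorem intUnits_smul_eq (K : Type u) [Field K] {X : Type w} [AddCommGroup X] [Module K X] (s : ℤˣ)
    (x : X) : s • x = ((s : ℤ) : K) • x := by
  rw [Units.smul_def, Int.cast_smul_eq_zsmul]

theorem negOnePow_smul_smul {X : Type w} [AddCommGroup X] (a b : ℤ) (x : X) :
    a.negOnePow • b.negOnePow • x = (a + b).negOnePow • x := by
  rw [smul_smul, Int.negOnePow_add]

theorem negOnePow_smul_self {X : Type w} [AddCommGroup X] (a : ℤ) (x : X) :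
    a.negOnePow • a.negOnePow • x = x := by
  rw [smul_smul, ← Int.negOnePow_add, Int.negOnePow_even _ ⟨a, rfl⟩, one_smul]

/-! ### Sums and signs over concatenated words -/

theorem sum_concat {X : Type*} [AddCommMonoid X] {k : ℕ} {n : Fin k → ℕ} (f : ∀ i, Fin (n i) → X) :
    ∑ p, concat f p = ∑ i, ∑ j, f i j := by
  rw [← Fintype.sum_sigma' (fun i j => f i j)]
  exact Fintype.sum_equiv finSigmaFinEquiv.symm _ _ (fun _ => rfl)

theorem sum_finSigma {X : Type*} [AddCommMonoid X] {k : ℕ} {n : Fin k → ℕ}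
    (f : Fin (∑ i, n i) → X) :
    ∑ p, f p = ∑ i, ∑ j, f (finSigmaFinEquiv ⟨i, j⟩) := by
  rw [← Fintype.sum_sigma' (fun i j => f (finSigmaFinEquiv ⟨i, j⟩))]
  exact (Fintype.sum_equiv finSigmaFinEquiv _ _ (fun _ => rfl)).symm

@[simp] theorem concat_finSigma {T : Type*} {k : ℕ} {n : Fin k → ℕ} (f : ∀ i, Fin (n i) → T)
    (i : Fin k) (j : Fin (n i)) : concat f (finSigmaFinEquiv ⟨i, j⟩) = f i j := by
  change (fun x : (i : Fin k) × Fin (n i) => f x.1 x.2)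
    (finSigmaFinEquiv.symm (finSigmaFinEquiv ⟨i, j⟩)) = f i j
  rw [Equiv.symm_apply_apply]

/-- The offset of a block as a sum over `Finset.Iio i`, instead of over `Fin i`, makes the offsets
of different blocks comparable. -/
theorem finSigmaFinEquiv_val {k : ℕ} {n : Fin k → ℕ} (i : Fin k) (a : Fin (n i)) :
    (finSigmaFinEquiv (⟨i, a⟩ : (i : Fin k) × Fin (n i)) : ℕ) = ∑ q ∈ Finset.Iio i, n q + a := by
  rw [finSigmaFinEquiv_apply]
  congr 1
  refine Finset.sum_bij (fun q _ => Fin.castLE i.2.le q) ?_ ?_ ?_ ?_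
  · intro q _
    simp [Fin.lt_def]
  · intro q _ q' _ h
    simpa using h
  · intro q hq
    rw [Finset.mem_Iio] at hq
    exact ⟨⟨q, hq⟩, Finset.mem_univ _, rfl⟩
  · intro q _
    rfl

theorem finSigmaFinEquiv_lt_of_lt {k : ℕ} {n : Fin k → ℕ} {i j : Fin k} (a : Fin (n i))
    (b : Fin (n j)) (h : i < j) :
    finSigmaFinEquiv (⟨i, a⟩ : (i : Fin k) × Fin (n i)) < finSigmaFinEquiv ⟨j, b⟩ := by
  rw [Fin.lt_def, finSigmaFinEquiv_val, finSigmaFinEquiv_val]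
  have h1 : ∑ q ∈ Finset.Iio i, n q + n i ≤ ∑ q ∈ Finset.Iio j, n q := by
    rw [add_comm, ← Finset.sum_insert (by simp)]
    refine Finset.sum_le_sum_of_subset ?_
    intro q hq
    rw [Finset.mem_insert, Finset.mem_Iio] at hq
    rw [Finset.mem_Iio]
    rcases hq with rfl | hq
    · exact h
    · exact hq.trans h
  have ha := a.2
  omega

theorem finSigmaFinEquiv_lt_iff {k : ℕ} {n : Fin k → ℕ} {i j : Fin k} (a : Fin (n i))
    (b : Fin (n j)) (hij : i ≠ j) :
    finSigmaFinEquiv (⟨i, a⟩ : (i : Fin k) × Fin (n i)) < finSigmaFinEquiv ⟨j, b⟩ ↔ i < j := by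
  refine ⟨fun h => ?_, finSigmaFinEquiv_lt_of_lt a b⟩
  by_contra hn
  exact lt_asymm h (finSigmaFinEquiv_lt_of_lt b a (lt_of_le_of_ne (not_lt.1 hn) hij.symm))

theorem finSigmaFinEquiv_lt_iff_right {k : ℕ} {n : Fin k → ℕ} {i : Fin k} (a b : Fin (n i)) :
    finSigmaFinEquiv (⟨i, a⟩ : (i : Fin k) × Fin (n i)) < finSigmaFinEquiv ⟨i, b⟩ ↔ a < b := by
  rw [Fin.lt_def, finSigmaFinEquiv_apply, finSigmaFinEquiv_apply, Fin.lt_def]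
  simp

theorem sum_Ioi_eq {X : Type*} [AddCommMonoid X] {n : ℕ} (i : Fin n) (f : Fin n → X) :
    ∑ j ∈ Finset.Ioi i, f j = ∑ j, if i < j then f j else 0 := by
  rw [← Finset.sum_filter]
  congr 1
  ext j
  simp

theorem sum_Iio_eq {X : Type*} [AddCommMonoid X] {n : ℕ} (i : Fin n) (f : Fin n → X) :
    ∑ j ∈ Finset.Iio i, f j = ∑ j, if j < i then f j else 0 := by
  rw [← Finset.sum_filter]
  congr 1
  ext j
  simp

/-- A double sum over two blocks of letters, for a summand supported on increasing pairs. -/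
theorem sum_sum_finSigma_lt {X : Type*} [AddCommMonoid X] {k : ℕ} {n : Fin k → ℕ}
    (F : Fin (∑ i, n i) → Fin (∑ i, n i) → X) :
    ∑ p, ∑ q, (if p < q then F p q else 0) =
      ∑ i, (∑ a, ∑ b, if a < b then F (finSigmaFinEquiv ⟨i, a⟩) (finSigmaFinEquiv ⟨i, b⟩) else 0)
      + ∑ i, ∑ j, if i < j then
          ∑ a, ∑ b, F (finSigmaFinEquiv ⟨i, a⟩) (finSigmaFinEquiv ⟨j, b⟩) else 0 := by
  rw [sum_finSigma, ← Finset.sum_add_distrib]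
  refine Finset.sum_congr rfl fun i _ => ?_
  have h1 : ∀ a : Fin (n i), (∑ q, if finSigmaFinEquiv ⟨i, a⟩ < q then
      F (finSigmaFinEquiv ⟨i, a⟩) q else 0) =
      (∑ b, if a < b then F (finSigmaFinEquiv ⟨i, a⟩) (finSigmaFinEquiv ⟨i, b⟩) else 0)
      + ∑ j, if i < j then ∑ b, F (finSigmaFinEquiv ⟨i, a⟩) (finSigmaFinEquiv ⟨j, b⟩) else 0 := by
    intro a
    rw [sum_finSigma, ← Finset.add_sum_erase _ _ (Finset.mem_univ i)]
    congr 1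
    · refine Finset.sum_congr rfl fun b _ => ?_
      simp only [finSigmaFinEquiv_lt_iff_right]
    · rw [← Finset.add_sum_erase Finset.univ (fun j => if i < j then
          ∑ b, F (finSigmaFinEquiv ⟨i, a⟩) (finSigmaFinEquiv ⟨j, b⟩) else 0) (Finset.mem_univ i),
        if_neg (lt_irrefl i), zero_add]
      refine Finset.sum_congr rfl fun j hj => ?_
      have hij : i ≠ j := (Finset.ne_of_mem_erase hj).symm
      by_cases h : i < j
      · simp [finSigmaFinEquiv_lt_iff _ _ hij, h]
      · simp [finSigmaFinEquiv_lt_iff _ _ hij, h]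
  rw [Finset.sum_congr rfl fun a _ => h1 a, Finset.sum_add_distrib]
  congr 1
  rw [Finset.sum_comm]
  refine Finset.sum_congr rfl fun j _ => ?_
  split_ifs <;> simp

/-- Written with a condition instead of a restricted range, the sum can be reindexed and cut into
blocks. -/
theorem shuffleExp_eq {n : ℕ} (f e : Fin n → ℤ) :
    shuffleExp f e = ∑ i, ∑ j, if i < j then f i * e j else 0 := by
  simp only [shuffleExp, sum_Ioi_eq]

/-- A pair of letters lies either in one block or in two different ones; the pairs from two given
blocks add up to a product of block totals. -/
theorem shuffleExp_concat {k : ℕ} {n : Fin k → ℕ} (f e : ∀ i, Fin (n i) → ℤ) :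
    shuffleExp (concat f) (concat e) =
      ∑ i, shuffleExp (f i) (e i) + shuffleExp (fun i => ∑ a, f i a) (fun i => ∑ a, e i a) := by
  simp only [shuffleExp_eq]
  rw [sum_sum_finSigma_lt]
  simp only [concat_finSigma, Finset.sum_mul_sum]

theorem shuffleExp_add_left {n : ℕ} (f g e : Fin n → ℤ) :
    shuffleExp (fun i => f i + g i) e = shuffleExp f e + shuffleExp g e := by
  simp only [shuffleExp, add_mul, Finset.sum_add_distrib]

theorem shuffleExp_add_right {n : ℕ} (f e g : Fin n → ℤ) :
    shuffleExp f (fun i => e i + g i) = shuffleExp f e + shuffleExp f g := by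
  simp only [shuffleExp, mul_add, Finset.sum_add_distrib]

/-- The exponent is biadditive, and an update is the addition of a `Pi.single`. -/
theorem shuffleExp_update_left {n : ℕ} (f e : Fin n → ℤ) (i : Fin n) (x : ℤ) :
    shuffleExp (Function.update f i x) e = shuffleExp f e + (x - f i) * ∑ j ∈ Finset.Ioi i, e j := by
  have h : Function.update f i x = fun j => f j + (Pi.single i (x - f i) : Fin n → ℤ) j := by
    ext j
    by_cases hj : j = i
    · subst hj; simp
    · simp [hj]
  rw [h, shuffleExp_add_left]
  congr 1
  rw [shuffleExp, Finset.sum_eq_single i]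
  · simp [Finset.mul_sum]
  · intro j _ hj
    simp [hj]
  · simp

theorem shuffleExp_update_right {n : ℕ} (f e : Fin n → ℤ) (i : Fin n) (x : ℤ) :
    shuffleExp f (Function.update e i x) = shuffleExp f e + (∑ j ∈ Finset.Iio i, f j) * (x - e i) := by
  have h : Function.update e i x = fun j => e j + (Pi.single i (x - e i) : Fin n → ℤ) j := by
    ext j
    by_cases hj : j = i
    · subst hj; simp
    · simp [hj]
  rw [h, shuffleExp_add_right]
  congr 1
  rw [shuffleExp_eq, Finset.sum_comm, Finset.sum_eq_single i]
  · simp [sum_Iio_eq, Finset.sum_mul]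
  · intro j _ hj
    simp [hj]
  · simp

/-- The exponent of the Koszul sign of a bijection between finite ordinals. -/
def equivKoszulExp {m n : ℕ} (σ : Fin m ≃ Fin n) (e : Fin n → ℤ) : ℤ :=
  ∑ i, ∑ j, if i < j then (if σ j < σ i then e (σ i) * e (σ j) else 0) else 0

theorem koszulExp_eq {n : ℕ} (σ : Equiv.Perm (Fin n)) (e : Fin n → ℤ) :
    koszulExp σ e = equivKoszulExp σ e := by
  simp only [koszulExp, equivKoszulExp, sum_Ioi_eq]

theorem equivKoszulExp_finCongr {m n : ℕ} (h : m = n) (e : Fin n → ℤ) :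
    equivKoszulExp (finCongr h) e = 0 := by
  subst h
  refine Finset.sum_eq_zero fun i _ => Finset.sum_eq_zero fun j _ => ?_
  split_ifs with h1 h2
  · exact absurd h2 (lt_asymm h1)
  · rfl
  · rfl

theorem blockPerm_apply {k : ℕ} (n : Fin k → ℕ) (σ : Equiv.Perm (Fin k)) (i : Fin k)
    (a : Fin (n (σ i))) :
    blockPerm n σ (finSigmaFinEquiv ⟨i, a⟩) = finSigmaFinEquiv ⟨σ i, a⟩ := by
  simp [blockPerm]

theorem blockSum_apply {k : ℕ} (n : Fin k → ℕ) (τ : ∀ i, Equiv.Perm (Fin (n i))) (i : Fin k)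
    (a : Fin (n i)) :
    blockSum n τ (finSigmaFinEquiv ⟨i, a⟩) = finSigmaFinEquiv ⟨i, τ i a⟩ := by
  simp [blockSum]

theorem concat_blockPerm {T : Type*} {k : ℕ} (n : Fin k → ℕ) (σ : Equiv.Perm (Fin k))
    (x : ∀ i, Fin (n i) → T) :
    concat x ∘ blockPerm n σ = concat (fun i => x (σ i)) := by
  ext p
  obtain ⟨⟨i, a⟩, rfl⟩ := finSigmaFinEquiv.surjective p
  simp only [Function.comp_apply, blockPerm_apply, concat_finSigma]

theorem concat_blockSum {T : Type*} {k : ℕ} (n : Fin k → ℕ) (τ : ∀ i, Equiv.Perm (Fin (n i)))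
    (x : ∀ i, Fin (n i) → T) :
    concat x ∘ blockSum n τ = concat (fun i => x i ∘ τ i) := by
  ext p
  obtain ⟨⟨i, a⟩, rfl⟩ := finSigmaFinEquiv.surjective p
  simp [blockSum_apply]

/-- Letters of one block keep their order. Two blocks are inverted as a whole, so a block behaves
like one letter of the total degree. -/
theorem equivKoszulExp_blockPerm {k : ℕ} (n : Fin k → ℕ) (σ : Equiv.Perm (Fin k))
    (e : ∀ i, Fin (n i) → ℤ) :
    equivKoszulExp (blockPerm n σ) (concat e) = koszulExp σ (fun i => ∑ a, e i a) := by
  rw [koszulExp_eq, equivKoszulExp, sum_sum_finSigma_lt, equivKoszulExp]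
  simp only [blockPerm_apply, concat_finSigma, finSigmaFinEquiv_lt_iff_right]
  rw [Finset.sum_eq_zero, zero_add]
  · refine Finset.sum_congr rfl fun i _ => Finset.sum_congr rfl fun j _ => ?_
    by_cases hij : i < j
    · have : σ j ≠ σ i := fun h => hij.ne' (σ.injective h)
      simp only [if_pos hij, finSigmaFinEquiv_lt_iff _ _ this]
      split_ifs
      · rw [Finset.sum_mul_sum]
      · simp
    · simp only [if_neg hij]
  · intro i _
    refine Finset.sum_eq_zero fun a _ => Finset.sum_eq_zero fun b _ => ?_
    split_ifs with h1 h2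
    · exact absurd h2 (lt_asymm h1)
    · rfl
    · rfl

theorem equivKoszulExp_blockSum {k : ℕ} (n : Fin k → ℕ) (τ : ∀ i, Equiv.Perm (Fin (n i)))
    (e : ∀ i, Fin (n i) → ℤ) :
    equivKoszulExp (blockSum n τ) (concat e) = ∑ i, koszulExp (τ i) (e i) := by
  simp only [koszulExp_eq]
  rw [equivKoszulExp, sum_sum_finSigma_lt]
  simp only [blockSum_apply, concat_finSigma, finSigmaFinEquiv_lt_iff_right]
  conv_rhs => rw [← add_zero (∑ i, _)]
  congr 1
  refine Finset.sum_eq_zero fun i _ => Finset.sum_eq_zero fun j _ => ?_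
  by_cases hij : i < j
  · simp only [if_pos hij, finSigmaFinEquiv_lt_iff _ _ hij.ne', if_neg (lt_asymm hij)]
    simp
  · simp only [if_neg hij]

theorem koszulExp_one {n : ℕ} (e : Fin n → ℤ) : koszulExp 1 e = 0 := by
  rw [koszulExp_eq]
  exact equivKoszulExp_finCongr rfl e

theorem sum_sum_eq_diag_add {X : Type*} [AddCommMonoid X] {n : ℕ} (G : Fin n → Fin n → X) :
    ∑ i, ∑ j, G i j = ∑ i, G i i + ∑ i, ∑ j, if i < j then G i j + G j i else 0 := by
  have h : ∀ i j, G i j = (if i = j then G i j else 0) +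
      ((if i < j then G i j else 0) + (if j < i then G i j else 0)) := by
    intro i j
    rcases lt_trichotomy i j with h | h | h
    · simp [h, h.ne, lt_asymm h]
    · subst h; simp
    · simp [h, h.ne', lt_asymm h]
  rw [Finset.sum_congr rfl fun i _ => Finset.sum_congr rfl fun j _ => h i j]
  simp only [Finset.sum_add_distrib, Finset.sum_ite_eq, Finset.mem_univ, if_true]
  congr 1
  conv_lhs => enter [2]; rw [Finset.sum_comm]
  simp only [← Finset.sum_add_distrib]
  refine Finset.sum_congr rfl fun i _ => Finset.sum_congr rfl fun j _ => ?_
  split_ifs <;> simp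

/-- Reordering pairs `(f_i, e_i)` before or after the shuffle. -/
theorem negOnePow_shuffleExp_perm {n : ℕ} (σ : Equiv.Perm (Fin n)) (f e : Fin n → ℤ) :
    (shuffleExp (fun i => f (σ i)) (fun i => e (σ i))
      + koszulExp σ (fun i => f i + e i)).negOnePow =
    (shuffleExp f e + koszulExp σ f + koszulExp σ e).negOnePow := by
  -- The shuffle exponent is rewritten as a sum over pairs of positions after σ, so that both sides
  -- can be compared pair by pair.
  have h1 : shuffleExp f e = ∑ i, ∑ j, if i < j then
      (if σ j < σ i then f (σ j) * e (σ i) else f (σ i) * e (σ j)) else 0 := by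
    rw [shuffleExp_eq, ← Equiv.sum_comp σ]
    have : ∀ i, ∑ j, (if σ i < j then f (σ i) * e j else 0) =
        ∑ j, if σ i < σ j then f (σ i) * e (σ j) else 0 := fun i =>
      (Equiv.sum_comp σ (fun j => if σ i < j then f (σ i) * e j else 0)).symm
    simp only [this]
    rw [sum_sum_eq_diag_add]
    simp only [lt_irrefl, if_false, Finset.sum_const_zero, zero_add]
    refine Finset.sum_congr rfl fun i _ => Finset.sum_congr rfl fun j _ => ?_
    by_cases hij : i < j
    · have hne : σ i ≠ σ j := fun h => hij.ne (σ.injective h)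
      rcases lt_or_gt_of_ne hne with h | h
      · simp [hij, h, lt_asymm h]
      · simp [hij, h, lt_asymm h]
    · simp [hij]
  rw [h1]
  simp only [koszulExp_eq, equivKoszulExp, shuffleExp_eq, ← Finset.sum_add_distrib]
  -- Only inverted pairs differ: for them `f (σ i) * e (σ j)` occurs once in the shuffle and once in
  -- the Koszul exponent of the sums.
  refine negOnePow_eq_of_eq_add (∑ i, ∑ j, if i < j then
    (if σ j < σ i then f (σ i) * e (σ j) else 0) else 0) ?_
  simp only [Finset.mul_sum, ← Finset.sum_add_distrib]
  refine Finset.sum_congr rfl fun i _ => Finset.sum_congr rfl fun j _ => ?_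
  split_ifs <;> ring

/-- The Koszul sign after the degree of one letter has been lowered by one. -/
theorem negOnePow_koszulExp_update {n : ℕ} (σ : Equiv.Perm (Fin n)) (e : Fin n → ℤ) (p : Fin n) :
    (∑ j ∈ Finset.Iio (σ p), e j
      + koszulExp σ (Function.update e (σ p) (e (σ p) - 1))).negOnePow =
    (koszulExp σ e + ∑ j ∈ Finset.Iio p, e (σ j)).negOnePow := by
  have hu : ∀ i, Function.update e (σ p) (e (σ p) - 1) (σ i) =
      e (σ i) - if i = p then 1 else 0 := by
    intro i
    by_cases h : i = p
    · subst h; simp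
    · have : σ i ≠ σ p := fun hh => h (σ.injective hh)
      simp [h, this]
  -- Lowering the degree of the letter `σ p` by one removes, for every inversion in which it takes
  -- part, the degree of its partner.
  have h2 : koszulExp σ (Function.update e (σ p) (e (σ p) - 1)) =
      koszulExp σ e - ∑ j, (if j < p then (if σ p < σ j then e (σ j) else 0) else 0)
        - ∑ j, (if p < j then (if σ j < σ p then e (σ j) else 0) else 0) := by
    simp only [koszulExp_eq, equivKoszulExp, hu]
    have h3 : ∀ i j : Fin n, (if i < j then (if σ j < σ i then
        (e (σ i) - if i = p then 1 else 0) * (e (σ j) - if j = p then 1 else 0) else 0) else 0) =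
        (if i < j then (if σ j < σ i then e (σ i) * e (σ j) else 0) else 0)
        - (if j = p then (if i < j then (if σ j < σ i then e (σ i) else 0) else 0) else 0)
        - (if i = p then (if i < j then (if σ j < σ i then e (σ j) else 0) else 0) else 0) := by
      intro i j
      by_cases hij : i < j
      · by_cases h : σ j < σ i
        · by_cases hi : i = p
          · subst hi
            simp only [hij, h, hij.ne', if_true, if_false]; ring
          · by_cases hj : j = p
            · subst hj
              simp only [hij, h, hi, if_true, if_false]; ring
            · simp only [hij, h, hi, hj, if_true, if_false]; ring
        · simp [h]
      · simp [hij]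
    simp only [h3, Finset.sum_sub_distrib]
    congr 1
    · congr 1
      refine Finset.sum_congr rfl fun i _ => ?_
      simp
    · rw [Finset.sum_comm]
      refine Finset.sum_congr rfl fun i _ => ?_
      simp
  have h4 : ∑ j ∈ Finset.Iio (σ p), e j = ∑ j, if σ j < σ p then e (σ j) else 0 := by
    rw [sum_Iio_eq]
    exact (Equiv.sum_comp σ (fun j => if j < σ p then e j else 0)).symm
  rw [h2, h4, sum_Iio_eq]
  refine negOnePow_eq_of_eq_add (-∑ j, (if j < p then (if σ p < σ j then e (σ j) else 0) else 0)) ?_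
  -- The letters originally before `σ p` are those now before it, without the ones that overtook it,
  -- together with the ones it overtook.
  have h5 : ∑ j, (if σ j < σ p then e (σ j) else 0) =
      ∑ j, (if j < p then e (σ j) else 0)
      - ∑ j, (if j < p then (if σ p < σ j then e (σ j) else 0) else 0)
      + ∑ j, (if p < j then (if σ j < σ p then e (σ j) else 0) else 0) := by
    rw [← Finset.sum_sub_distrib, ← Finset.sum_add_distrib]
    refine Finset.sum_congr rfl fun j _ => ?_
    rcases lt_trichotomy j p with h | h | h
    · have hne : σ j ≠ σ p := fun hh => h.ne (σ.injective hh)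
      rcases lt_or_gt_of_ne hne with h' | h'
      · simp [h, h', lt_asymm h, lt_asymm h']
      · simp [h, h', lt_asymm h, lt_asymm h']
    · subst h; simp
    · simp [h, lt_asymm h]
  rw [h5]
  ring

theorem sum_Iio_finSigma {X : Type*} [AddCommMonoid X] {k : ℕ} {n : Fin k → ℕ}
    (f : ∀ i, Fin (n i) → X) (i : Fin k)
    (a : Fin (n i)) :
    ∑ p ∈ Finset.Iio (finSigmaFinEquiv ⟨i, a⟩), concat f p =
      ∑ j ∈ Finset.Iio i, ∑ b, f j b + ∑ b ∈ Finset.Iio a, f i b := by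
  simp only [sum_Iio_eq]
  rw [sum_finSigma, ← Finset.add_sum_erase _ _ (Finset.mem_univ i), add_comm]
  congr 1
  · rw [← Finset.add_sum_erase (a := i) _ (fun j => if j < i then ∑ b, f j b else 0)
      (Finset.mem_univ i), if_neg (lt_irrefl i), zero_add]
    refine Finset.sum_congr rfl fun j hj => ?_
    have hij : j ≠ i := Finset.ne_of_mem_erase hj
    simp only [finSigmaFinEquiv_lt_iff _ _ hij, concat_finSigma]
    split_ifs <;> simp
  · simp only [finSigmaFinEquiv_lt_iff_right, concat_finSigma]

theorem sum_eq_Iio_add_Ioi {n : ℕ} (f : Fin n → ℤ) (i : Fin n) :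
    ∑ j, f j = ∑ j ∈ Finset.Iio i, f j + f i + ∑ j ∈ Finset.Ioi i, f j := by
  have h : (Finset.univ : Finset (Fin n)) = (Finset.Iio i ∪ {i}) ∪ Finset.Ioi i := by
    ext j
    simp only [Finset.mem_univ, Finset.mem_union, Finset.mem_Iio, Finset.mem_singleton,
      Finset.mem_Ioi, true_iff]
    rcases lt_trichotomy j i with h | h | h <;> simp [h]
  rw [h, Finset.sum_union, Finset.sum_union, Finset.sum_singleton]
  · simp
  · rw [Finset.disjoint_left]
    intro j hj
    simp only [Finset.mem_union, Finset.mem_Iio, Finset.mem_singleton, Finset.mem_Ioi] at hj ⊢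
    rcases hj with hj | hj
    · exact lt_asymm hj
    · simp [hj]

theorem sum_Iic_eq {n : ℕ} (f : Fin n → ℤ) (i : Fin n) :
    ∑ j ∈ Finset.Iic i, f j = ∑ j ∈ Finset.Iio i, f j + f i := by
  rw [add_comm, ← Finset.sum_insert (by simp)]
  congr 1
  ext j
  simp [le_iff_eq_or_lt]

theorem sum_update {n : ℕ} (f : Fin n → ℤ) (i : Fin n) (x : ℤ) :
    ∑ j, Function.update f i x j = ∑ j, f j + (x - f i) := by
  rw [← Finset.add_sum_erase _ _ (Finset.mem_univ i),
    ← Finset.add_sum_erase _ f (Finset.mem_univ i), Function.update_self,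
    Finset.sum_congr rfl fun j hj => Function.update_of_ne (Finset.ne_of_mem_erase hj) x f]
  ring

/-! ## Generators and relations -/

section Presentation

variable {K : Type*} [Field K] {T N X : Type*} [AddCommGroup N] [Module K N] [AddCommGroup X]
  [Module K X]

/-- The module `N` is presented by the generators `g` and the relations `R`. -/
structure IsPresentation (g : T → N) (R : (T →₀ K) → Prop) : Prop where
  span : Submodule.span K (Set.range g) = ⊤
  ker : LinearMap.ker (Finsupp.linearCombination K g) ≤ Submodule.span K {f | R f}

/-- `L` undoes the map from the free module modulo the relations, so whatever `g` sends to zero is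
already zero modulo the relations. -/
theorem IsPresentation.of_linearMap {g : T → N} {R : (T →₀ K) → Prop}
    (hs : Submodule.span K (Set.range g) = ⊤)
    (L : N →ₗ[K] (T →₀ K) ⧸ Submodule.span K {f | R f})
    (hL : ∀ t, L (g t) = (Submodule.span K {f | R f}).mkQ (Finsupp.single t 1)) :
    IsPresentation g R := by
  refine ⟨hs, fun f hf => ?_⟩
  have h : L ∘ₗ Finsupp.linearCombination K g = (Submodule.span K {f | R f}).mkQ := by
    refine Finsupp.lhom_ext' fun t => LinearMap.ext_ring ?_
    simp [hL]
  rw [← Submodule.ker_mkQ (Submodule.span K {f | R f}), ← h]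
  rw [LinearMap.mem_ker] at hf ⊢
  rw [LinearMap.comp_apply, hf, map_zero]

/-- Over a field the projection from the free module has a linear section; the extension of `F` is
composed with it. Two lifts of one element differ by a combination of relations, which `F` kills. -/
theorem IsPresentation.exists_linearMap {g : T → N} {R : (T →₀ K) → Prop} (h : IsPresentation g R)
    (F : T → X) (hF : ∀ f, R f → Finsupp.linearCombination K F f = 0) :
    ∃ L : N →ₗ[K] X, ∀ t, L (g t) = F t := by
  have hsurj : LinearMap.range (Finsupp.linearCombination K g) = ⊤ := by
    rw [Finsupp.range_linearCombination, h.span]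
  obtain ⟨σ, hσ⟩ := (Finsupp.linearCombination K g).exists_rightInverse_of_surjective hsurj
  refine ⟨Finsupp.linearCombination K F ∘ₗ σ, fun t => ?_⟩
  have hk : Submodule.span K {f | R f} ≤ LinearMap.ker (Finsupp.linearCombination K F) :=
    Submodule.span_le.2 fun f hf => hF f hf
  have h1 : σ (g t) - Finsupp.single t 1 ∈ LinearMap.ker (Finsupp.linearCombination K g) := by
    rw [LinearMap.mem_ker, map_sub]
    have := LinearMap.congr_fun hσ (g t)
    simp only [LinearMap.comp_apply, LinearMap.id_apply] at this
    simp [this]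
  have h2 := hk (h.ker h1)
  rw [LinearMap.mem_ker, map_sub, sub_eq_zero] at h2
  simpa using h2

theorem exists_multilinearMap_finsupp {ι : Type*} [Finite ι] (F : (ι → T) → X) :
    ∃ Φ : MultilinearMap K (fun _ : ι => T →₀ K) X,
      ∀ t, Φ (fun i => Finsupp.single (t i) 1) = F t := by
  classical
  have := Fintype.ofFinite ι
  -- On basis vectors with coefficients the value is the product of the coefficients times `F t`.
  refine ⟨(MultilinearMap.fromDirectSumEquiv (R := K) (ι := ι) (κ := fun _ => T)
    (M := fun _ _ => K) (fun t => MultilinearMap.mkPiRing K ι (F t))).compLinearMap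
      (fun _ => (finsuppLEquivDirectSum K K T).toLinearMap), fun t => ?_⟩
  rw [MultilinearMap.compLinearMap_apply]
  have : (fun i => (finsuppLEquivDirectSum K K T).toLinearMap (Finsupp.single (t i) 1)) =
      fun i => DirectSum.lof K T (fun _ => K) (t i) 1 := by
    ext1 i
    exact finsuppLEquivDirectSum_single K K T _ _
  rw [this, MultilinearMap.fromDirectSumEquiv_lof]
  simp

/-- Two multilinear maps which agree on generators agree on the spans of the generators. -/
theorem multilinearMap_eq_of_mem_span {ι : Type*} [Finite ι] {N : ι → Type*}
    [∀ i, AddCommGroup (N i)] [∀ i, Module K (N i)] (f g : MultilinearMap K N X)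
    (S : ∀ i, Set (N i)) (h : ∀ x, (∀ i, x i ∈ S i) → f x = g x) (x : ∀ i, N i)
    (hx : ∀ i, x i ∈ Submodule.span K (S i)) : f x = g x := by
  classical
  have := Fintype.ofFinite ι
  -- The set `s` collects the coordinates already allowed to range over the spans; it grows one
  -- coordinate at a time.
  have key : ∀ s : Finset ι, ∀ x, (∀ i ∈ s, x i ∈ Submodule.span K (S i)) →
      (∀ i ∉ s, x i ∈ S i) → f x = g x := by
    intro s
    induction s using Finset.induction_on with
    | empty => exact fun x _ hx => h x fun i => hx i (Finset.notMem_empty i)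
    | insert i s hi ih =>
      intro x hx hx'
      rw [← Function.update_eq_self i x]
      refine Submodule.span_induction (p := fun y _ =>
        f (Function.update x i y) = g (Function.update x i y)) ?_ ?_ ?_ ?_
        (hx i (Finset.mem_insert_self i s))
      · intro y hy
        refine ih _ (fun j hj => ?_) (fun j hj => ?_)
        · have : j ≠ i := fun hji => hi (hji ▸ hj)
          rw [Function.update_of_ne this]
          exact hx j (Finset.mem_insert_of_mem hj)
        · by_cases hji : j = i
          · subst hji
            rwa [Function.update_self]
          · rw [Function.update_of_ne hji]
            exact hx' j (by simp [hji, hj])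
      · rw [f.map_update_zero, g.map_update_zero]
      · intro a b _ _ ha hb
        rw [f.map_update_add, g.map_update_add, ha, hb]
      · intro r a _ ha
        rw [f.map_update_smul, g.map_update_smul, ha]
  exact key Finset.univ x (fun i _ => hx i) (fun i hi => absurd (Finset.mem_univ i) hi)

theorem multilinearMap_ext_of_span {ι : Type*} [Finite ι] (f f' : MultilinearMap K (fun _ : ι => N) X)
    {g : T → N} (hg : Submodule.span K (Set.range g) = ⊤)
    (h : ∀ t : ι → T, f (fun i => g (t i)) = f' (fun i => g (t i))) : f = f' := by
  ext x
  refine multilinearMap_eq_of_mem_span f f' (fun _ => Set.range g) (fun x hx => ?_) x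
    (fun i => by rw [hg]; trivial)
  choose t ht using hx
  obtain rfl : (fun i => g (t i)) = x := funext ht
  exact h t

theorem linearMap_ext_of_span {f f' : N →ₗ[K] X} {g : T → N}
    (hg : Submodule.span K (Set.range g) = ⊤) (h : ∀ t : T, f (g t) = f' (g t)) : f = f' := by
  refine LinearMap.ext_on hg ?_
  rintro _ ⟨t, rfl⟩
  exact h t

/-- As for linear maps, a multilinear map on the free modules is composed with a section in every
variable. What has to be seen is that it vanishes as soon as one entry lies in the kernel, whatever
the other entries are. -/
theorem IsPresentation.exists_multilinearMap {g : T → N} {R : (T →₀ K) → Prop}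
    (h : IsPresentation g R) {ι : Type*} [Finite ι] [DecidableEq ι] (F : (ι → T) → X)
    (hF : ∀ (t : ι → T) (i : ι) (f : T →₀ K), R f →
      Finsupp.linearCombination K (fun s => F (Function.update t i s)) f = 0) :
    ∃ Φ : MultilinearMap K (fun _ : ι => N) X, ∀ t, Φ (fun i => g (t i)) = F t := by
  have := Fintype.ofFinite ι
  have hsurj : LinearMap.range (Finsupp.linearCombination K g) = ⊤ := by
    rw [Finsupp.range_linearCombination, h.span]
  obtain ⟨σ, hσ⟩ := (Finsupp.linearCombination K g).exists_rightInverse_of_surjective hsurj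
  obtain ⟨Ψ, hΨ⟩ := exists_multilinearMap_finsupp (K := K) F
  have hker : ∀ (i : ι) (a : ι → T →₀ K) (f : T →₀ K),
      f ∈ LinearMap.ker (Finsupp.linearCombination K g) → Ψ (Function.update a i f) = 0 := by
    intro i a f hf
    -- In place `i` an entry is replaced by the sum of its coefficients times the fixed kernel
    -- element `f`. The result is multilinear in all variables, so it may be tested on basis
    -- vectors, where the hypothesis on relations applies.
    have h1 : Ψ.compLinearMap (Function.update (fun _ => LinearMap.id) i
        ((Submodule.span K {f | R f}).subtype ∘ₗ
          (LinearMap.toSpanSingleton K _ ⟨f, h.ker hf⟩) ∘ₗ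
          (Finsupp.linearCombination K fun _ : T => (1 : K)))) = 0 := by
      refine multilinearMap_ext_of_span _ _ (g := fun t : T => Finsupp.single t (1 : K)) ?_ ?_
      · exact (Finsupp.basisSingleOne (R := K) (ι := T)).span_eq ▸ by congr 1
      · intro t
        rw [MultilinearMap.compLinearMap_apply, zero_apply]
        have h2 : (fun j => (Function.update (fun _ => LinearMap.id) i
            ((Submodule.span K {f | R f}).subtype ∘ₗ
            (LinearMap.toSpanSingleton K _ ⟨f, h.ker hf⟩) ∘ₗ
            (Finsupp.linearCombination K fun _ : T => (1 : K))) : ι → (T →₀ K) →ₗ[K] (T →₀ K)) j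
              (Finsupp.single (t j) 1)) =
            Function.update (fun j => Finsupp.single (t j) 1) i f := by
          ext1 j
          by_cases hj : j = i
          · subst hj
            simp
          · simp [hj]
        rw [h2]
        have h3 : Ψ.toLinearMap (fun j => Finsupp.single (t j) 1) i =
            Finsupp.linearCombination K (fun s => F (Function.update t i s)) := by
          refine Finsupp.lhom_ext' fun s => LinearMap.ext_ring ?_
          simp only [LinearMap.comp_apply, Finsupp.lsingle_apply, MultilinearMap.toLinearMap_apply,
            Finsupp.linearCombination_single, one_smul]
          rw [← hΨ]
          congr 1
          ext1 j
          by_cases hj : j = i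
          · subst hj; simp
          · simp [hj]
        have h4 : Submodule.span K {f | R f} ≤
            LinearMap.ker (Ψ.toLinearMap (fun j => Finsupp.single (t j) 1) i) := by
          refine Submodule.span_le.2 fun f' hf' => ?_
          rw [SetLike.mem_coe, LinearMap.mem_ker, h3]
          exact hF t i f' hf'
        exact h4 (h.ker hf)
    -- A basis vector in place `i` has coefficient sum one and so recovers `f`. Without generators
    -- the free module is zero.
    by_cases hT : Nonempty T
    · obtain ⟨t⟩ := hT
      have h5 := congrArg (fun M => M (Function.update a i (Finsupp.single t 1))) h1
      simp only [MultilinearMap.compLinearMap_apply, zero_apply] at h5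
      rw [← h5]
      congr 1
      ext1 j
      by_cases hj : j = i
      · subst hj; simp
      · simp [hj]
    · rw [not_nonempty_iff] at hT
      rw [Subsingleton.elim f 0, Ψ.map_update_zero]
  refine ⟨Ψ.compLinearMap fun _ => σ, fun t => ?_⟩
  rw [MultilinearMap.compLinearMap_apply, ← hΨ]
  -- The entries `Finsupp.single (t i) 1` are exchanged for the chosen lifts of `g (t i)` one after
  -- another; each exchange changes one entry by a kernel element.
  have hstep : ∀ s : Finset ι, Ψ (fun i => if i ∈ s then σ (g (t i)) else Finsupp.single (t i) 1) =
      Ψ (fun i => Finsupp.single (t i) 1) := by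
    intro s
    induction s using Finset.induction_on with
    | empty => simp
    | insert i s hi ih =>
      rw [← ih, ← sub_eq_zero]
      have h1 : (fun j => if j ∈ insert i s then σ (g (t j)) else Finsupp.single (t j) 1) =
          Function.update (fun j => if j ∈ s then σ (g (t j)) else Finsupp.single (t j) 1) i
            (σ (g (t i))) := by
        ext1 j
        by_cases hj : j = i
        · subst hj; simp
        · simp [hj]
      have h2 : (fun j => if j ∈ s then σ (g (t j)) else Finsupp.single (t j) 1) =
          Function.update (fun j => if j ∈ s then σ (g (t j)) else Finsupp.single (t j) 1) i
            (Finsupp.single (t i) 1) := by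
        ext1 j
        by_cases hj : j = i
        · subst hj; simp [hi]
        · simp [hj]
      rw [h1]
      conv_lhs => enter [2]; rw [h2]
      rw [← Ψ.map_update_sub]
      refine hker i _ _ ?_
      rw [LinearMap.mem_ker, map_sub]
      have := LinearMap.congr_fun hσ (g (t i))
      simp only [LinearMap.comp_apply, LinearMap.id_apply] at this
      simp [this]
  simpa using hstep Finset.univ

end Presentation

/-! ## Graded modules -/

section Graded

variable {K : Type*} [Field K] {N X : Type*} [AddCommGroup N] [Module K N] [AddCommGroup X]
  [Module K X]

theorem exists_linearMap_of_isInternal {gr : ℤ → Submodule K N} (h : DirectSum.IsInternal gr)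
    (F : ∀ i, gr i →ₗ[K] X) : ∃ L : N →ₗ[K] X, ∀ (i : ℤ) (x : gr i), L x = F i x := by
  have hb : Function.Bijective (DirectSum.coeLinearMap gr) := h
  refine ⟨DirectSum.toModule K ℤ X F ∘ₗ (LinearEquiv.ofBijective _ hb).symm.toLinearMap,
    fun i x => ?_⟩
  have : (LinearEquiv.ofBijective _ hb).symm (x : N) = DirectSum.lof K ℤ (fun i => gr i) i x := by
    rw [LinearEquiv.symm_apply_eq]
    simp
  rw [LinearMap.comp_apply, LinearEquiv.coe_coe, this, DirectSum.toModule_lof]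

theorem span_iUnion_of_isInternal {gr : ℤ → Submodule K N} (h : DirectSum.IsInternal gr) :
    Submodule.span K (Set.range fun x : Σ i : ℤ, gr i => (x.2 : N)) = ⊤ := by
  rw [eq_top_iff, ← h.submodule_iSup_eq_top, iSup_le_iff]
  intro i x hx
  exact Submodule.subset_span ⟨⟨i, x, hx⟩, rfl⟩

theorem exists_signMap {gr : ℤ → Submodule K N} (h : DirectSum.IsInternal gr) :
    ∃ L : N →ₗ[K] N, ∀ (i : ℤ) (x : N), x ∈ gr i → L x = i.negOnePow • x := by
  obtain ⟨L, hL⟩ := exists_linearMap_of_isInternal h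
    (fun i => ((i.negOnePow : ℤ) : K) • (gr i).subtype)
  refine ⟨L, fun i x hx => ?_⟩
  rw [hL i ⟨x, hx⟩, intUnits_smul_eq K]
  rfl

/-- The grading involution `x ↦ (-1) ^ |x| x`. -/
def signMap {gr : ℤ → Submodule K N} (h : DirectSum.IsInternal gr) : N →ₗ[K] N :=
  (exists_signMap h).choose

theorem signMap_apply {gr : ℤ → Submodule K N} (h : DirectSum.IsInternal gr) {i : ℤ} {x : N}
    (hx : x ∈ gr i) : signMap h x = i.negOnePow • x :=
  (exists_signMap h).choose_spec i x hx

/-- Each `P m` recovers the component of degree `m` of a sum, which gives independence; the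
homogeneous generators span. -/
theorem isInternal_of_projections {T : Type*} (g : T → N) (deg : T → ℤ)
    (hs : Submodule.span K (Set.range g) = ⊤) (P : ℤ → N →ₗ[K] N)
    (hP : ∀ m t, P m (g t) = if deg t = m then g t else 0) :
    DirectSum.IsInternal fun m => Submodule.span K {y | ∃ t, deg t = m ∧ y = g t} := by
  set gr : ℤ → Submodule K N := fun m => Submodule.span K {y | ∃ t, deg t = m ∧ y = g t} with hgr
  have hPgr : ∀ m i (x : N), x ∈ gr i → P m x = if i = m then x else 0 := by
    intro m i x hx
    refine Submodule.span_induction (p := fun x _ => P m x = if i = m then x else 0)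
      ?_ ?_ ?_ ?_ hx
    · rintro _ ⟨t, rfl, rfl⟩
      exact hP m t
    · simp
    · intro a b _ _ ha hb
      rw [map_add, ha, hb]
      split_ifs <;> simp
    · intro r a _ ha
      rw [map_smul, ha]
      split_ifs <;> simp
  have hcoe : ∀ (m : ℤ) (x : ⨁ i, gr i), P m (DirectSum.coeLinearMap gr x) = x m := by
    intro m x
    induction x using DirectSum.induction_on with
    | zero => simp
    | of i x =>
      rw [← DirectSum.lof_eq_of K, DirectSum.coeLinearMap_lof, hPgr m i x x.2, DirectSum.lof_eq_of]
      split_ifs with h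
      · subst h
        rw [DirectSum.of_eq_same]
      · rw [DirectSum.of_eq_of_ne _ _ _ (Ne.symm h)]
        rfl
    | add x y hx hy => rw [map_add, map_add, hx, hy]; rfl
  constructor
  · intro x y hxy
    ext m
    rw [← hcoe, ← hcoe]
    exact congrArg (P m) hxy
  · have : LinearMap.range (DirectSum.coeLinearMap gr) = ⊤ := by
      rw [eq_top_iff, ← hs, Submodule.span_le]
      rintro _ ⟨t, rfl⟩
      exact ⟨DirectSum.lof K ℤ (fun i => gr i) (deg t) ⟨g t, Submodule.subset_span ⟨t, rfl, rfl⟩⟩,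
        by simp⟩
    exact LinearMap.range_eq_top.1 this

/-- The relations between homogeneous elements: additivity and homogeneity in each degree. -/
inductive HomogRel (gr : ℤ → Submodule K N) : ((Σ i : ℤ, gr i) →₀ K) → Prop
  | add (i : ℤ) (a b : gr i) : HomogRel gr
      (Finsupp.single ⟨i, a + b⟩ 1 - (Finsupp.single ⟨i, a⟩ 1 + Finsupp.single ⟨i, b⟩ 1))
  | smul (i : ℤ) (r : K) (a : gr i) : HomogRel gr
      (Finsupp.single ⟨i, r • a⟩ 1 - r • Finsupp.single ⟨i, a⟩ 1)

theorem isPresentation_homog {gr : ℤ → Submodule K N} (h : DirectSum.IsInternal gr) :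
    IsPresentation (fun x : Σ i : ℤ, gr i => (x.2 : N)) (HomogRel gr) := by
  obtain ⟨L, hL⟩ := exists_linearMap_of_isInternal h (fun i =>
    { toFun := fun a : gr i => (Submodule.span K {f | HomogRel gr f}).mkQ
        (Finsupp.single (⟨i, a⟩ : Σ i : ℤ, gr i) 1)
      map_add' := fun a b => by
        rw [← map_add, ← sub_eq_zero, ← map_sub, Submodule.mkQ_apply, Submodule.Quotient.mk_eq_zero]
        exact Submodule.subset_span (HomogRel.add i a b)
      map_smul' := fun r a => by
        rw [RingHom.id_apply, ← map_smul, ← sub_eq_zero, ← map_sub, Submodule.mkQ_apply,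
          Submodule.Quotient.mk_eq_zero]
        exact Submodule.subset_span (HomogRel.smul i r a) })
  exact IsPresentation.of_linearMap (span_iUnion_of_isInternal h) L fun t => hL t.1 t.2

end Graded

/-! ## The free algebra as a graded algebra -/

theorem concat_update {T : Type*} {k : ℕ} {n : Fin k → ℕ} (x : ∀ i, Fin (n i) → T) (i : Fin k)
    (y : Fin (n i) → T) (j : Fin (n i)) (s : T) :
    concat (Function.update x i (Function.update y j s)) =
      Function.update (concat (Function.update x i y)) (finSigmaFinEquiv ⟨i, j⟩) s := by
  ext p
  obtain ⟨⟨l, a⟩, rfl⟩ := finSigmaFinEquiv.surjective p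
  rw [concat_finSigma]
  by_cases hl : l = i
  · subst hl
    rw [Function.update_self]
    by_cases ha : a = j
    · subst ha
      rw [Function.update_self, Function.update_self]
    · rw [Function.update_of_ne ha, Function.update_of_ne (by simpa using ha), concat_finSigma,
        Function.update_self]
  · rw [Function.update_of_ne hl, Function.update_of_ne (by simp [hl]), concat_finSigma,
      Function.update_of_ne hl]

theorem concat_comp {S T : Type*} {k : ℕ} {n : Fin k → ℕ} (φ : S → T) (x : ∀ i, Fin (n i) → S) :
    (fun p => φ (concat x p)) = concat (fun i j => φ (x i j)) := rfl

/-- Updating a corolla in a family changes an arity and with it the types of the inputs and of the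
operation. Here the arities are fixed beforehand, with `n i` that of the new corolla, so that the
update becomes an ordinary update of inputs and operations, to which multilinearity applies. -/
theorem Corolla.exists_update_eq {K : Type u} [Field K] {C : DGOperad.{u, v} K} {T : Type w} {k : ℕ}
    (t : Fin k → Corolla C T) (i : Fin k) (w : Corolla C T) :
    ∃ (n : Fin k → ℕ) (x : ∀ j, Fin (n j) → T) (b : ∀ j, C.HOp (n j)), n i = w.arity ∧
      ∀ (y : Fin (n i) → T) (c : C.HOp (n i)), Function.update t i ⟨n i, y, c⟩ =
        fun j => ⟨n j, Function.update x i y j, Function.update b i c j⟩ := by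
  refine ⟨fun j => (Function.update t i w j).arity, fun j => (Function.update t i w j).inp,
    fun j => (Function.update t i w j).op, by simp, fun y c => ?_⟩
  ext1 j
  by_cases hj : j = i
  · subst hj
    simp
  · simp only [Function.update_of_ne hj]
    rw [Function.update_of_ne hj]

section

variable {K : Type u} [Field K] {C : DGOperad.{u, v} K}

theorem DGOperad.update_coe {k : ℕ} {n : Fin k → ℕ} (b : ∀ j, C.HOp (n j)) (i : Fin k)
    (c : C.HOp (n i)) :
    (fun j => ((Function.update b i c j).2 : C.obj (n j))) =
      Function.update (fun j => ((b j).2 : C.obj (n j))) i (c.2 : C.obj (n i)) := by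
  ext1 j
  by_cases hj : j = i
  · subst hj
    rw [Function.update_self, Function.update_self]
  · rw [Function.update_of_ne hj, Function.update_of_ne hj]

theorem DGOperad.update_fst {k : ℕ} {n : Fin k → ℕ} (b : ∀ j, C.HOp (n j)) (i : Fin k)
    (c : C.HOp (n i)) :
    (fun j => (Function.update b i c j).1) = Function.update (fun j => (b j).1) i c.1 := by
  ext1 j
  by_cases hj : j = i
  · subst hj
    simp
  · simp [hj]

theorem span_HOp (n : ℕ) : Submodule.span K (Set.range fun c : C.HOp n => (c.2 : C.obj n)) = ⊤ :=
  span_iUnion_of_isInternal (C.isDG n).internal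

end

/-- The relations between corollas of homogeneous elements which define the free algebra. -/
inductive CorollaRel {K : Type u} [Field K] (C : DGOperad.{u, v} K) {N : Type w} [AddCommGroup N]
    [Module K N] (gr : ℤ → Submodule K N) : (Corolla C (Homog gr) →₀ K) → Prop
  | op_add (n : ℕ) (x : Fin n → Homog gr) (q : ℤ) (a b : C.gr n q) : CorollaRel C gr
      (Finsupp.single ⟨n, x, ⟨q, a + b⟩⟩ 1
        - (Finsupp.single ⟨n, x, ⟨q, a⟩⟩ 1 + Finsupp.single ⟨n, x, ⟨q, b⟩⟩ 1))
  | op_smul (n : ℕ) (x : Fin n → Homog gr) (q : ℤ) (r : K) (a : C.gr n q) : CorollaRel C gr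
      (Finsupp.single ⟨n, x, ⟨q, r • a⟩⟩ 1 - r • Finsupp.single ⟨n, x, ⟨q, a⟩⟩ 1)
  | inp_add (n : ℕ) (x : Fin n → Homog gr) (c : C.HOp n) (j : Fin n) (q : ℤ) (a b : gr q) :
      CorollaRel C gr (Finsupp.single ⟨n, Function.update x j ⟨q, a + b⟩, c⟩ 1
        - (Finsupp.single ⟨n, Function.update x j ⟨q, a⟩, c⟩ 1
          + Finsupp.single ⟨n, Function.update x j ⟨q, b⟩, c⟩ 1))
  | inp_smul (n : ℕ) (x : Fin n → Homog gr) (c : C.HOp n) (j : Fin n) (q : ℤ) (r : K) (a : gr q) :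
      CorollaRel C gr (Finsupp.single ⟨n, Function.update x j ⟨q, r • a⟩, c⟩ 1
        - r • Finsupp.single ⟨n, Function.update x j ⟨q, a⟩, c⟩ 1)
  | perm (n : ℕ) (x : Fin n → Homog gr) (c : C.HOp n) (σ : Equiv.Perm (Fin n)) : CorollaRel C gr
      (Finsupp.single ⟨n, x, C.actH σ c⟩ 1
        - (koszulExp σ fun i => (x i).1).negOnePow • Finsupp.single ⟨n, fun i => x (σ i), c⟩ 1)

/-! ### Presentation of the free algebra and the product of the monad -/

namespace FreeAlg

variable {K : Type u} [Field K] {C : DGOperad.{u, v} K} {N : Type w} [AddCommGroup N] [Module K N]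
  {gr : ℤ → Submodule K N}

variable (C gr) in
/-- `x_0 ⊗ ⋯ ⊗ x_{n-1} ⊗ c` as a multilinear map. -/
def pureM (n : ℕ) : MultilinearMap K (fun _ : Fin n => N) (C.obj n →ₗ[K] FreeAlg C gr) :=
  ((TensorProduct.mk K (⨂[K] _i : Fin n, N) (C.obj n)).compr₂
    ((freeRel C gr).mkQ ∘ₗ
      DirectSum.lof K ℕ (fun n => (⨂[K] _i : Fin n, N) ⊗[K] C.obj n) n)).compMultilinearMap
    (PiTensorProduct.tprod K)

theorem pureM_apply {n : ℕ} (x : Fin n → N) (c : C.obj n) : pureM C gr n x c = pure gr x c := rfl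

theorem linearMap_ext {X : Type*} [AddCommGroup X] [Module K X] {L L' : FreeAlg C gr →ₗ[K] X}
    (h : ∀ (n : ℕ) (x : Fin n → N) (c : C.obj n), L (pure gr x c) = L' (pure gr x c)) : L = L' := by
  refine Submodule.linearMap_qext _ ?_
  refine DirectSum.linearMap_ext K fun n => ?_
  refine TensorProduct.ext ?_
  refine PiTensorProduct.ext ?_
  ext x c
  exact h n x c

theorem linearMap_ext_of_span {T : Type*} {g : T → N} (hg : Submodule.span K (Set.range g) = ⊤)
    {X : Type*} [AddCommGroup X] [Module K X] {L L' : FreeAlg C gr →ₗ[K] X}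
    (h : ∀ (n : ℕ) (t : Fin n → T) (c : C.HOp n),
      L (pure gr (fun i => g (t i)) (c.2 : C.obj n)) =
        L' (pure gr (fun i => g (t i)) (c.2 : C.obj n))) : L = L' := by
  refine linearMap_ext fun n x c => ?_
  have : (LinearMap.compRight K L).compMultilinearMap (pureM C gr n) =
      (LinearMap.compRight K L').compMultilinearMap (pureM C gr n) := by
    refine multilinearMap_ext_of_span _ _ hg fun t => ?_
    refine _root_.linearMap_ext_of_span (span_HOp n) fun c => ?_
    exact h n t c
  exact LinearMap.congr_fun (congrArg (fun M => M x) this) c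

theorem span_pure {T : Type*} {g : T → N} (hg : Submodule.span K (Set.range g) = ⊤) :
    Submodule.span K (Set.range fun z : Corolla C T =>
      pure gr (fun i => g (z.inp i)) (z.op.2 : C.obj z.arity)) = ⊤ := by
  rw [← Submodule.ker_mkQ (Submodule.span K _), LinearMap.ker_eq_top]
  refine linearMap_ext_of_span hg fun n t c => ?_
  rw [LinearMap.zero_apply, Submodule.mkQ_apply, Submodule.Quotient.mk_eq_zero]
  exact Submodule.subset_span ⟨⟨n, t, c⟩, rfl⟩

theorem span_cls (h : DirectSum.IsInternal gr) :
    Submodule.span K (Set.range fun z : Corolla C (Homog gr) => cls z) = ⊤ :=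
  span_pure (C := C) (gr := gr) (g := fun x : Homog gr => (x.2 : N)) (span_iUnion_of_isInternal h)

theorem exists_linearMap {X : Type*} [AddCommGroup X] [Module K X]
    (f : ∀ n, MultilinearMap K (fun _ : Fin n => N) (C.obj n →ₗ[K] X))
    (hf : ∀ (n : ℕ) (σ : Equiv.Perm (Fin n)) (x : Fin n → Homog gr) (c : C.obj n),
      f n (fun i => ((x i).2 : N)) (C.act σ c) =
        (koszulExp σ fun i => (x i).1).negOnePow • f n (fun i => ((x (σ i)).2 : N)) c) :
    ∃ L : FreeAlg C gr →ₗ[K] X, ∀ (n : ℕ) (x : Fin n → N) (c : C.obj n),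
      L (pure gr x c) = f n x c := by
  let L0 : PreFree C N →ₗ[K] X := DirectSum.toModule K ℕ X fun n =>
    TensorProduct.lift (PiTensorProduct.lift (f n))
  have hL0 : ∀ (n : ℕ) (x : Fin n → N) (c : C.obj n), L0 (PreFree.pure C x c) = f n x c := by
    intro n x c
    refine (DirectSum.toModule_lof K (M := fun n => (⨂[K] _i : Fin n, N) ⊗[K] C.obj n) n _).trans ?_
    rw [TensorProduct.lift.tmul, PiTensorProduct.lift.tprod]
  have hker : freeRel C gr ≤ LinearMap.ker L0 := by
    refine Submodule.span_le.2 ?_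
    rintro _ ⟨n, σ, x, c, rfl⟩
    rw [SetLike.mem_coe, LinearMap.mem_ker, map_sub, intUnits_smul_eq K, map_smul, hL0, hL0, hf,
      intUnits_smul_eq K, sub_self]
  exact ⟨(freeRel C gr).liftQ L0 hker, hL0⟩

theorem pure_perm {n : ℕ} (σ : Equiv.Perm (Fin n)) (x : Fin n → N) (c : C.obj n) (e : Fin n → ℤ)
    (hx : ∀ i, x i ∈ gr (e i)) :
    pure gr x (C.act σ c) = (koszulExp σ e).negOnePow • pure gr (fun i => x (σ i)) c := by
  have h : PreFree.pure C x (C.act σ c) - ((((koszulExp σ e).negOnePow : ℤ) : K)) •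
      PreFree.pure C (fun i => x (σ i)) c ∈ freeRel C gr := by
    rw [← intUnits_smul_eq K]
    exact Submodule.subset_span ⟨n, σ, fun i => ⟨e i, x i, hx i⟩, c, rfl⟩
  rw [← sub_eq_zero, intUnits_smul_eq K]
  exact (Submodule.Quotient.mk_eq_zero _).2 h

theorem pure_act {m n : ℕ} (σ : Fin m ≃ Fin n) (x : Fin n → N) (c : C.obj m) (e : Fin n → ℤ)
    (hx : ∀ i, x i ∈ gr (e i)) :
    pure gr x (C.act σ c) = (equivKoszulExp σ e).negOnePow • pure gr (fun i => x (σ i)) c := by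
  obtain rfl : m = n := by simpa using Fintype.card_congr σ
  rw [← koszulExp_eq]
  exact pure_perm σ x c e hx

theorem pure_finCongr {m n : ℕ} (h : m = n) (x : Fin n → N) (c : C.obj m) :
    pure gr x (C.act (finCongr h) c) = pure gr (fun i => x (Fin.cast h i)) c := by
  subst h
  have : finCongr (rfl : m = m) = Equiv.refl _ := by ext; simp
  rw [this, C.act_refl]
  rfl

/-- The inverse map is built in layers, each using one kind of relation: linear in the operation for
fixed inputs, then multilinear in the inputs, then descending to coinvariants. -/
theorem isPresentation_cls (h : DirectSum.IsInternal gr) :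
    IsPresentation (K := K) (fun z : Corolla C (Homog gr) => cls z) (CorollaRel C gr) := by
  set Q := Submodule.span K {f | CorollaRel C gr f}
  have h0 : ∀ f, CorollaRel C gr f → Q.mkQ f = 0 := by
    intro f hf
    rw [Submodule.mkQ_apply, Submodule.Quotient.mk_eq_zero]
    exact Submodule.subset_span hf
  have h1 : ∀ (n : ℕ) (x : Fin n → Homog gr), ∃ L : C.obj n →ₗ[K] _ ⧸ Q, ∀ c : C.HOp n,
      L c.2 = Q.mkQ (Finsupp.single ⟨n, x, c⟩ 1) := by
    intro n x
    refine (isPresentation_homog (C.isDG n).internal).exists_linearMap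
      (fun c => Q.mkQ (Finsupp.single ⟨n, x, c⟩ 1)) ?_
    intro f hf
    cases hf with
    | add i a b => simpa using h0 _ (CorollaRel.op_add n x i a b)
    | smul i r a =>
      have h3 := h0 _ (CorollaRel.op_smul n x i r a)
      rw [map_sub, map_smul] at h3
      simpa only [map_sub, map_smul, Finsupp.linearCombination_single, one_smul] using h3
  choose L hL using h1
  have h2 : ∀ n : ℕ, ∃ M : MultilinearMap K (fun _ : Fin n => N) (C.obj n →ₗ[K] _ ⧸ Q),
      ∀ x : Fin n → Homog gr, M (fun i => ((x i).2 : N)) = L n x := by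
    intro n
    refine (isPresentation_homog h).exists_multilinearMap (L n) ?_
    intro x j f hf
    refine _root_.linearMap_ext_of_span (span_HOp n) fun c => ?_
    cases hf with
    | add i a b => simpa [hL] using h0 _ (CorollaRel.inp_add n x c j i a b)
    | smul i r a =>
      have h3 := h0 _ (CorollaRel.inp_smul n x c j i r a)
      rw [map_sub, map_smul] at h3
      simpa only [map_sub, map_smul, Finsupp.linearCombination_single, one_smul,
        LinearMap.sub_apply, LinearMap.smul_apply, hL, LinearMap.zero_apply] using h3
  choose M hM using h2
  obtain ⟨Ψ, hΨ⟩ := exists_linearMap (gr := gr) M (by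
    intro n σ x c
    rw [hM, hM]
    have : L n x ∘ₗ C.act σ = (((koszulExp σ fun i => (x i).1).negOnePow : ℤ) : K) •
        L n (fun i => x (σ i)) := by
      refine _root_.linearMap_ext_of_span (span_HOp n) fun c => ?_
      have h3 := h0 _ (CorollaRel.perm n x c σ)
      rw [map_sub, intUnits_smul_eq K, map_smul, ← hL, ← hL, sub_eq_zero] at h3
      exact h3
    rw [intUnits_smul_eq K]
    exact LinearMap.congr_fun this c)
  refine IsPresentation.of_linearMap (span_cls h) Ψ fun z => ?_
  rw [cls, hΨ, hM, hL]

/-- The value of the product of the monad on corollas of given arities. -/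
def graftValue {k : ℕ} {n : Fin k → ℕ} (x : ∀ i, Fin (n i) → Homog gr) (b : ∀ i, C.HOp (n i)) :
    C.obj k →ₗ[K] FreeAlg C gr :=
  (((shuffleExp (fun i => (b i).1) (fun i => ∑ q, (x i q).1)).negOnePow : ℤ) : K) •
    (pureM C gr _ (concat fun i q => ((x i q).2 : N)) ∘ₗ C.γ n (fun i => ((b i).2 : C.obj (n i))))

theorem graftValue_op {k : ℕ} {n : Fin k → ℕ} (x : ∀ i, Fin (n i) → Homog gr)
    (b : ∀ i, C.HOp (n i)) (i : Fin k) (q : ℤ) (a : C.gr (n i) q) :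
    graftValue x (Function.update b i ⟨q, a⟩) =
      (((shuffleExp (Function.update (fun i => (b i).1) i q)
          (fun i => ∑ q, (x i q).1)).negOnePow : ℤ) : K) •
      (pureM C gr _ (concat fun i q => ((x i q).2 : N)) ∘ₗ
        C.γ n (Function.update (fun j => ((b j).2 : C.obj (n j))) i a)) := by
  rw [graftValue, DGOperad.update_fst, DGOperad.update_coe]

theorem graftValue_inp {k : ℕ} {n : Fin k → ℕ} (x : ∀ i, Fin (n i) → Homog gr)
    (b : ∀ i, C.HOp (n i)) (i : Fin k) (y : Fin (n i) → Homog gr) (j : Fin (n i)) (q : ℤ)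
    (a : gr q) :
    graftValue (Function.update x i (Function.update y j ⟨q, a⟩)) b =
      (((shuffleExp (fun i => (b i).1) (Function.update (fun l => ∑ q, (x l q).1) i
          (∑ l, Function.update (fun l => (y l).1) j q l))).negOnePow : ℤ) : K) •
      (pureM C gr _ (Function.update (concat fun l q => ((Function.update x i y l q).2 : N))
          (finSigmaFinEquiv ⟨i, j⟩) a) ∘ₗ C.γ n (fun i => ((b i).2 : C.obj (n i)))) := by
  rw [graftValue]
  congr 4
  · congr 3
    ext1 l
    by_cases hl : l = i
    · subst hl
      rw [Function.update_self, Function.update_self]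
      refine Finset.sum_congr rfl fun p _ => ?_
      by_cases hp : p = j
      · subst hp; simp
      · simp [hp]
    · simp [hl]
  · rw [← concat_comp (fun s : Homog gr => (s.2 : N)), concat_update,
      ← concat_comp (fun s : Homog gr => (s.2 : N))]
    ext1 p
    by_cases hp : p = finSigmaFinEquiv ⟨i, j⟩
    · subst hp
      rw [Function.update_self, Function.update_self]
    · rw [Function.update_of_ne hp, Function.update_of_ne hp]

/-- The permutation σ is extended by identities to a block sum, which `γ_perm_inner` carries to the
composite operation. The Koszul sign of the block sum is that of σ, and the shuffle sign is
unaffected because it involves only the total degree of the inputs of each corolla. -/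
theorem graftValue_perm {k : ℕ} {n : Fin k → ℕ} (x : ∀ i, Fin (n i) → Homog gr)
    (b : ∀ i, C.HOp (n i)) (i : Fin k) (y : Fin (n i) → Homog gr) (c : C.HOp (n i))
    (σ : Equiv.Perm (Fin (n i))) :
    graftValue (Function.update x i y) (Function.update b i (C.actH σ c)) =
      (((koszulExp σ fun j => (y j).1).negOnePow : ℤ) : K) •
        graftValue (Function.update x i (fun j => y (σ j))) (Function.update b i c) := by
  set τ : ∀ j, Equiv.Perm (Fin (n j)) := Function.update (fun _ => 1) i σ with hτ
  set X := Function.update x i y with hX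
  have hXσ : Function.update x i (fun j => y (σ j)) = fun l p => X l (τ l p) := by
    ext1 l
    by_cases hl : l = i
    · subst hl
      simp [hX, hτ]
    · simp [hX, hτ, hl]
  have hb : (fun j => ((Function.update b i (C.actH σ c) j).2 : C.obj (n j))) =
      fun j => C.act (τ j) ((Function.update b i c j).2 : C.obj (n j)) := by
    ext1 j
    by_cases hj : j = i
    · subst hj
      rw [Function.update_self, Function.update_self, hτ, Function.update_self]
      rfl
    · rw [Function.update_of_ne hj, Function.update_of_ne hj, hτ, Function.update_of_ne hj]
      exact (C.act_refl _ _).symm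
  have hdeg : (fun j => (Function.update b i (C.actH σ c) j).1) =
      fun j => (Function.update b i c j).1 := by
    rw [DGOperad.update_fst, DGOperad.update_fst]
    rfl
  have hk : ∑ l, koszulExp (τ l) (fun p => (X l p).1) = koszulExp σ fun j => (y j).1 := by
    rw [Finset.sum_eq_single i]
    · simp [hτ, hX]
    · intro l _ hl
      simp only [hτ, Function.update_of_ne hl]
      exact koszulExp_one _
    · simp
  have hs : (fun l => ∑ p, (X l (τ l p)).1) = fun l => ∑ p, (X l p).1 := by
    ext1 l
    exact Equiv.sum_comp (τ l) (fun p => (X l p).1)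
  refine LinearMap.ext fun c' => ?_
  rw [hXσ, graftValue, graftValue, hb, hdeg, hs]
  simp only [LinearMap.smul_apply, LinearMap.comp_apply, C.γ_perm_inner, pureM_apply]
  rw [pure_act (blockSum n τ) (concat fun l p => ((X l p).2 : N)) _ (concat fun l p => (X l p).1) (fun p => (concat X p).2.2),
    equivKoszulExp_blockSum, hk, intUnits_smul_eq K, smul_comm]
  congr 3
  exact concat_blockSum n τ fun l p => ((X l p).2 : N)

/-- The value of the product of the monad on corollas. -/
def graftCls {k : ℕ} (z : Fin k → Corolla C (Homog gr)) : C.obj k →ₗ[K] FreeAlg C gr :=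
  graftValue (fun i => (z i).inp) (fun i => (z i).op)

theorem graftCls_mk {k : ℕ} {n : Fin k → ℕ} (x : ∀ i, Fin (n i) → Homog gr)
    (b : ∀ i, C.HOp (n i)) : graftCls (fun i => ⟨n i, x i, b i⟩) = graftValue x b := rfl

/-- The value on corollas respects each relation in each variable, because its sign depends on
degrees only. -/
theorem exists_monadAction (h : DirectSum.IsInternal gr) :
    ∃ θ : ∀ n : ℕ, MultilinearMap K (fun _ : Fin n => FreeAlg C gr) (C.obj n →ₗ[K] FreeAlg C gr),
      IsMonadAction C gr θ := by
  have key : ∀ k : ℕ, ∃ M : MultilinearMap K (fun _ : Fin k => FreeAlg C gr)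
      (C.obj k →ₗ[K] FreeAlg C gr), ∀ z : Fin k → Corolla C (Homog gr),
        M (fun i => cls (z i)) = graftCls z := by
    intro k
    refine (isPresentation_cls h).exists_multilinearMap graftCls ?_
    intro t i f hf
    cases hf with
    | op_add m y q a b =>
      obtain ⟨n, x, b', rfl, hs⟩ := Corolla.exists_update_eq t i (⟨m, y, ⟨q, a⟩⟩ : Corolla C _)
      simp only [map_sub, map_add, Finsupp.linearCombination_single, one_smul, hs, graftCls_mk, graftValue_op,
        Submodule.coe_add, MultilinearMap.map_update_add, LinearMap.comp_add, smul_add, sub_self]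
    | op_smul m y q r a =>
      obtain ⟨n, x, b', rfl, hs⟩ := Corolla.exists_update_eq t i (⟨m, y, ⟨q, a⟩⟩ : Corolla C _)
      simp only [map_sub, map_smul, Finsupp.linearCombination_single, one_smul, hs, graftCls_mk, graftValue_op,
        Submodule.coe_smul, MultilinearMap.map_update_smul, LinearMap.comp_smul]
      rw [smul_comm, sub_self]
    | inp_add m y c j q a b =>
      obtain ⟨n, x, b', rfl, hs⟩ := Corolla.exists_update_eq t i (⟨m, y, c⟩ : Corolla C _)
      simp only [map_sub, map_add, Finsupp.linearCombination_single, one_smul, hs, graftCls_mk, graftValue_inp,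
        Submodule.coe_add, MultilinearMap.map_update_add, LinearMap.add_comp, smul_add, sub_self]
    | inp_smul m y c j q r a =>
      obtain ⟨n, x, b', rfl, hs⟩ := Corolla.exists_update_eq t i (⟨m, y, c⟩ : Corolla C _)
      simp only [map_sub, map_smul, Finsupp.linearCombination_single, one_smul, hs, graftCls_mk, graftValue_inp,
        Submodule.coe_smul, MultilinearMap.map_update_smul, LinearMap.smul_comp]
      rw [smul_comm, sub_self]
    | perm m y c σ =>
      obtain ⟨n, x, b', rfl, hs⟩ := Corolla.exists_update_eq t i (⟨m, y, c⟩ : Corolla C _)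
      rw [intUnits_smul_eq K]
      simp only [map_sub, map_smul, Finsupp.linearCombination_single, one_smul, hs,
        graftCls_mk, graftValue_perm, sub_self]
  choose M hM using key
  refine ⟨M, fun k z c => ?_⟩
  rw [hM, graftCls, graftValue, intUnits_smul_eq K]
  rfl

variable (C) in
/-- The `C`-algebra structure of `C N`. -/
def action (h : DirectSum.IsInternal gr) (n : ℕ) :
    MultilinearMap K (fun _ : Fin n => FreeAlg C gr) (C.obj n →ₗ[K] FreeAlg C gr) :=
  (exists_monadAction h).choose n

theorem action_isMonadAction (h : DirectSum.IsInternal gr) : IsMonadAction C gr (action C h) :=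
  (exists_monadAction h).choose_spec

end FreeAlg

/-- Associativity of concatenation. The two arities are equal only propositionally, hence the cast;
positions are compared through their values. -/
theorem concat_concat {T : Type*} {k : ℕ} {n : Fin k → ℕ} {m : ∀ i, Fin (n i) → ℕ}
    (x : ∀ i j, Fin (m i j) → T) :
    (fun q => concat (n := fun i => ∑ j, m i j) (fun i => concat (x i))
      (Fin.cast (sum_concat_arity n m) q)) =
    concat (n := concat m)
      (fun p => x (finSigmaFinEquiv.symm p).1 (finSigmaFinEquiv.symm p).2) := by
  ext q
  obtain ⟨⟨p, a⟩, rfl⟩ := finSigmaFinEquiv.surjective q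
  refine Eq.trans ?_ (concat_finSigma (n := concat m)
    (fun p => x (finSigmaFinEquiv.symm p).1 (finSigmaFinEquiv.symm p).2) p a).symm
  have hp : p = finSigmaFinEquiv ⟨(finSigmaFinEquiv.symm p).1, (finSigmaFinEquiv.symm p).2⟩ :=
    (finSigmaFinEquiv.apply_symm_apply p).symm
  -- `a'` is `a` with its type unfolded to the arity of a single inner block.
  obtain ⟨a', ha, hx⟩ : ∃ a' : Fin (m (finSigmaFinEquiv.symm p).1 (finSigmaFinEquiv.symm p).2),
      (a' : ℕ) = a ∧ x (finSigmaFinEquiv.symm p).1 (finSigmaFinEquiv.symm p).2 a' =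
        (fun p => x (finSigmaFinEquiv.symm p).1 (finSigmaFinEquiv.symm p).2) p a := ⟨a, rfl, rfl⟩
  have h : Fin.cast (sum_concat_arity n m) (finSigmaFinEquiv ⟨p, a⟩) =
      finSigmaFinEquiv (n := fun i => ∑ j, m i j) ⟨(finSigmaFinEquiv.symm p).1,
        finSigmaFinEquiv (n := m (finSigmaFinEquiv.symm p).1)
          ⟨(finSigmaFinEquiv.symm p).2, a'⟩⟩ := by
    refine Fin.ext ?_
    rw [Fin.val_cast, finSigmaFinEquiv_val, finSigmaFinEquiv_val, finSigmaFinEquiv_val, ← add_assoc,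
      ha]
    congr 1
    conv_lhs => rw [hp]
    exact sum_Iio_finSigma m _ _
  rw [h, concat_finSigma, concat_finSigma]
  exact hx

theorem linearMap_intUnits_smul {K : Type*} [Field K] {N X : Type*} [AddCommGroup N] [Module K N]
    [AddCommGroup X] [Module K X] (L : N →ₗ[K] X) (s : ℤˣ) (x : N) : L (s • x) = s • L x := by
  rw [intUnits_smul_eq K, intUnits_smul_eq K, map_smul]

theorem multilinearMap_negOnePow_smul {K : Type*} [Field K] {n : ℕ} {N X : Type*} [AddCommGroup N]
    [Module K N] [AddCommGroup X] [Module K X] (f : MultilinearMap K (fun _ : Fin n => N) X)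
    (s : Fin n → ℤ) (x : Fin n → N) :
    f (fun i => (s i).negOnePow • x i) = (∑ i, s i).negOnePow • f x := by
  simp only [intUnits_smul_eq K]
  rw [f.map_smul_univ]
  congr 1
  have : ∀ t : Finset (Fin n), (((∑ i ∈ t, s i).negOnePow : ℤ) : K) =
      ∏ i ∈ t, (((s i).negOnePow : ℤ) : K) := by
    intro t
    induction t using Finset.induction_on with
    | empty => simp
    | insert i t hi ih =>
      rw [Finset.sum_insert hi, Finset.prod_insert hi, Int.negOnePow_add, ← ih]
      push_cast
      rfl
  exact (this _).symm

/-! ### Graded algebras over the operad -/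

section

variable {K : Type u} [Field K] (C : DGOperad.{u, v} K) {B : Type w} [AddCommGroup B] [Module K B]

/-- `(B, gr)` with the operations `θ` is a graded `C`-algebra. -/
structure IsGradedAlgebra (gr : ℤ → Submodule K B)
    (θ : ∀ n : ℕ, MultilinearMap K (fun _ : Fin n => B) (C.obj n →ₗ[K] B)) : Prop where
  internal : DirectSum.IsInternal gr
  θ_mem : ∀ (n : ℕ) (x : Fin n → B) (c : C.obj n) (e : Fin n → ℤ) (q : ℤ),
    (∀ i, x i ∈ gr (e i)) → c ∈ C.gr n q → θ n x c ∈ gr ((∑ i, e i) + q)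
  θ_one : ∀ x : B, θ 1 (fun _ => x) C.one = x
  θ_assoc : ∀ (k : ℕ) (n : Fin k → ℕ) (x : ∀ i, Fin (n i) → B) (b : ∀ i, C.obj (n i))
    (c : C.obj k) (e : ∀ i, Fin (n i) → ℤ) (eb : Fin k → ℤ),
    (∀ i j, x i j ∈ gr (e i j)) → (∀ i, b i ∈ C.gr (n i) (eb i)) →
    θ k (fun i => θ (n i) (x i) (b i)) c =
      (shuffleExp eb (fun i => ∑ j, e i j)).negOnePow • θ (∑ i, n i) (concat x) (C.γ n b c)
  θ_perm : ∀ (n : ℕ) (x : Fin n → B) (c : C.obj n) (e : Fin n → ℤ) (σ : Equiv.Perm (Fin n)),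
    (∀ i, x i ∈ gr (e i)) →
    θ n x (C.act σ c) = (koszulExp σ e).negOnePow • θ n (fun i => x (σ i)) c

variable {C}

theorem IsDGAlgebra.isGradedAlgebra {gr : ℤ → Submodule K B} {d : B →ₗ[K] B}
    {θ : ∀ n : ℕ, MultilinearMap K (fun _ : Fin n => B) (C.obj n →ₗ[K] B)}
    (h : IsDGAlgebra C gr d θ) : IsGradedAlgebra C gr θ :=
  ⟨h.isDG.internal, h.θ_mem, h.θ_one, h.θ_assoc, h.θ_perm⟩

/-- The operation of `B` given by `c`. -/
def opMap (θ : ∀ n : ℕ, MultilinearMap K (fun _ : Fin n => B) (C.obj n →ₗ[K] B)) {n : ℕ}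
    (c : C.obj n) : MultilinearMap K (fun _ : Fin n => B) B :=
  (LinearMap.applyₗ c).compMultilinearMap (θ n)

theorem opMap_apply (θ : ∀ n : ℕ, MultilinearMap K (fun _ : Fin n => B) (C.obj n →ₗ[K] B)) {n : ℕ}
    (c : C.obj n) (x : Fin n → B) : opMap θ c x = θ n x c := rfl

end

/-! ### The algebra axioms for the product of the monad -/

namespace FreeAlg

variable {K : Type u} [Field K] {C : DGOperad.{u, v} K} {N : Type w} [AddCommGroup N] [Module K N]
  {gr : ℤ → Submodule K N}

theorem pure_intUnits_smul {n : ℕ} (x : Fin n → N) (s : ℤˣ) (c : C.obj n) :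
    pure gr x (s • c) = s • pure gr x c :=
  linearMap_intUnits_smul (pureM C gr n x) s c

/-- The degree of a corolla of homogeneous elements. -/
def clsDeg (z : Corolla C (Homog gr)) : ℤ := (∑ i, (z.inp i).1) + z.op.1

theorem cls_mem (z : Corolla C (Homog gr)) : cls z ∈ deg C gr (clsDeg z) :=
  Submodule.subset_span ⟨z, rfl, rfl⟩

theorem pure_mem {n : ℕ} {x : Fin n → N} {c : C.obj n} {e : Fin n → ℤ} {q : ℤ}
    (hx : ∀ i, x i ∈ gr (e i)) (hc : c ∈ C.gr n q) : pure gr x c ∈ deg C gr ((∑ i, e i) + q) :=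
  cls_mem (⟨n, fun i => ⟨e i, x i, hx i⟩, ⟨q, c, hc⟩⟩ : Corolla C (Homog gr))

theorem update_homog_coe {n : ℕ} (x : Fin n → Homog gr) (j : Fin n) (s : Homog gr) :
    (fun i => ((Function.update x j s i).2 : N)) =
      Function.update (fun i => ((x i).2 : N)) j (s.2 : N) := by
  ext1 i
  by_cases hi : i = j
  · subst hi
    rw [Function.update_self, Function.update_self]
  · rw [Function.update_of_ne hi, Function.update_of_ne hi]

theorem sum_update_homog {n : ℕ} (x : Fin n → Homog gr) (j : Fin n) (s : Homog gr) :
    ∑ i, (Function.update x j s i).1 = ∑ i, (x i).1 + (s.1 - (x j).1) := by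
  rw [← sum_update (fun i => (x i).1)]
  refine Finset.sum_congr rfl fun i _ => ?_
  by_cases hi : i = j
  · subst hi; simp
  · simp [hi]

/-- All corollas in one relation have the same degree, so the projection to a degree descends to the
quotient. -/
theorem deg_isInternal (h : DirectSum.IsInternal gr) : DirectSum.IsInternal (deg C gr) := by
  have key : ∀ m : ℤ, ∃ P : FreeAlg C gr →ₗ[K] FreeAlg C gr, ∀ z : Corolla C (Homog gr),
      P (cls z) = if clsDeg z = m then cls z else 0 := by
    intro m
    refine (isPresentation_cls h).exists_linearMap _ fun f hf => ?_
    cases hf with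
    | op_add n x q a b =>
      simp only [map_sub, map_add, Finsupp.linearCombination_single, one_smul, clsDeg]
      split_ifs
      · simp only [cls, ← pureM_apply, Submodule.coe_add, map_add, sub_self]
      · simp
    | op_smul n x q r a =>
      simp only [map_sub, map_smul, Finsupp.linearCombination_single, one_smul, clsDeg]
      split_ifs
      · simp only [cls, ← pureM_apply, Submodule.coe_smul, map_smul, sub_self]
      · simp
    | inp_add n x c j q a b =>
      simp only [map_sub, map_add, Finsupp.linearCombination_single, one_smul, clsDeg,
        sum_update_homog]
      split_ifs
      · simp only [cls, ← pureM_apply, update_homog_coe, Submodule.coe_add,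
          MultilinearMap.map_update_add, LinearMap.add_apply, sub_self]
      · simp
    | inp_smul n x c j q r a =>
      simp only [map_sub, map_smul, Finsupp.linearCombination_single, one_smul, clsDeg,
        sum_update_homog]
      split_ifs
      · simp only [cls, ← pureM_apply, update_homog_coe, Submodule.coe_smul,
          MultilinearMap.map_update_smul, LinearMap.smul_apply, sub_self]
      · simp
    | perm n x c σ =>
      rw [intUnits_smul_eq K]
      simp only [map_sub, map_smul, Finsupp.linearCombination_single, one_smul, clsDeg,
        Equiv.sum_comp σ fun i => (x i).1, DGOperad.actH]
      split_ifs
      · rw [sub_eq_zero, ← intUnits_smul_eq K]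
        exact pure_perm σ _ _ _ fun i => (x i).2.2
      · simp
  choose P hP using key
  exact isInternal_of_projections _ clsDeg (span_cls h) P hP

theorem action_cls (h : DirectSum.IsInternal gr) {k : ℕ} (z : Fin k → Corolla C (Homog gr)) :
    action C h k (fun i => cls (z i)) = graftCls z := by
  refine _root_.linearMap_ext_of_span (span_HOp k) fun c => ?_
  rw [action_isMonadAction h, graftCls, graftValue, intUnits_smul_eq K]
  rfl

theorem clsDeg_graft {k : ℕ} (z : Fin k → Corolla C (Homog gr)) (c : C.HOp k) :
    clsDeg (Corolla.graft z c) = ∑ i, clsDeg (z i) + c.1 := by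
  have h : ∑ p, ((Corolla.graft z c).inp p).1 = ∑ i, ∑ q, ((z i).inp q).1 :=
    sum_concat fun i q => ((z i).inp q).1
  simp only [clsDeg, Finset.sum_add_distrib, h]
  rw [add_assoc]
  rfl

theorem action_mem (h : DirectSum.IsInternal gr) (n : ℕ) (x : Fin n → FreeAlg C gr) (c : C.obj n)
    (e : Fin n → ℤ) (q : ℤ) (hx : ∀ i, x i ∈ deg C gr (e i)) (hc : c ∈ C.gr n q) :
    action C h n x c ∈ deg C gr ((∑ i, e i) + q) := by
  -- Membership in the graded piece is vanishing in the quotient by it, an equation of multilinear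
  -- maps that can be checked on classes of corollas.
  have := multilinearMap_eq_of_mem_span
    ((deg C gr ((∑ i, e i) + q)).mkQ.compMultilinearMap (opMap (action C h) c)) 0
    (fun i => {y | ∃ z : Corolla C (Homog gr), clsDeg z = e i ∧ y = cls z}) ?_ x hx
  · exact (Submodule.Quotient.mk_eq_zero _).1 this
  · intro y hy
    choose z hz hyz using hy
    obtain rfl := funext hyz
    rw [LinearMap.compMultilinearMap_apply, opMap_apply]
    refine (Submodule.Quotient.mk_eq_zero _).2 ?_
    have h1 := action_isMonadAction h n z ⟨q, c, hc⟩
    rw [h1, intUnits_smul_eq K]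
    refine Submodule.smul_mem _ _ ?_
    have h2 := cls_mem (Corolla.graft z (⟨q, c, hc⟩ : C.HOp n))
    rwa [clsDeg_graft, Finset.sum_congr rfl fun i _ => hz i] at h2

theorem action_one (h : DirectSum.IsInternal gr) (x : FreeAlg C gr) :
    action C h 1 (fun _ => x) C.one = x := by
  have key : (opMap (action C h) C.one).toLinearMap (fun _ => 0) 0 = LinearMap.id := by
    refine _root_.linearMap_ext_of_span (span_cls h) fun z => ?_
    have h0 : Function.update (fun _ : Fin 1 => (0 : FreeAlg C gr)) 0 (cls z) = fun _ => cls z := by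
      ext1 i
      rw [Subsingleton.elim i 0, Function.update_self]
    rw [MultilinearMap.toLinearMap_apply, h0, opMap_apply, LinearMap.id_apply,
      action_cls h (fun _ => z), graftCls, graftValue]
    have h1 : shuffleExp (fun _ : Fin 1 => z.op.1) (fun _ => ∑ q, (z.inp q).1) = 0 := by
      simp [shuffleExp]
    rw [h1, Int.negOnePow_zero, Units.val_one, Int.cast_one, one_smul, LinearMap.comp_apply,
      pureM_apply, cls]
    conv_rhs => rw [← C.γ_one_right (z.op.2 : C.obj z.arity), pure_finCongr]
    congr 1
    ext1 p
    obtain ⟨⟨i, a⟩, rfl⟩ := finSigmaFinEquiv.surjective p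
    rw [concat_finSigma]
    refine congrArg (fun q => ((z.inp q).2 : N)) (Fin.ext ?_)
    rw [Fin.val_cast, finSigmaFinEquiv_one]
  have := LinearMap.congr_fun key x
  rw [MultilinearMap.toLinearMap_apply, opMap_apply, LinearMap.id_apply] at this
  conv_rhs => rw [← this]
  congr 2
  ext1 i
  rw [Subsingleton.elim i 0, Function.update_self]

theorem action_assoc (h : DirectSum.IsInternal gr) (k : ℕ) (n : Fin k → ℕ)
    (x : ∀ i, Fin (n i) → FreeAlg C gr) (b : ∀ i, C.obj (n i)) (c : C.obj k)
    (e : ∀ i, Fin (n i) → ℤ) (eb : Fin k → ℤ) (hx : ∀ i j, x i j ∈ deg C gr (e i j))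
    (hb : ∀ i, b i ∈ C.gr (n i) (eb i)) :
    action C h k (fun i => action C h (n i) (x i) (b i)) c =
      (shuffleExp eb (fun i => ∑ j, e i j)).negOnePow •
        action C h (∑ i, n i) (concat x) (C.γ n b c) := by
  -- Both sides are multilinear in the family of all `x i j`, indexed by the sigma type; homogeneity
  -- reduces the equation to corollas, where the degrees fix the signs.
  have := multilinearMap_eq_of_mem_span
    ((opMap (action C h) c).compMultilinearMap (fun i => opMap (action C h) (b i)))
    ((((shuffleExp eb (fun i => ∑ j, e i j)).negOnePow : ℤ) : K) •
      (opMap (action C h) (C.γ n b c)).domDomCongr finSigmaFinEquiv.symm)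
    (fun p : Σ i, Fin (n i) => {y | ∃ z : Corolla C (Homog gr), clsDeg z = e p.1 p.2 ∧ y = cls z})
    ?_ (fun p => x p.1 p.2) (fun p => hx p.1 p.2)
  · rw [smul_apply, ← intUnits_smul_eq K] at this
    exact this
  intro y hy
  choose z' hz' hyz using hy
  obtain rfl := funext hyz
  set z : ∀ i, Fin (n i) → Corolla C (Homog gr) := fun i j => z' ⟨i, j⟩ with hzdef
  have hz : ∀ i j, clsDeg (z i j) = e i j := fun i j => hz' ⟨i, j⟩
  let bH : ∀ i, C.HOp (n i) := fun i => ⟨eb i, b i, hb i⟩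
  rw [smul_apply, ← intUnits_smul_eq K]
  change action C h k (fun i => action C h (n i) (fun j => cls (z i j)) ((bH i).2 : C.obj (n i))) c =
    _ • action C h _ (fun p => cls (concat z p)) (C.γ n b c)
  simp only [action_isMonadAction h _ _ (bH _)]
  rw [← opMap_apply, multilinearMap_negOnePow_smul, opMap_apply, action_cls, action_cls,
    graftCls, graftCls, graftValue, graftValue, LinearMap.smul_apply, LinearMap.smul_apply,
    ← intUnits_smul_eq K, ← intUnits_smul_eq K, LinearMap.comp_apply, LinearMap.comp_apply,
    pureM_apply, pureM_apply, negOnePow_smul_smul, negOnePow_smul_smul]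
  have hγ := C.γ_assoc n (fun i j => (z i j).arity) (fun i j => ((z i j).op.2 : C.obj _)) b c
    (fun i j => (z i j).op.1) eb (fun i j => (z i j).op.2.2) hb
  have hsum : ∑ p, (concat z p).arity = ∑ i, (Corolla.graft (z i) (bH i)).arity :=
    sum_concat_arity n (fun i j => (z i j).arity)
  have hγ' : C.γ (fun i => (Corolla.graft (z i) (bH i)).arity)
      (fun i => ((Corolla.graft (z i) (bH i)).op.2 : C.obj (Corolla.graft (z i) (bH i)).arity)) c =
      (shuffleExp eb fun i => ∑ j, (z i j).op.1).negOnePow •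
        C.act (finCongr hsum)
          (C.γ (fun p => (concat z p).arity) (fun p => ((concat z p).op.2 : C.obj _))
            (C.γ n b c)) := hγ
  have hin : (fun q => concat (fun i q => ((((Corolla.graft (z i) (bH i)).inp q).2 : N)))
      (Fin.cast hsum q)) =
      concat (fun p q => (((concat z p).inp q).2 : N)) :=
    concat_concat (fun i j q => (((z i j).inp q).2 : N))
  rw [hγ', pure_intUnits_smul, pure_finCongr, negOnePow_smul_smul, hin]
  congr 1
  -- The operation and the inputs of a grafted corolla have as degrees the sums over its parts.
  -- Biadditivity then splits the shuffle exponents of both sides into the same terms.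
  have e1 : (fun i => (Corolla.graft (z i) (bH i)).op.1) =
      fun i => (∑ j, (z i j).op.1) + eb i := rfl
  have e2 : (fun i => ∑ q, ((Corolla.graft (z i) (bH i)).inp q).1) =
      fun i => ∑ j, ∑ q, ((z i j).inp q).1 := by
    ext1 i
    exact sum_concat fun j q => ((z i j).inp q).1
  have e3 : shuffleExp (fun p => (concat z p).op.1) (fun p => ∑ q, ((concat z p).inp q).1) =
      ∑ i, shuffleExp (fun j => (z i j).op.1) (fun j => ∑ q, ((z i j).inp q).1)
        + shuffleExp (fun i => ∑ j, (z i j).op.1) (fun i => ∑ j, ∑ q, ((z i j).inp q).1) :=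
    shuffleExp_concat (fun i j => (z i j).op.1) (fun i j => ∑ q, ((z i j).inp q).1)
  have e4 : (fun i => ∑ j, e i j) =
      fun i => (∑ j, ∑ q, ((z i j).inp q).1) + ∑ j, (z i j).op.1 := by
    ext1 i
    rw [← Finset.sum_add_distrib]
    exact Finset.sum_congr rfl fun j _ => (hz i j).symm
  rw [e1, e2, e3, e4, shuffleExp_add_left, shuffleExp_add_right]
  congr 1
  ring

/-- `γ_perm` gives the Koszul sign of the operations and the block permutation that of the inputs;
`negOnePow_shuffleExp_perm` combines these with the two shuffle signs into the Koszul sign of the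
corollas. -/
theorem action_perm (h : DirectSum.IsInternal gr) (n : ℕ) (x : Fin n → FreeAlg C gr) (c : C.obj n)
    (e : Fin n → ℤ) (σ : Equiv.Perm (Fin n)) (hx : ∀ i, x i ∈ deg C gr (e i)) :
    action C h n x (C.act σ c) = (koszulExp σ e).negOnePow • action C h n (fun i => x (σ i)) c := by
  have := multilinearMap_eq_of_mem_span (opMap (action C h) (C.act σ c))
    ((((koszulExp σ e).negOnePow : ℤ) : K) • (opMap (action C h) c).domDomCongr σ)
    (fun i => {y | ∃ z : Corolla C (Homog gr), clsDeg z = e i ∧ y = cls z}) ?_ x hx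
  · rw [smul_apply, ← intUnits_smul_eq K] at this
    exact this
  intro y hy
  choose z hz hyz using hy
  obtain rfl := funext hyz
  rw [smul_apply, ← intUnits_smul_eq K, MultilinearMap.domDomCongr_apply,
    opMap_apply, opMap_apply, action_cls, action_cls h (fun i => z (σ i)), graftCls, graftCls,
    graftValue, graftValue, LinearMap.smul_apply, LinearMap.smul_apply,
    ← intUnits_smul_eq K, ← intUnits_smul_eq K, LinearMap.comp_apply, LinearMap.comp_apply,
    pureM_apply, pureM_apply,
    C.γ_perm _ _ _ (fun i => (z i).op.1) σ (fun i => (z i).op.2.2), pure_intUnits_smul,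
    pure_act (blockPerm (fun i => (z i).arity) σ) (concat fun i q => (((z i).inp q).2 : N)) _ (concat fun i q => ((z i).inp q).1)
      (fun p => ((concat (fun i => (z i).inp)) p).2.2), equivKoszulExp_blockPerm,
    negOnePow_smul_smul, negOnePow_smul_smul, negOnePow_smul_smul]
  have h1 := concat_blockPerm (fun i => (z i).arity) σ fun i q => (((z i).inp q).2 : N)
  have h2 : (fun p => concat (fun i q => (((z i).inp q).2 : N))
      (blockPerm (fun i => (z i).arity) σ p)) = _ := h1
  rw [h2]
  congr 1
  have h3 := negOnePow_shuffleExp_perm σ (fun i => (z i).op.1) (fun i => ∑ q, ((z i).inp q).1)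
  have h4 : e = fun i => (z i).op.1 + ∑ q, ((z i).inp q).1 := by
    ext1 i
    rw [← hz i, clsDeg, add_comm]
  rw [h4, add_comm (koszulExp σ _), h3]

theorem isGradedAlgebra (h : DirectSum.IsInternal gr) :
    IsGradedAlgebra C (deg C gr) (action C h) :=
  ⟨deg_isInternal h, action_mem h, action_one h, action_assoc h, action_perm h⟩

/-- The inclusion of the generators. -/
def gen (C : DGOperad.{u, v} K) (gr : ℤ → Submodule K N) : N →ₗ[K] FreeAlg C gr :=
  -- In arity one the base point of `toLinearMap` is irrelevant, since its only entry is replaced.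
  ((LinearMap.applyₗ C.one).compMultilinearMap (pureM C gr 1)).toLinearMap (fun _ => 0) 0

theorem gen_apply (x : N) : gen C gr x = pure gr (fun _ : Fin 1 => x) C.one := by
  rw [gen, MultilinearMap.toLinearMap_apply, LinearMap.compMultilinearMap_apply,
    LinearMap.applyₗ_apply_apply, pureM_apply]
  congr 1
  ext1 i
  rw [Subsingleton.elim i 0, Function.update_self]

theorem gen_eq_cls (x : Homog gr) :
    gen C gr (x.2 : N) = cls (⟨1, fun _ => x, C.oneH⟩ : Corolla C (Homog gr)) :=
  gen_apply _

theorem gen_mem {i : ℤ} {x : N} (hx : x ∈ gr i) : gen C gr x ∈ deg C gr i := by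
  rw [gen_apply]
  have := pure_mem (C := C) (n := 1) (e := fun _ => i) (fun _ => hx) C.one_mem
  simpa using this

/-- By the left unit law a pure tensor is an operation applied to generators. Formulas for pure
tensors thus become instances of the algebra axioms. -/
theorem action_gen (h : DirectSum.IsInternal gr) {n : ℕ} (x : Fin n → N) (c : C.obj n) :
    action C h n (fun i => gen C gr (x i)) c = pure gr x c := by
  have key : (action C h n).compLinearMap (fun _ => gen C gr) = pureM C gr n := by
    refine multilinearMap_ext_of_span _ _ (span_iUnion_of_isInternal h) fun t => ?_
    refine LinearMap.ext fun c => ?_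
    rw [MultilinearMap.compLinearMap_apply]
    simp only [gen_eq_cls]
    rw [action_cls h (fun i => (⟨1, fun _ => t i, C.oneH⟩ : Corolla C (Homog gr))), graftCls,
      graftValue]
    have h1 : shuffleExp (fun _ : Fin n => (C.oneH).1) (fun i => ∑ _q : Fin 1, (t i).1) = 0 := by
      simp [shuffleExp, DGOperad.oneH]
    rw [h1, Int.negOnePow_zero, Units.val_one, Int.cast_one, one_smul, LinearMap.comp_apply,
      pureM_apply, pureM_apply]
    conv_rhs => rw [← C.γ_one_left c, pure_finCongr]
    congr 1
    ext1 p
    obtain ⟨⟨i, a⟩, rfl⟩ := finSigmaFinEquiv.surjective p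
    rw [concat_finSigma]
    have : i = Fin.cast (by simp) (finSigmaFinEquiv (⟨i, a⟩ : (i : Fin n) × Fin 1)) := by
      refine Fin.ext ?_
      rw [Fin.val_cast, finSigmaFinEquiv_val]
      simp
    exact congrArg (fun i => ((t i).2 : N)) this
  exact LinearMap.congr_fun (congrArg (fun M => M x) key) c

end FreeAlg

/-! ## Derivations -/

section

variable {K : Type u} [Field K] {C : DGOperad.{u, v} K} {B : Type w} [AddCommGroup B] [Module K B]
  {gr : ℤ → Submodule K B}
  {θ : ∀ n : ℕ, MultilinearMap K (fun _ : Fin n => B) (C.obj n →ₗ[K] B)}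

/-- The Leibniz rule: the value of a derivation on `θ(y_0, …, y_{n-1}; c)`, for pairs of elements
`y_i` and values of the derivation on `y_i`. -/
def leibniz (h : IsGradedAlgebra C gr θ) (n : ℕ) :
    MultilinearMap K (fun _ : Fin n => B × B) (C.obj n →ₗ[K] B) :=
  -- The signs come from the grading involution applied to the entries before place `i`, which keeps
  -- the expression multilinear without reference to degrees. Values are supplied in pairs so that
  -- the rule can be used before a derivation exists.
  ∑ i : Fin n, (θ n).compLinearMap (fun j =>
      if j < i then signMap h.internal ∘ₗ LinearMap.fst K B B
      else if j = i then LinearMap.snd K B B else LinearMap.fst K B B)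
    + (LinearMap.lcomp K B (C.d n)).compMultilinearMap
      ((θ n).compLinearMap fun _ => signMap h.internal ∘ₗ LinearMap.fst K B B)

theorem leibniz_apply (h : IsGradedAlgebra C gr θ) {n : ℕ} (p : Fin n → B × B) (c : C.obj n)
    (e : Fin n → ℤ) (hp : ∀ i, (p i).1 ∈ gr (e i)) :
    leibniz h n p c =
      ∑ i, (∑ j ∈ Finset.Iio i, e j).negOnePow •
        θ n (Function.update (fun j => (p j).1) i (p i).2) c
      + (∑ j, e j).negOnePow • θ n (fun j => (p j).1) (C.d n c) := by
  simp only [leibniz, add_apply, sum_apply, LinearMap.add_apply,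
    LinearMap.sum_apply, LinearMap.compMultilinearMap_apply, LinearMap.lcomp_apply,
    MultilinearMap.compLinearMap_apply]
  congr 1
  · refine Finset.sum_congr rfl fun i _ => ?_
    rw [sum_Iio_eq, ← opMap_apply, ← opMap_apply, ← multilinearMap_negOnePow_smul]
    congr 1
    ext1 j
    rcases lt_trichotomy j i with hj | hj | hj
    · rw [if_pos hj, if_pos hj, Function.update_of_ne hj.ne, LinearMap.comp_apply,
        LinearMap.fst_apply, signMap_apply h.internal (hp j)]
    · subst hj
      simp
    · rw [if_neg (lt_asymm hj), if_neg (lt_asymm hj), if_neg hj.ne', Function.update_of_ne hj.ne']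
      simp
  · rw [← opMap_apply, ← opMap_apply, ← multilinearMap_negOnePow_smul]
    congr 1
    ext1 j
    rw [LinearMap.comp_apply, LinearMap.fst_apply, signMap_apply h.internal (hp j)]

/-- In the term where the derivation hits one entry the degree of that entry is lowered by one;
`negOnePow_koszulExp_update` accounts for the change of the Koszul sign. The last term only needs
that the symmetric group acts by chain maps. -/
theorem leibniz_perm (h : IsGradedAlgebra C gr θ) {n : ℕ} (σ : Equiv.Perm (Fin n))
    (p : Fin n → B × B) (c : C.obj n) (e : Fin n → ℤ) (hp : ∀ i, (p i).1 ∈ gr (e i))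
    (hp' : ∀ i, (p i).2 ∈ gr (e i - 1)) :
    leibniz h n p (C.act σ c) =
      (koszulExp σ e).negOnePow • leibniz h n (fun i => p (σ i)) c := by
  rw [leibniz_apply h p _ e hp, leibniz_apply h (fun i => p (σ i)) c (fun i => e (σ i))
    (fun i => hp _), C.d_act, smul_add, Finset.smul_sum, ← Equiv.sum_comp σ]
  congr 1
  · refine Finset.sum_congr rfl fun i _ => ?_
    have hu : ∀ j, Function.update (fun j => (p j).1) (σ i) (p (σ i)).2 j ∈
        gr (Function.update e (σ i) (e (σ i) - 1) j) := by
      intro j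
      by_cases hj : j = σ i
      · subst hj
        simpa using hp' (σ i)
      · simpa [hj] using hp j
    rw [h.θ_perm n _ c _ σ hu, negOnePow_smul_smul, negOnePow_koszulExp_update, negOnePow_smul_smul]
    congr 1
    refine congrArg (fun v => θ n v c) (funext fun j => ?_)
    by_cases hj : j = i
    · subst hj; simp
    · simp [hj]
  · rw [h.θ_perm n _ _ e σ hp, Equiv.sum_comp σ e, negOnePow_smul_smul, negOnePow_smul_smul,
      add_comm]

/-- The terms are of three kinds, with the derivation at an input, at an inner operation or at the
outer operation. Associativity applies to each of them with one degree lowered by at most one, and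
`d_γ` matches the operation terms. This makes a derivation prescribed on pure tensors a derivation
for all operations. -/
theorem leibniz_assoc (h : IsGradedAlgebra C gr θ) {k : ℕ} (n : Fin k → ℕ)
    (w : ∀ i, Fin (n i) → B × B) (b : ∀ i, C.obj (n i)) (c : C.obj k) (e : ∀ i, Fin (n i) → ℤ)
    (eb : Fin k → ℤ) (hw : ∀ i j, (w i j).1 ∈ gr (e i j)) (hw' : ∀ i j, (w i j).2 ∈ gr (e i j - 1))
    (hb : ∀ i, b i ∈ C.gr (n i) (eb i)) :
    leibniz h k (fun i => (θ (n i) (fun j => (w i j).1) (b i), leibniz h (n i) (w i) (b i))) c =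
      (shuffleExp eb (fun i => ∑ j, e i j)).negOnePow •
        leibniz h (∑ i, n i) (concat w) (C.γ n b c) := by
  set y : Fin k → B := fun i => θ (n i) (fun j => (w i j).1) (b i) with hy
  set X : Fin k → ℤ := fun i => ∑ j, e i j with hX
  have hymem : ∀ i, y i ∈ gr (X i + eb i) := fun i => h.θ_mem _ _ _ _ _ (hw i) (hb i)
  have hcw : ∀ p, (concat w p).1 ∈ gr (concat e p) := fun p => hw _ _
  have h0 : leibniz h k (fun i => (y i, leibniz h (n i) (w i) (b i))) c =
      ∑ i, (∑ j ∈ Finset.Iio i, (X j + eb j)).negOnePow •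
        θ k (Function.update y i (leibniz h (n i) (w i) (b i))) c
      + (∑ j, (X j + eb j)).negOnePow • θ k y (C.d k c) := leibniz_apply h _ c _ hymem
  rw [h0, leibniz_apply h _ _ _ hcw]
  -- the terms in which the derivation is applied to an input
  have hT : ∀ (i : Fin k) (j : Fin (n i)),
      θ k (Function.update y i (θ (n i) (Function.update (fun j => (w i j).1) j (w i j).2) (b i))) c =
        (shuffleExp eb X - ∑ l ∈ Finset.Iio i, eb l).negOnePow •
        θ (∑ i, n i) (Function.update (fun p => (concat w p).1) (finSigmaFinEquiv ⟨i, j⟩) (w i j).2)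
          (C.γ n b c) := by
    intro i j
    have h1 := h.θ_assoc k n (Function.update (fun i j => (w i j).1) i
      (Function.update (fun j => (w i j).1) j (w i j).2)) b c
      (Function.update e i (Function.update (e i) j (e i j - 1))) eb ?_ hb
    · rw [concat_update, Function.update_eq_self] at h1
      have h2 : (fun l => θ (n l) (Function.update (fun i j => (w i j).1) i
          (Function.update (fun j => (w i j).1) j (w i j).2) l) (b l)) =
          Function.update y i
            (θ (n i) (Function.update (fun j => (w i j).1) j (w i j).2) (b i)) := by
        ext1 l
        by_cases hl : l = i
        · subst hl; simp
        · simp [hl, hy]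
      have h3 : (fun l => ∑ q, Function.update e i (Function.update (e i) j (e i j - 1)) l q) =
          Function.update X i (X i - 1) := by
        ext1 l
        by_cases hl : l = i
        · subst hl
          rw [Function.update_self, Function.update_self, sum_update]
          simp only [hX]
          ring
        · simp [hl, hX]
      rw [h2, h3, shuffleExp_update_right] at h1
      rw [h1]
      congr 2
      ring
    · intro l q
      by_cases hl : l = i
      · subst hl
        rw [Function.update_self, Function.update_self]
        by_cases hq : q = j
        · subst hq
          simpa using hw' l q
        · simpa [hq] using hw l q
      · simpa [hl] using hw l q
  -- the terms in which the derivation is applied to an inner operation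
  have hU : ∀ i : Fin k, θ k (Function.update y i (θ (n i) (fun j => (w i j).1) (C.d _ (b i)))) c =
      (shuffleExp eb X - ∑ l ∈ Finset.Ioi i, X l).negOnePow •
        θ (∑ i, n i) (fun p => (concat w p).1) (C.γ n (Function.update b i (C.d _ (b i))) c) := by
    intro i
    have h1 := h.θ_assoc k n (fun i j => (w i j).1) (Function.update b i (C.d _ (b i))) c e
      (Function.update eb i (eb i - 1)) hw ?_
    · have h2 : (fun l => θ (n l) (fun j => (w l j).1) (Function.update b i (C.d _ (b i)) l)) =
          Function.update y i (θ (n i) (fun j => (w i j).1) (C.d _ (b i))) := by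
        ext1 l
        by_cases hl : l = i
        · subst hl; simp
        · simp [hl, hy]
      rw [h2, shuffleExp_update_left] at h1
      rw [h1]
      congr 2
      ring
    · intro l
      by_cases hl : l = i
      · subst hl
        simpa using (C.isDG _).d_mem _ _ (hb l)
      · simpa [hl] using hb l
  have hV : θ k y (C.d k c) = (shuffleExp eb X).negOnePow •
      θ (∑ i, n i) (fun p => (concat w p).1) (C.γ n b (C.d k c)) :=
    h.θ_assoc k n (fun i j => (w i j).1) b (C.d k c) e eb hw hb
  have hL : ∀ i : Fin k, θ k (Function.update y i (leibniz h (n i) (w i) (b i))) c =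
      ∑ j, (∑ l ∈ Finset.Iio j, e i l).negOnePow •
        θ k (Function.update y i (θ (n i) (Function.update (fun j => (w i j).1) j (w i j).2) (b i))) c
      + (X i).negOnePow •
        θ k (Function.update y i (θ (n i) (fun j => (w i j).1) (C.d _ (b i)))) c := by
    intro i
    rw [leibniz_apply h _ _ _ (hw i), ← opMap_apply, MultilinearMap.map_update_add,
      MultilinearMap.map_update_sum]
    simp only [intUnits_smul_eq K, MultilinearMap.map_update_smul, opMap_apply]
    rfl
  rw [C.d_γ n b c eb hb]
  simp only [hL, hT, hU, hV, map_add, map_sum, linearMap_intUnits_smul, smul_add, Finset.smul_sum,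
    negOnePow_smul_smul, Finset.sum_add_distrib]
  rw [add_assoc]
  congr 1
  · rw [sum_finSigma]
    refine Finset.sum_congr rfl fun i _ => Finset.sum_congr rfl fun j _ => ?_
    rw [concat_finSigma, sum_Iio_finSigma]
    congr 1
    refine negOnePow_eq_of_eq_add 0 ?_
    simp only [hX]
    ring
  · rw [sum_concat]
    congr 1
    · refine Finset.sum_congr rfl fun i _ => ?_
      congr 1
      -- The inputs to the right of block `i` appear on the right through the total degree of all
      -- inputs, and on the left, negatively, because lowering the degree of `b i` changes the
      -- shuffle.
      refine negOnePow_eq_of_eq_add (-∑ l ∈ Finset.Ioi i, X l) ?_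
      have := sum_eq_Iio_add_Ioi X i
      rw [show ∑ i, ∑ j, e i j = ∑ i, X i from rfl, this]
      ring
    · congr 1
      refine negOnePow_eq_of_eq_add 0 ?_
      simp only [hX]
      ring

/-- The square of an odd derivation is a derivation. -/
theorem leibniz_leibniz (h : IsGradedAlgebra C gr θ) {D : B →ₗ[K] B}
    (hD : ∀ i x, x ∈ gr i → D x ∈ gr (i - 1))
    (hDθ : ∀ (n : ℕ) (y : Fin n → B) (c : C.obj n),
      D (θ n y c) = leibniz h n (fun i => (y i, D (y i))) c)
    {n : ℕ} (y : Fin n → B) (c : C.obj n) (e : Fin n → ℤ) (hy : ∀ i, y i ∈ gr (e i)) :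
    D (D (θ n y c)) = ∑ i, θ n (Function.update y i (D (D (y i)))) c := by
  have hu : ∀ i j, Function.update y i (D (y i)) j ∈ gr (Function.update e i (e i - 1) j) := by
    intro i j
    by_cases hj : j = i
    · subst hj
      simpa using hD _ _ (hy j)
    · simpa [hj] using hy j
  rw [hDθ, leibniz_apply h _ c e hy]
  simp only [map_add, map_sum, linearMap_intUnits_smul, hDθ]
  rw [leibniz_apply h _ _ e hy]
  simp only [fun i => leibniz_apply h (fun j => (Function.update y i (D (y i)) j,
    D (Function.update y i (D (y i)) j))) c _ (hu i), (C.isDG n).d_d, map_zero, smul_zero, add_zero,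
    smul_add, Finset.smul_sum, Finset.sum_add_distrib, negOnePow_smul_smul, sum_update]
  -- Terms with `D` on an input and `d` on the operation occur in both orders; when `D` comes first,
  -- it has lowered the total degree by one, so they cancel.
  have hc : ∑ i, (∑ j ∈ Finset.Iio i, e j + (∑ j, e j + (e i - 1 - e i))).negOnePow •
        θ n (Function.update y i (D (y i))) (C.d n c) =
      - ∑ i, (∑ j, e j + ∑ j ∈ Finset.Iio i, e j).negOnePow •
        θ n (Function.update y i (D (y i))) (C.d n c) := by
    rw [← Finset.sum_neg_distrib]
    refine Finset.sum_congr rfl fun i _ => ?_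
    rw [show ∑ j ∈ Finset.Iio i, e j + (∑ j, e j + (e i - 1 - e i)) =
      (∑ j, e j + ∑ j ∈ Finset.Iio i, e j) - 1 by ring, Int.negOnePow_sub, Int.negOnePow_one,
      mul_neg, mul_one, Units.neg_smul]
  rw [hc, neg_add_cancel_right, sum_sum_eq_diag_add]
  -- For `i < j` the two orders of applying `D` at both places have opposite signs, for the same
  -- reason. Only the terms with `D` twice at one place remain, with an even exponent.
  have hoff : ∑ i, ∑ j, (if i < j then
      ((∑ l ∈ Finset.Iio i, e l + ∑ l ∈ Finset.Iio j, Function.update e i (e i - 1) l).negOnePow •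
        θ n (Function.update (Function.update y i (D (y i))) j
          (D (Function.update y i (D (y i)) j))) c
      + (∑ l ∈ Finset.Iio j, e l + ∑ l ∈ Finset.Iio i, Function.update e j (e j - 1) l).negOnePow •
        θ n (Function.update (Function.update y j (D (y j))) i
          (D (Function.update y j (D (y j)) i))) c) else 0) = 0 := by
    refine Finset.sum_eq_zero fun i _ => Finset.sum_eq_zero fun j _ => ?_
    split_ifs with hij
    · have h1 : ∑ l ∈ Finset.Iio j, Function.update e i (e i - 1) l =
          ∑ l ∈ Finset.Iio j, e l - 1 := by
        rw [Finset.sum_update_of_mem (by simpa using hij), ← Finset.add_sum_erase _ e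
          (Finset.mem_Iio.2 hij), Finset.sdiff_singleton_eq_erase]
        ring
      have h2 : ∑ l ∈ Finset.Iio i, Function.update e j (e j - 1) l = ∑ l ∈ Finset.Iio i, e l :=
        Finset.sum_update_of_notMem (by simpa using hij.le) _ _
      rw [h1, h2, Function.update_of_ne hij.ne', Function.update_of_ne hij.ne,
        Function.update_comm hij.ne, show ∑ l ∈ Finset.Iio i, e l + (∑ l ∈ Finset.Iio j, e l - 1) =
          (∑ l ∈ Finset.Iio j, e l + ∑ l ∈ Finset.Iio i, e l) - 1 by ring, Int.negOnePow_sub,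
        Int.negOnePow_one, mul_neg, mul_one, Units.neg_smul, neg_add_cancel]
    · rfl
  rw [hoff, add_zero]
  refine Finset.sum_congr rfl fun i _ => ?_
  rw [Finset.sum_update_of_notMem (by simp), Function.update_idem, Function.update_self,
    Int.negOnePow_even _ ⟨_, rfl⟩, one_smul]

end

/-! ### Derivations of the free algebra and morphisms out of it -/

namespace FreeAlg

variable {K : Type u} [Field K] {C : DGOperad.{u, v} K} {N : Type w} [AddCommGroup N] [Module K N]
  {gr : ℤ → Submodule K N}

theorem exists_derivation (h : DirectSum.IsInternal gr) (g : N →ₗ[K] FreeAlg C gr)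
    (hg : ∀ i x, x ∈ gr i → g x ∈ deg C gr (i - 1)) :
    ∃ D : FreeAlg C gr →ₗ[K] FreeAlg C gr, ∀ (n : ℕ) (x : Fin n → N) (c : C.obj n),
      D (pure gr x c) = leibniz (isGradedAlgebra h) n (fun i => (gen C gr (x i), g (x i))) c :=
  exists_linearMap (fun n => (leibniz (isGradedAlgebra (C := C) h) n).compLinearMap
    fun _ => (gen C gr).prod g) fun _ σ x c =>
      leibniz_perm (isGradedAlgebra h) σ (fun i => (gen C gr ((x i).2 : N), g ((x i).2 : N))) c
        (fun i => (x i).1) (fun i => gen_mem (x i).2.2) (fun i => hg _ _ (x i).2.2)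

/-- The derivation of the free algebra with given values on the generators. -/
def derivation (h : DirectSum.IsInternal gr) (g : N →ₗ[K] FreeAlg C gr)
    (hg : ∀ i x, x ∈ gr i → g x ∈ deg C gr (i - 1)) : FreeAlg C gr →ₗ[K] FreeAlg C gr :=
  (exists_derivation h g hg).choose

section

variable (h : DirectSum.IsInternal gr) (g : N →ₗ[K] FreeAlg C gr)
    (hg : ∀ i x, x ∈ gr i → g x ∈ deg C gr (i - 1))

theorem derivation_pure {n : ℕ} (x : Fin n → N) (c : C.obj n) :
    derivation h g hg (pure gr x c) =
      leibniz (isGradedAlgebra h) n (fun i => (gen C gr (x i), g (x i))) c :=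
  (exists_derivation h g hg).choose_spec n x c

theorem derivation_gen (x : N) : derivation h g hg (gen C gr x) = g x := by
  have : derivation h g hg ∘ₗ gen C gr = g := by
    refine _root_.linearMap_ext_of_span (span_iUnion_of_isInternal h) fun t => ?_
    rw [LinearMap.comp_apply, gen_apply, derivation_pure, leibniz_apply _ _ _ (fun _ => t.1)
      (fun _ => gen_mem t.2.2), C.d_one, map_zero, smul_zero, add_zero, Fin.sum_univ_one]
    have h0 : Function.update (fun _ : Fin 1 => gen C gr (t.2 : N)) 0 (g t.2) = fun _ => g t.2 := by
      ext1 i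
      rw [Subsingleton.elim i 0, Function.update_self]
    have h1 : ∑ j ∈ Finset.Iio (0 : Fin 1), t.1 = 0 := by simp
    rw [h0, action_one, h1, Int.negOnePow_zero, one_smul]
  exact LinearMap.congr_fun this x

/-- Corollas are operations applied to generators, so both sides reduce to the Leibniz rule for one
composite operation, by `leibniz_assoc` with the pairs (generator, prescribed value). -/
theorem derivation_action (n : ℕ) (y : Fin n → FreeAlg C gr) (c : C.obj n) :
    derivation h g hg (action C h n y c) =
      leibniz (isGradedAlgebra h) n (fun i => (y i, derivation h g hg (y i))) c := by
  have key : (LinearMap.compRight K (derivation h g hg)).compMultilinearMap (action C h n) =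
      (leibniz (isGradedAlgebra h) n).compLinearMap
        fun _ => (LinearMap.id).prod (derivation h g hg) := by
    refine multilinearMap_ext_of_span _ _ (span_cls h) fun z => ?_
    refine LinearMap.ext fun c => ?_
    have h1 := (isGradedAlgebra h).θ_assoc n (fun i => (z i).arity)
      (fun i j => gen C gr (((z i).inp j).2 : N)) (fun i => ((z i).op.2 : C.obj (z i).arity)) c
      (fun i j => ((z i).inp j).1) (fun i => (z i).op.1) (fun i j => gen_mem ((z i).inp j).2.2)
      (fun i => (z i).op.2.2)
    have h2 := leibniz_assoc (isGradedAlgebra h) (fun i => (z i).arity)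
      (fun i j => (gen C gr (((z i).inp j).2 : N), g (((z i).inp j).2 : N)))
      (fun i => ((z i).op.2 : C.obj (z i).arity)) c (fun i j => ((z i).inp j).1)
      (fun i => (z i).op.1) (fun i j => gen_mem ((z i).inp j).2.2)
      (fun i j => hg _ _ ((z i).inp j).2.2) (fun i => (z i).op.2.2)
    have h3 : concat (fun i j => gen C gr (((z i).inp j).2 : N)) =
      fun p => gen C gr (concat (fun i j => (((z i).inp j).2 : N)) p) := rfl
    have h4 : concat (fun i j => (gen C gr (((z i).inp j).2 : N), g (((z i).inp j).2 : N))) =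
      fun p => (gen C gr (concat (fun i j => (((z i).inp j).2 : N)) p),
        g (concat (fun i j => (((z i).inp j).2 : N)) p)) := rfl
    simp only [action_gen, h3] at h1
    simp only [action_gen, h4, ← derivation_pure h g hg] at h2
    change derivation h g hg (action C h n (fun i => cls (z i)) c) = leibniz (isGradedAlgebra h) n
      (fun i => (cls (z i), derivation h g hg (cls (z i)))) c
    refine Eq.trans ?_ h2.symm
    rw [← linearMap_intUnits_smul]
    exact congrArg _ h1
  exact LinearMap.congr_fun (congrArg (fun M => M y) key) c

theorem derivation_mem (i : ℤ) (y : FreeAlg C gr) (hy : y ∈ deg C gr i) :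
    derivation h g hg y ∈ deg C gr (i - 1) := by
  have : deg C gr i ≤ (deg C gr (i - 1)).comap (derivation h g hg) := by
    refine Submodule.span_le.2 ?_
    rintro _ ⟨z, hz, rfl⟩
    rw [SetLike.mem_coe, Submodule.mem_comap, cls, derivation_pure,
      leibniz_apply _ _ _ (fun j => (z.inp j).1) (fun j => gen_mem (z.inp j).2.2)]
    refine Submodule.add_mem _ (Submodule.sum_mem _ fun j _ => ?_) ?_
    · rw [intUnits_smul_eq K]
      refine Submodule.smul_mem _ _ ?_
      have := action_mem h z.arity (Function.update (fun l => gen C gr ((z.inp l).2 : N)) j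
        (g ((z.inp j).2 : N))) (z.op.2 : C.obj z.arity)
        (Function.update (fun l => (z.inp l).1) j ((z.inp j).1 - 1)) z.op.1 ?_ z.op.2.2
      · rw [sum_update] at this
        convert this using 2
        rw [← hz]
        ring
      · intro l
        by_cases hl : l = j
        · subst hl
          simpa using hg _ _ (z.inp l).2.2
        · simpa [hl] using gen_mem (z.inp l).2.2
    · rw [intUnits_smul_eq K]
      refine Submodule.smul_mem _ _ ?_
      have := action_mem h z.arity (fun l => gen C gr ((z.inp l).2 : N)) _
        (fun l => (z.inp l).1) (z.op.1 - 1) (fun l => gen_mem (z.inp l).2.2)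
        ((C.isDG _).d_mem _ _ z.op.2.2)
      convert this using 2
      rw [← hz]
      ring
  exact this hy

end

section

variable {B : Type*} [AddCommGroup B] [Module K B] {grB : ℤ → Submodule K B}
  {θ : ∀ n : ℕ, MultilinearMap K (fun _ : Fin n => B) (C.obj n →ₗ[K] B)}

theorem exists_lift (hB : IsGradedAlgebra C grB θ) (p : N →ₗ[K] B)
    (hp : ∀ i x, x ∈ gr i → p x ∈ grB i) :
    ∃ L : FreeAlg C gr →ₗ[K] B, ∀ (n : ℕ) (x : Fin n → N) (c : C.obj n),
      L (pure gr x c) = θ n (fun i => p (x i)) c :=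
  exists_linearMap (fun n => (θ n).compLinearMap fun _ => p) fun n σ x c =>
    hB.θ_perm n (fun i => p ((x i).2 : N)) c (fun i => (x i).1) σ (fun i => hp _ _ (x i).2.2)

/-- The morphism of algebras from the free algebra with given values on the generators. -/
def lift (hB : IsGradedAlgebra C grB θ) (p : N →ₗ[K] B) (hp : ∀ i x, x ∈ gr i → p x ∈ grB i) :
    FreeAlg C gr →ₗ[K] B :=
  (exists_lift hB p hp).choose

variable (hB : IsGradedAlgebra C grB θ) (p : N →ₗ[K] B) (hp : ∀ i x, x ∈ gr i → p x ∈ grB i)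

theorem lift_pure {n : ℕ} (x : Fin n → N) (c : C.obj n) :
    lift hB p hp (pure gr x c) = θ n (fun i => p (x i)) c :=
  (exists_lift hB p hp).choose_spec n x c

theorem lift_gen (x : N) : lift hB p hp (gen C gr x) = p x := by
  rw [gen_apply, lift_pure, hB.θ_one]

/-- On corollas of generators both sides are evaluated by the associativity law, with the same sign
in the source and in the target. -/
theorem lift_action (h : DirectSum.IsInternal gr) (n : ℕ) (y : Fin n → FreeAlg C gr) (c : C.obj n) :
    lift hB p hp (action C h n y c) = θ n (fun i => lift hB p hp (y i)) c := by
  have key : (LinearMap.compRight K (lift hB p hp)).compMultilinearMap (action C h n) =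
      (θ n).compLinearMap fun _ => lift hB p hp := by
    refine multilinearMap_ext_of_span _ _ (span_cls h) fun z => ?_
    refine LinearMap.ext fun c => ?_
    have h1 := (isGradedAlgebra h).θ_assoc n (fun i => (z i).arity)
      (fun i j => gen C gr (((z i).inp j).2 : N)) (fun i => ((z i).op.2 : C.obj (z i).arity)) c
      (fun i j => ((z i).inp j).1) (fun i => (z i).op.1) (fun i j => gen_mem ((z i).inp j).2.2)
      (fun i => (z i).op.2.2)
    have h2 := hB.θ_assoc n (fun i => (z i).arity)
      (fun i j => p (((z i).inp j).2 : N)) (fun i => ((z i).op.2 : C.obj (z i).arity)) c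
      (fun i j => ((z i).inp j).1) (fun i => (z i).op.1) (fun i j => hp _ _ ((z i).inp j).2.2)
      (fun i => (z i).op.2.2)
    have h3 : concat (fun i j => gen C gr (((z i).inp j).2 : N)) =
      fun p => gen C gr (concat (fun i j => (((z i).inp j).2 : N)) p) := rfl
    have h4 : concat (fun i j => p (((z i).inp j).2 : N)) =
      fun q => p (concat (fun i j => (((z i).inp j).2 : N)) q) := rfl
    simp only [action_gen, h3] at h1
    simp only [h4, ← lift_pure hB p hp] at h2
    change lift hB p hp (action C h n (fun i => cls (z i)) c) =
      θ n (fun i => lift hB p hp (cls (z i))) c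
    refine Eq.trans ?_ h2.symm
    rw [← linearMap_intUnits_smul]
    exact congrArg _ h1
  exact LinearMap.congr_fun (congrArg (fun M => M y) key) c

end

end FreeAlg

/-! ## The augmented bar construction as a graded module -/

namespace LTree

variable {K : Type u} [Field K] {C : DGOperad.{u, v} K} {M : Type w} [AddCommGroup M] [Module K M]
  {gr : ℤ → Submodule K M}

theorem inner_node (k : ℕ) (ch : Fin k → LTree C gr) (c : C.HOp k) :
    (node k ch c).inner = ∑ i, (ch i).inner + 1 := by
  rw [inner]

theorem intDeg_node (k : ℕ) (ch : Fin k → LTree C gr) (c : C.HOp k) :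
    (node k ch c).intDeg = ∑ i, (ch i).intDeg + c.1 := by
  rw [intDeg]

theorem deg_node (k : ℕ) (ch : Fin k → LTree C gr) (c : C.HOp k) :
    (node k ch c).deg = ∑ i, (ch i).deg + c.1 + 1 := by
  simp only [deg, inner_node, intDeg_node, Finset.sum_add_distrib]
  ring

theorem sum_update_comp {k : ℕ} (φ : LTree C gr → ℤ) (ch : Fin k → LTree C gr) (i : Fin k)
    (t : LTree C gr) :
    (fun j => φ (Function.update ch i t j)) = Function.update (fun j => φ (ch j)) i (φ t) := by
  ext1 j
  by_cases hj : j = i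
  · subst hj; simp
  · simp [hj]

/-- The formal linear combinations of trees with `p` inner vertices and labels of total degree `q`. -/
def bideg (C : DGOperad.{u, v} K) (gr : ℤ → Submodule K M) (p q : ℤ) :
    Submodule K (LTree C gr →₀ K) :=
  Finsupp.supported K K {t | t.inner = p ∧ t.intDeg = q}

theorem single_mem_bideg (t : LTree C gr) (r : K) :
    Finsupp.single t r ∈ bideg C gr t.inner t.intDeg :=
  Finsupp.single_mem_supported K r ⟨rfl, rfl⟩

theorem single_mem_bideg_of_eq {t : LTree C gr} (r : K) {p q : ℤ} (hp : t.inner = p)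
    (hq : t.intDeg = q) : Finsupp.single t r ∈ bideg C gr p q :=
  Finsupp.single_mem_supported K r ⟨hp, hq⟩

theorem eq_of_mem_bideg {X : Type*} [AddCommGroup X] [Module K X]
    {L L' : (LTree C gr →₀ K) →ₗ[K] X} {p q : ℤ}
    (h : ∀ t : LTree C gr, t.inner = p → t.intDeg = q →
      L (Finsupp.single t 1) = L' (Finsupp.single t 1))
    {f : LTree C gr →₀ K} (hf : f ∈ bideg C gr p q) : L f = L' f := by
  rw [bideg, Finsupp.supported_eq_span_single] at hf
  refine LinearMap.eqOn_span (s := (fun t => Finsupp.single t (1 : K)) ''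
    {t : LTree C gr | t.inner = p ∧ t.intDeg = q}) ?_ hf
  rintro _ ⟨t, ⟨hp, hq⟩, rfl⟩
  exact h t hp hq

theorem map_mem_of_mem_bideg {X : Type*} [AddCommGroup X] [Module K X]
    {L : (LTree C gr →₀ K) →ₗ[K] X} {S : Submodule K X} {p q : ℤ}
    (h : ∀ t : LTree C gr, t.inner = p → t.intDeg = q → L (Finsupp.single t 1) ∈ S)
    {f : LTree C gr →₀ K} (hf : f ∈ bideg C gr p q) : L f ∈ S := by
  rw [← Submodule.Quotient.mk_eq_zero]
  exact eq_of_mem_bideg (L := S.mkQ ∘ₗ L) (L' := 0)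
    (fun t hp hq => (Submodule.Quotient.mk_eq_zero _).2 (h t hp hq)) hf

theorem atChild_single {k : ℕ} (ch : Fin k → LTree C gr) (c : C.HOp k) (i : Fin k) (t : LTree C gr)
    (r : K) : atChild ch c i (Finsupp.single t r) =
      Finsupp.single (node k (Function.update ch i t) c) r := by
  rw [atChild, Finsupp.mapDomain_single]

/-- `atChild` as a linear map. -/
def atChildL {k : ℕ} (ch : Fin k → LTree C gr) (c : C.HOp k) (i : Fin k) :
    (LTree C gr →₀ K) →ₗ[K] (LTree C gr →₀ K) :=
  Finsupp.lmapDomain K K fun t => node k (Function.update ch i t) c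

theorem atChildL_apply {k : ℕ} (ch : Fin k → LTree C gr) (c : C.HOp k) (i : Fin k)
    (f : LTree C gr →₀ K) : atChildL ch c i f = atChild ch c i f := rfl

theorem atChild_mem_bideg {k : ℕ} (ch : Fin k → LTree C gr) (c : C.HOp k) (i : Fin k)
    {f : LTree C gr →₀ K} {p q : ℤ} (hf : f ∈ bideg C gr p q) :
    atChild ch c i f ∈ bideg C gr (∑ j, (ch j).inner + (p - (ch i).inner) + 1)
      (∑ j, (ch j).intDeg + (q - (ch i).intDeg) + c.1) := by
  rw [← atChildL_apply]
  refine map_mem_of_mem_bideg (fun t hp hq => ?_) hf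
  rw [atChildL_apply, atChild_single]
  refine single_mem_bideg_of_eq 1 ?_ ?_
  · rw [inner_node, sum_update_comp inner, sum_update, hp]
  · rw [intDeg_node, sum_update_comp intDeg, sum_update, hq]

/-- Relations are homogeneous both in the number of inner vertices and in the label degree. Every
sign below depends on a successor tree only through these two numbers, so it is constant on the
trees of a relation. -/
theorem Rel.exists_mem_bideg {f : LTree C gr →₀ K} (hf : Rel C gr f) :
    ∃ p q, f ∈ bideg C gr p q := by
  induction hf with
  | leaf_add i a b =>
    exact ⟨0, i, sub_mem (single_mem_bideg _ _)
      (add_mem (single_mem_bideg (leaf ⟨i, a⟩) _) (single_mem_bideg (leaf ⟨i, b⟩) _))⟩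
  | leaf_smul i r a =>
    exact ⟨0, i, sub_mem (single_mem_bideg _ _)
      (Submodule.smul_mem _ _ (single_mem_bideg (leaf ⟨i, a⟩) _))⟩
  | node_add k ch q a b =>
    refine ⟨∑ i, (ch i).inner + 1, ∑ i, (ch i).intDeg + q, sub_mem ?_ (add_mem ?_ ?_)⟩ <;>
    exact single_mem_bideg_of_eq _ (inner_node _ _ _) (intDeg_node _ _ _)
  | node_smul k ch q r a =>
    refine ⟨∑ i, (ch i).inner + 1, ∑ i, (ch i).intDeg + q, sub_mem ?_ (Submodule.smul_mem _ _ ?_)⟩ <;>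
    exact single_mem_bideg_of_eq _ (inner_node _ _ _) (intDeg_node _ _ _)
  | perm k ch c σ =>
    refine ⟨∑ i, (ch i).inner + 1, ∑ i, (ch i).intDeg + c.1, sub_mem ?_ ?_⟩
    · exact single_mem_bideg_of_eq _ (inner_node _ _ _) (intDeg_node _ _ _)
    · rw [intUnits_smul_eq K]
      refine Submodule.smul_mem _ _ (single_mem_bideg_of_eq _ ?_ ?_)
      · rw [inner_node, Equiv.sum_comp σ fun i => (ch i).inner]
      · rw [intDeg_node, Equiv.sum_comp σ fun i => (ch i).intDeg]
  | context k ch c i f _ ih =>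
    obtain ⟨p, q, hf⟩ := ih
    exact ⟨_, _, atChild_mem_bideg ch c i hf⟩

/-- The exponent of the sign with which the root is split off a tree whose root has a label of degree
`q` and the given successor trees. -/
def splitExp {k : ℕ} (ch : Fin k → LTree C gr) (q : ℤ) : ℤ :=
  ∑ i, (ch i).intDeg + q + shuffleExp (fun i => (ch i).intDeg) (fun i => (ch i).inner)

/-- The tree relation permutes the e and the f separately, the free algebra permutes whole trees
with their total degree. The shuffle in `splitExp` turns one sign into the other. -/
theorem negOnePow_splitExp_perm {k : ℕ} (ch : Fin k → LTree C gr) (q : ℤ)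
    (σ : Equiv.Perm (Fin k)) :
    (splitExp ch q + ((koszulExp σ fun i => (ch i).inner)
      + koszulExp σ fun i => (ch i).intDeg)).negOnePow =
    ((koszulExp σ fun i => (ch i).deg) + splitExp (fun i => ch (σ i)) q).negOnePow := by
  have h := negOnePow_shuffleExp_perm σ (fun i => (ch i).intDeg) (fun i => (ch i).inner)
  have h2 : (fun i => (ch i).deg) = fun i => (ch i).intDeg + (ch i).inner := by
    ext1 i
    rw [deg, add_comm]
  rw [splitExp, splitExp, Equiv.sum_comp σ fun i => (ch i).intDeg, h2]
  rw [show ∑ i, (ch i).intDeg + q + shuffleExp (fun i => (ch i).intDeg) (fun i => (ch i).inner) +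
    ((koszulExp σ fun i => (ch i).inner) + koszulExp σ fun i => (ch i).intDeg) =
    ∑ i, (ch i).intDeg + q + (shuffleExp (fun i => (ch i).intDeg) (fun i => (ch i).inner) +
    (koszulExp σ fun i => (ch i).intDeg) + (koszulExp σ fun i => (ch i).inner)) by ring,
    Int.negOnePow_add, ← h, ← Int.negOnePow_add]
  congr 1
  ring

/-- The exponent `splitExp` after the `i`-th successor tree is replaced. -/
theorem splitExp_update {k : ℕ} (ch : Fin k → LTree C gr) (r : ℤ) (i : Fin k) (t : LTree C gr) :
    splitExp (Function.update ch i t) r =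
      ∑ j, (ch j).intDeg + (t.intDeg - (ch i).intDeg) + r +
        shuffleExp (Function.update (fun j => (ch j).intDeg) i t.intDeg)
          (Function.update (fun j => (ch j).inner) i t.inner) := by
  rw [splitExp, sum_update_comp intDeg, sum_update_comp inner, sum_update]

end LTree

namespace AugBar

variable {K : Type u} [Field K] {C : DGOperad.{u, v} K} {M : Type w} [AddCommGroup M] [Module K M]
  (A : DGAlgebra C M)

theorem linearCombination_cls : Finsupp.linearCombination K (cls A) = mk A := by
  refine Finsupp.lhom_ext' fun t => LinearMap.ext_ring ?_
  simp [cls]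

theorem mk_eq_zero {f : LTree C A.gr →₀ K} (hf : LTree.Rel C A.gr f) : mk A f = 0 :=
  (Submodule.Quotient.mk_eq_zero _).2 (Submodule.subset_span hf)

theorem span_cls : Submodule.span K (Set.range (cls A)) = ⊤ := by
  rw [← Finsupp.range_linearCombination, linearCombination_cls]
  exact Submodule.range_mkQ _

theorem isPresentation_cls : IsPresentation (cls A) (LTree.Rel C A.gr) := by
  refine ⟨span_cls A, ?_⟩
  rw [linearCombination_cls]
  exact (Submodule.ker_mkQ _).le

theorem cls_mem (t : LTree C A.gr) : cls A t ∈ deg A t.deg :=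
  Submodule.subset_span ⟨t, rfl, rfl⟩

theorem mk_mem {f : LTree C A.gr →₀ K} {p q : ℤ} (hf : f ∈ LTree.bideg C A.gr p q) :
    mk A f ∈ deg A (p + q) := by
  refine LTree.map_mem_of_mem_bideg (fun t hp hq => ?_) hf
  have := cls_mem A t
  rwa [LTree.deg, hp, hq] at this

theorem deg_isInternal : DirectSum.IsInternal (deg A) := by
  have key : ∀ m : ℤ, ∃ P : AugBar A →ₗ[K] AugBar A, ∀ t : LTree C A.gr,
      P (cls A t) = if t.deg = m then cls A t else 0 := by
    intro m
    refine (isPresentation_cls A).exists_linearMap _ fun f hf => ?_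
    obtain ⟨p, q, hpq⟩ := hf.exists_mem_bideg
    have h1 : Finsupp.linearCombination K (fun t : LTree C A.gr =>
        if t.deg = m then cls A t else 0) f = (if p + q = m then (1 : K) else 0) • mk A f := by
      refine LTree.eq_of_mem_bideg (L' := (if p + q = m then (1 : K) else 0) • mk A)
        (fun t hp hq => ?_) hpq
      rw [Finsupp.linearCombination_single, one_smul, LTree.deg, hp, hq, LinearMap.smul_apply]
      split_ifs
      · rw [one_smul]; rfl
      · rw [zero_smul]
    rw [h1, mk_eq_zero A hf, smul_zero]
  choose P hP using key
  exact isInternal_of_projections (cls A) LTree.deg (span_cls A) P hP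

/-- The class of a tree as a homogeneous element. -/
def clsH (t : LTree C A.gr) : Homog (deg A) := ⟨t.deg, cls A t, cls_mem A t⟩

theorem update_cls {k : ℕ} (ch : Fin k → LTree C A.gr) (i : Fin k) (t : LTree C A.gr) :
    (fun j => cls A (Function.update ch i t j)) =
      Function.update (fun j => cls A (ch j)) i (cls A t) := by
  ext1 j
  by_cases hj : j = i
  · subst hj; simp
  · simp [hj]

/-! ### Grafting trees onto a new root -/

theorem exists_nodeMap {k : ℕ} (ch : Fin k → LTree C A.gr) :
    ∃ L : C.obj k →ₗ[K] AugBar A, ∀ c : C.HOp k,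
      L c.2 = (LTree.splitExp ch c.1).negOnePow • cls A (LTree.node k ch c) := by
  refine (isPresentation_homog (C.isDG k).internal).exists_linearMap
    (fun c => (LTree.splitExp ch c.1).negOnePow • cls A (LTree.node k ch c)) fun f hf => ?_
  cases hf with
  | add q a b =>
    have h := mk_eq_zero A (LTree.Rel.node_add k ch q a b)
    rw [map_sub, map_add, sub_eq_zero] at h
    simp only [map_sub, map_add, Finsupp.linearCombination_single, one_smul]
    rw [← smul_add, sub_eq_zero]
    exact congrArg _ h
  | smul q r a =>
    have h := mk_eq_zero A (LTree.Rel.node_smul k ch q r a)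
    rw [map_sub, map_smul, sub_eq_zero] at h
    simp only [map_sub, map_smul, Finsupp.linearCombination_single, one_smul]
    rw [intUnits_smul_eq K, intUnits_smul_eq K, smul_comm, ← smul_sub]
    rw [sub_eq_zero.2 (show cls A _ = r • cls A _ from h), smul_zero]

/-- The tree with given successor trees and root label, with the sign of `splitExp`. -/
def nodeMap {k : ℕ} (ch : Fin k → LTree C A.gr) : C.obj k →ₗ[K] AugBar A :=
  (exists_nodeMap A ch).choose

theorem nodeMap_apply {k : ℕ} (ch : Fin k → LTree C A.gr) (c : C.HOp k) :
    nodeMap A ch c.2 = (LTree.splitExp ch c.1).negOnePow • cls A (LTree.node k ch c) :=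
  (exists_nodeMap A ch).choose_spec c

/-- In one successor place a relation has a common sign `s`, by its bidegree; what remains is the
same relation in a context, which is zero in the quotient. -/
theorem exists_nodeMultilinear (k : ℕ) :
    ∃ L : MultilinearMap K (fun _ : Fin k => AugBar A) (C.obj k →ₗ[K] AugBar A),
      ∀ ch : Fin k → LTree C A.gr, L (fun i => cls A (ch i)) = nodeMap A ch := by
  refine (isPresentation_cls A).exists_multilinearMap (nodeMap A) fun ch i f hf => ?_
  refine linearMap_ext_of_span (span_HOp k) fun c => ?_
  obtain ⟨p, q, hpq⟩ := hf.exists_mem_bideg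
  set s : ℤ := ∑ j, (ch j).intDeg + (q - (ch i).intDeg) + c.1 +
    shuffleExp (Function.update (fun j => (ch j).intDeg) i q)
      (Function.update (fun j => (ch j).inner) i p) with hs
  have h1 := LTree.eq_of_mem_bideg (L := LinearMap.applyₗ (c.2 : C.obj k) ∘ₗ
    Finsupp.linearCombination K fun t => nodeMap A (Function.update ch i t))
    (L' := ((s.negOnePow : ℤ) : K) • (mk A ∘ₗ LTree.atChildL ch c i)) (fun t hp hq => ?_) hpq
  · simp only [LinearMap.comp_apply, LinearMap.smul_apply, LTree.atChildL_apply,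
      mk_eq_zero A (LTree.Rel.context k ch c i f hf), smul_zero] at h1
    exact h1
  · simp only [LinearMap.comp_apply, LinearMap.smul_apply, LTree.atChildL_apply,
      LTree.atChild_single, Finsupp.linearCombination_single, one_smul, ← intUnits_smul_eq K,
      LinearMap.applyₗ_apply_apply, nodeMap_apply, LTree.splitExp_update, hp, hq, hs]
    rfl

/-- `nodeMap` as a multilinear map. -/
def nodeMultilinear (k : ℕ) :
    MultilinearMap K (fun _ : Fin k => AugBar A) (C.obj k →ₗ[K] AugBar A) :=
  (exists_nodeMultilinear A k).choose

theorem nodeMultilinear_cls {k : ℕ} (ch : Fin k → LTree C A.gr) :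
    nodeMultilinear A k (fun i => cls A (ch i)) = nodeMap A ch :=
  (exists_nodeMultilinear A k).choose_spec ch

theorem nodeMap_act {k : ℕ} (σ : Equiv.Perm (Fin k)) (ch : Fin k → LTree C A.gr) (c : C.obj k) :
    nodeMap A ch (C.act σ c) =
      (koszulExp σ fun i => (ch i).deg).negOnePow • nodeMap A (fun i => ch (σ i)) c := by
  have : nodeMap A ch ∘ₗ C.act σ = (((koszulExp σ fun i => (ch i).deg).negOnePow : ℤ) : K) •
      nodeMap A (fun i => ch (σ i)) := by
    refine linearMap_ext_of_span (span_HOp k) fun c => ?_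
    have h := mk_eq_zero A (LTree.Rel.perm k ch c σ)
    rw [map_sub, linearMap_intUnits_smul, sub_eq_zero] at h
    rw [LinearMap.smul_apply, LinearMap.comp_apply, ← intUnits_smul_eq K, nodeMap_apply,
      negOnePow_smul_smul, ← LTree.negOnePow_splitExp_perm, ← negOnePow_smul_smul]
    exact (nodeMap_apply A ch (C.actH σ c)).trans (congrArg _ h)
  rw [intUnits_smul_eq K]
  exact LinearMap.congr_fun this c

theorem nodeMultilinear_act {k : ℕ} (σ : Equiv.Perm (Fin k)) (x : Fin k → AugBar A) (c : C.obj k)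
    (e : Fin k → ℤ) (hx : ∀ i, x i ∈ deg A (e i)) :
    nodeMultilinear A k x (C.act σ c) =
      (koszulExp σ e).negOnePow • nodeMultilinear A k (fun i => x (σ i)) c := by
  have := multilinearMap_eq_of_mem_span (opMap (nodeMultilinear A) (C.act σ c))
    ((((koszulExp σ e).negOnePow : ℤ) : K) • (opMap (nodeMultilinear A) c).domDomCongr σ)
    (fun i => {y | ∃ t : LTree C A.gr, t.deg = e i ∧ y = cls A t}) ?_ x hx
  · rw [smul_apply, ← intUnits_smul_eq K] at this
    exact this
  intro y hy
  choose t ht hyt using hy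
  obtain rfl := funext hyt
  obtain rfl : (fun i => (t i).deg) = e := funext ht
  rw [smul_apply, ← intUnits_smul_eq K, MultilinearMap.domDomCongr_apply, opMap_apply, opMap_apply,
    nodeMultilinear_cls, nodeMultilinear_cls A (fun i => t (σ i)), nodeMap_act]

theorem exists_joinRoot : ∃ L : FreeAlg C (deg A) →ₗ[K] AugBar A,
    ∀ (n : ℕ) (x : Fin n → AugBar A) (c : C.obj n),
      L (FreeAlg.pure (deg A) x c) = nodeMultilinear A n x c :=
  FreeAlg.exists_linearMap (nodeMultilinear A) fun _ σ x c =>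
    nodeMultilinear_act A σ _ c _ fun i => (x i).2.2

/-- Join trees to a new root. -/
def joinRoot : FreeAlg C (deg A) →ₗ[K] AugBar A := (exists_joinRoot A).choose

theorem joinRoot_pure {k : ℕ} (ch : Fin k → LTree C A.gr) (c : C.HOp k) :
    joinRoot A (FreeAlg.pure (deg A) (fun i => cls A (ch i)) (c.2 : C.obj k)) =
      (LTree.splitExp ch c.1).negOnePow • cls A (LTree.node k ch c) := by
  rw [joinRoot, (exists_joinRoot A).choose_spec, nodeMultilinear_cls, nodeMap_apply]

theorem cls_node {k : ℕ} (ch : Fin k → LTree C A.gr) (c : C.HOp k) :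
    cls A (LTree.node k ch c) = (LTree.splitExp ch c.1).negOnePow •
      joinRoot A (FreeAlg.pure (deg A) (fun i => cls A (ch i)) (c.2 : C.obj k)) := by
  rw [joinRoot_pure, negOnePow_smul_self]

/-! ### Splitting off the root -/

/-- The value of `δ` on a tree. -/
def splitTree : LTree C A.gr → FreeAlg C (deg A)
  | .leaf _ => 0
  | .node k ch c => (LTree.splitExp ch c.1).negOnePow •
      FreeAlg.pure (deg A) (fun i => cls A (ch i)) (c.2 : C.obj k)

theorem exists_splitRoot : ∃ δ : AugBar A →ₗ[K] FreeAlg C (deg A),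
    ∀ t, δ (cls A t) = splitTree A t := by
  refine (isPresentation_cls A).exists_linearMap (splitTree A) fun f hf => ?_
  cases hf with
  | leaf_add i a b => simp [splitTree]
  | leaf_smul i r a => simp [splitTree]
  | node_add k ch q a b =>
    simp only [map_sub, map_add, Finsupp.linearCombination_single, one_smul, splitTree,
      ← FreeAlg.pureM_apply, Submodule.coe_add, smul_add, sub_self]
  | node_smul k ch q r a =>
    simp only [map_sub, map_smul, Finsupp.linearCombination_single, one_smul, splitTree,
      ← FreeAlg.pureM_apply, Submodule.coe_smul]
    rw [intUnits_smul_eq K, intUnits_smul_eq K, smul_comm, sub_self]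
  | perm k ch c σ =>
    rw [map_sub, linearMap_intUnits_smul, Finsupp.linearCombination_single,
      Finsupp.linearCombination_single, one_smul, one_smul, splitTree, splitTree,
      negOnePow_smul_smul, sub_eq_zero]
    have h1 := FreeAlg.pure_perm (C := C) (gr := deg A) σ (fun i => cls A (ch i)) (c.2 : C.obj k)
      (fun i => (ch i).deg) (fun i => cls_mem A (ch i))
    have h2 : ((C.actH σ c).2 : C.obj k) = C.act σ c.2 := rfl
    have h3 : (C.actH σ c).1 = c.1 := rfl
    rw [h2, h1, h3, negOnePow_smul_smul]
    congr 1
    exact negOnePow_add_eq_of_eq (LTree.negOnePow_splitExp_perm ch c.1 σ)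
  | context k ch c i f h =>
    -- Only the root is split off, so the value depends linearly on the class of the successor tree,
    -- which is zero; no induction hypothesis is needed.
    obtain ⟨p, q, hpq⟩ := h.exists_mem_bideg
    set s : ℤ := ∑ j, (ch j).intDeg + (q - (ch i).intDeg) + c.1 +
      shuffleExp (Function.update (fun j => (ch j).intDeg) i q)
        (Function.update (fun j => (ch j).inner) i p) with hs
    have h1 := LTree.eq_of_mem_bideg (L := Finsupp.linearCombination K (splitTree A) ∘ₗ
      LTree.atChildL ch c i) (L' := ((s.negOnePow : ℤ) : K) •
        (((LinearMap.applyₗ (c.2 : C.obj k)).compMultilinearMap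
          (FreeAlg.pureM C (deg A) k)).toLinearMap (fun j => cls A (ch j)) i ∘ₗ
          mk A)) (fun t hp hq => ?_) hpq
    · rw [LinearMap.smul_apply, LinearMap.comp_apply, LinearMap.comp_apply, mk_eq_zero A h, map_zero,
        smul_zero] at h1
      exact h1
    · rw [LinearMap.smul_apply, LinearMap.comp_apply, LinearMap.comp_apply, LTree.atChildL_apply,
        LTree.atChild_single, Finsupp.linearCombination_single, one_smul, splitTree,
        LTree.splitExp_update, hp, hq, ← hs, ← intUnits_smul_eq K, update_cls]
      rfl

/-- The map `δ` which splits off the root. -/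
def splitRoot : AugBar A →ₗ[K] FreeAlg C (deg A) := (exists_splitRoot A).choose

theorem splitRoot_cls (t : LTree C A.gr) : splitRoot A (cls A t) = splitTree A t :=
  (exists_splitRoot A).choose_spec t

theorem splitRoot_leaf (a : Homog A.gr) : splitRoot A (cls A (LTree.leaf a)) = 0 := by
  rw [splitRoot_cls, splitTree]

theorem splitRoot_node {k : ℕ} (ch : Fin k → LTree C A.gr) (c : C.HOp k) :
    splitRoot A (cls A (LTree.node k ch c)) = (LTree.splitExp ch c.1).negOnePow •
      FreeAlg.pure (deg A) (fun i => cls A (ch i)) (c.2 : C.obj k) := by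
  rw [splitRoot_cls, splitTree]

theorem splitRoot_joinRoot (y : FreeAlg C (deg A)) : splitRoot A (joinRoot A y) = y := by
  have : splitRoot A ∘ₗ joinRoot A = LinearMap.id := by
    refine FreeAlg.linearMap_ext_of_span (span_cls A) fun n t c => ?_
    rw [LinearMap.comp_apply, joinRoot_pure, linearMap_intUnits_smul, splitRoot_node,
      negOnePow_smul_self, LinearMap.id_apply]
  exact LinearMap.congr_fun this y

theorem joinRoot_splitRoot_node {k : ℕ} (ch : Fin k → LTree C A.gr) (c : C.HOp k) :
    joinRoot A (splitRoot A (cls A (LTree.node k ch c))) = cls A (LTree.node k ch c) := by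
  rw [splitRoot_node, linearMap_intUnits_smul, ← cls_node]

theorem splitRoot_mem (m : ℤ) (x : AugBar A) (hx : x ∈ deg A m) :
    splitRoot A x ∈ FreeAlg.deg C (deg A) (m - 1) := by
  have : deg A m ≤ (FreeAlg.deg C (deg A) (m - 1)).comap (splitRoot A) := by
    refine Submodule.span_le.2 ?_
    rintro _ ⟨t, ht, rfl⟩
    rw [SetLike.mem_coe, Submodule.mem_comap]
    cases t with
    | leaf a => rw [splitRoot_leaf]; exact Submodule.zero_mem _
    | node k ch c =>
      rw [splitRoot_node, intUnits_smul_eq K]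
      refine Submodule.smul_mem _ _ ?_
      have := FreeAlg.pure_mem (C := C) (fun i => cls_mem A (ch i)) c.2.2
      convert this using 2
      rw [← ht, LTree.deg_node]
      ring
  exact this hx

/-! ### The leaves -/

/-- The label of a tree consisting of one leaf. -/
def leafValue : LTree C A.gr → M
  | .leaf a => a.2
  | .node _ _ _ => 0

theorem exists_leafProj : ∃ p : AugBar A →ₗ[K] M, ∀ t, p (cls A t) = leafValue A t := by
  refine (isPresentation_cls A).exists_linearMap (leafValue A) fun f hf => ?_
  cases hf with
  | leaf_add i a b => simp [leafValue]
  | leaf_smul i r a => simp [leafValue]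
  | node_add k ch q a b => simp [leafValue]
  | node_smul k ch q r a => simp [leafValue]
  | perm k ch c σ =>
    rw [intUnits_smul_eq K]
    simp [leafValue]
  | context k ch c i f h =>
    -- A tree obtained by filling a successor place is never a single leaf.
    have : Finsupp.linearCombination K (leafValue A) ∘ₗ LTree.atChildL ch c i = 0 := by
      refine Finsupp.lhom_ext' fun t => LinearMap.ext_ring ?_
      rw [LinearMap.comp_apply, LinearMap.comp_apply, Finsupp.lsingle_apply, LTree.atChildL_apply,
        LTree.atChild_single, Finsupp.linearCombination_single, leafValue, smul_zero]
      rfl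
    exact LinearMap.congr_fun this f

/-- The projection to the summand of leaves. -/
def leafProj : AugBar A →ₗ[K] M := (exists_leafProj A).choose

theorem leafProj_leaf (a : Homog A.gr) : leafProj A (cls A (LTree.leaf a)) = a.2 := by
  rw [leafProj, (exists_leafProj A).choose_spec, leafValue]

theorem leafProj_node {k : ℕ} (ch : Fin k → LTree C A.gr) (c : C.HOp k) :
    leafProj A (cls A (LTree.node k ch c)) = 0 := by
  rw [leafProj, (exists_leafProj A).choose_spec, leafValue]

theorem leafProj_joinRoot (y : FreeAlg C (deg A)) : leafProj A (joinRoot A y) = 0 := by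
  have : leafProj A ∘ₗ joinRoot A = 0 := by
    refine FreeAlg.linearMap_ext_of_span (span_cls A) fun n t c => ?_
    rw [LinearMap.comp_apply, joinRoot_pure, linearMap_intUnits_smul, leafProj_node, smul_zero]
    rfl
  exact LinearMap.congr_fun this y

theorem leafProj_mem (m : ℤ) (x : AugBar A) (hx : x ∈ deg A m) : leafProj A x ∈ A.gr m := by
  have : deg A m ≤ (A.gr m).comap (leafProj A) := by
    refine Submodule.span_le.2 ?_
    rintro _ ⟨t, rfl, rfl⟩
    rw [SetLike.mem_coe, Submodule.mem_comap]
    cases t with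
    | leaf a =>
      rw [leafProj_leaf, LTree.deg, LTree.inner, LTree.intDeg, zero_add]
      exact a.2.2
    | node k ch c => rw [leafProj_node]; exact Submodule.zero_mem _
  exact this hx

theorem exists_leafIncl : ∃ j : M →ₗ[K] AugBar A, ∀ a : Homog A.gr,
    j a.2 = cls A (LTree.leaf a) := by
  refine (isPresentation_homog A.isDGAlgebra.isDG.internal).exists_linearMap
    (fun a => cls A (LTree.leaf a)) fun f hf => ?_
  cases hf with
  | add i a b =>
    have h := mk_eq_zero A (LTree.Rel.leaf_add i a b)
    rw [map_sub, map_add] at h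
    simp only [map_sub, map_add, Finsupp.linearCombination_single, one_smul]
    exact h
  | smul i r a =>
    have h := mk_eq_zero A (LTree.Rel.leaf_smul i r a)
    rw [map_sub, map_smul] at h
    simp only [map_sub, map_smul, Finsupp.linearCombination_single, one_smul]
    exact h

/-- The inclusion of the summand of leaves. -/
def leafIncl : M →ₗ[K] AugBar A := (exists_leafIncl A).choose

theorem leafIncl_apply (a : Homog A.gr) : leafIncl A a.2 = cls A (LTree.leaf a) :=
  (exists_leafIncl A).choose_spec a

theorem leafIncl_mem_leaves (a : M) : leafIncl A a ∈ leaves A := by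
  have h : Submodule.span K (Set.range fun a : Homog A.gr => (a.2 : M)) ≤
      (leaves A).comap (leafIncl A) := by
    refine Submodule.span_le.2 ?_
    rintro _ ⟨a, rfl⟩
    rw [SetLike.mem_coe, Submodule.mem_comap, leafIncl_apply]
    exact Submodule.subset_span ⟨a, rfl⟩
  refine h ?_
  rw [span_iUnion_of_isInternal A.isDGAlgebra.isDG.internal]
  trivial

theorem splitRoot_leafIncl (a : M) : splitRoot A (leafIncl A a) = 0 := by
  have : splitRoot A ∘ₗ leafIncl A = 0 := by
    refine linearMap_ext_of_span (span_iUnion_of_isInternal A.isDGAlgebra.isDG.internal) fun a => ?_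
    rw [LinearMap.comp_apply, leafIncl_apply, splitRoot_leaf]
    rfl
  exact LinearMap.congr_fun this a

theorem leafProj_leafIncl (a : M) : leafProj A (leafIncl A a) = a := by
  have : leafProj A ∘ₗ leafIncl A = LinearMap.id := by
    refine linearMap_ext_of_span (span_iUnion_of_isInternal A.isDGAlgebra.isDG.internal) fun a => ?_
    rw [LinearMap.comp_apply, leafIncl_apply, leafProj_leaf]
    rfl
  exact LinearMap.congr_fun this a

/-- The augmented bar construction is the sum of `A` and of the free algebra on itself. -/
theorem leafIncl_leafProj_add (x : AugBar A) :
    leafIncl A (leafProj A x) + joinRoot A (splitRoot A x) = x := by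
  have : leafIncl A ∘ₗ leafProj A + joinRoot A ∘ₗ splitRoot A = LinearMap.id := by
    refine linearMap_ext_of_span (span_cls A) fun t => ?_
    rw [LinearMap.add_apply, LinearMap.comp_apply, LinearMap.comp_apply, LinearMap.id_apply]
    cases t with
    | leaf a => rw [leafProj_leaf, leafIncl_apply, splitRoot_leaf, map_zero, add_zero]
    | node k ch c => rw [leafProj_node, map_zero, joinRoot_splitRoot_node, zero_add]
  exact LinearMap.congr_fun this x

end AugBar

/-! ## Grafting and splicing corollas -/

namespace Corolla

variable {K : Type u} [Field K] {C : DGOperad.{u, v} K} {T : Type w}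

/-- The corolla with one input whose operation is the unit. -/
def unit (C : DGOperad.{u, v} K) (x : T) : Corolla C T := ⟨1, fun _ => x, C.oneH⟩

theorem splice_eq {k : ℕ} (x : Fin k → T) (c : C.HOp k) (i : Fin k) (z : Corolla C T) :
    splice x c i z = graft (Function.update (fun j => unit C (x j)) i z) c := by
  rw [splice]
  congr 1
  ext1 j
  by_cases hj : j = i
  · subst hj; simp
  · rw [if_neg hj, Function.update_of_ne hj, unit]

/-- The unit has degree zero, so in a splice only the inserted operation contributes to the sign. -/
theorem update_unit_op {k : ℕ} (x : Fin k → T) (i : Fin k) (z : Corolla C T) :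
    (fun j => (Function.update (fun j => unit C (x j)) i z j).op.1) =
      Function.update (fun _ => 0) i z.op.1 :=
  funext fun j => Function.apply_update (fun _ (z : Corolla C T) => z.op.1)
    (fun j => unit C (x j)) i z j

theorem update_unit_sum {k : ℕ} (φ : T → ℤ) (x : Fin k → T) (i : Fin k) (z : Corolla C T) :
    (fun j => ∑ q, φ ((Function.update (fun j => unit C (x j)) i z j).inp q)) =
      Function.update (fun j => φ (x j)) i (∑ q, φ (z.inp q)) := by
  ext1 j
  rw [Function.apply_update (fun _ (z : Corolla C T) => ∑ q, φ (z.inp q))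
    (fun j => unit C (x j)) i z j]
  congr 1
  ext1 j
  exact Fin.sum_univ_one (fun _ => φ (x j))

theorem update_unit_shuffleExp {k : ℕ} (φ ψ : T → ℤ) (x : Fin k → T) (i : Fin k)
    (z : Corolla C T) :
    ∑ j, shuffleExp (fun q => φ ((Function.update (fun j => unit C (x j)) i z j).inp q))
      (fun q => ψ ((Function.update (fun j => unit C (x j)) i z j).inp q)) =
      shuffleExp (fun q => φ (z.inp q)) (fun q => ψ (z.inp q)) := by
  have h : ∀ j, shuffleExp (fun q => φ ((Function.update (fun j => unit C (x j)) i z j).inp q))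
      (fun q => ψ ((Function.update (fun j => unit C (x j)) i z j).inp q)) =
      Function.update (fun _ => (0 : ℤ)) i
        (shuffleExp (fun q => φ (z.inp q)) (fun q => ψ (z.inp q))) j := by
    intro j
    rw [Function.apply_update (fun _ (z : Corolla C T) =>
      shuffleExp (fun q => φ (z.inp q)) (fun q => ψ (z.inp q))) (fun j => unit C (x j)) i z j]
    congr 1
  simp only [h, sum_update]
  simp

/-- Relabel the inputs. -/
def map {S : Type*} (φ : T → S) (z : Corolla C T) : Corolla C S := ⟨z.arity, fun q => φ (z.inp q), z.op⟩

theorem map_graft {S : Type*} (φ : T → S) {k : ℕ} (z : Fin k → Corolla C T) (c : C.HOp k) :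
    map φ (graft z c) = graft (fun i => map φ (z i)) c := rfl

theorem map_splice {S : Type*} (φ : T → S) {k : ℕ} (x : Fin k → T) (c : C.HOp k) (i : Fin k)
    (z : Corolla C T) : map φ (splice x c i z) = splice (fun j => φ (x j)) c i (map φ z) := by
  rw [splice_eq, splice_eq, map_graft]
  congr 1
  exact funext fun j => Function.apply_update (fun _ => map φ) (fun j => unit C (x j)) i z j

theorem splice_op_fst {k : ℕ} (x : Fin k → T) (c : C.HOp k) (i : Fin k) (z : Corolla C T) :
    (splice x c i z).op.1 = z.op.1 + c.1 := by
  rw [splice_eq]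
  refine congrArg (· + c.1) ?_
  refine (congrArg (fun f : Fin k → ℤ => ∑ j, f j) (update_unit_op x i z)).trans ?_
  rw [sum_update]
  simp

theorem sum_graft {k : ℕ} (φ : T → ℤ) (z : Fin k → Corolla C T) (c : C.HOp k) :
    ∑ p, φ ((graft z c).inp p) = ∑ i, ∑ q, φ ((z i).inp q) :=
  sum_concat fun i q => φ ((z i).inp q)

theorem sum_splice {k : ℕ} (φ : T → ℤ) (x : Fin k → T) (c : C.HOp k) (i : Fin k)
    (z : Corolla C T) :
    ∑ p, φ ((splice x c i z).inp p) = ∑ j, φ (x j) + (∑ q, φ (z.inp q) - φ (x i)) := by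
  rw [splice_eq, sum_graft]
  exact (congrArg (fun f : Fin k → ℤ => ∑ j, f j) (update_unit_sum φ x i z)).trans (sum_update _ _ _)

theorem shuffleExp_graft {k : ℕ} (φ ψ : T → ℤ) (z : Fin k → Corolla C T) (c : C.HOp k) :
    shuffleExp (fun p => φ ((graft z c).inp p)) (fun p => ψ ((graft z c).inp p)) =
      ∑ i, shuffleExp (fun q => φ ((z i).inp q)) (fun q => ψ ((z i).inp q)) +
        shuffleExp (fun i => ∑ q, φ ((z i).inp q)) (fun i => ∑ q, ψ ((z i).inp q)) :=
  shuffleExp_concat (fun i q => φ ((z i).inp q)) (fun i q => ψ ((z i).inp q))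

end Corolla

/-! ### The map of a D-structure as a derivation -/

namespace FreeAlg

variable {K : Type u} [Field K] {C : DGOperad.{u, v} K} {N : Type w} [AddCommGroup N] [Module K N]
  {gr : ℤ → Submodule K N}

theorem action_update_cls (h : DirectSum.IsInternal gr) {n : ℕ} (x : Fin n → Homog gr)
    (c : C.HOp n) (i : Fin n) (z : Corolla C (Homog gr)) :
    action C h n (Function.update (fun j => gen C gr ((x j).2 : N)) i (cls z)) (c.2 : C.obj n) =
      (z.op.1 * ∑ j ∈ Finset.Ioi i, (x j).1).negOnePow • cls (Corolla.splice x c i z) := by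
  have h1 : Function.update (fun j => gen C gr ((x j).2 : N)) i (cls z) =
      fun j => cls (Function.update (fun j => Corolla.unit C (x j)) i z j) := by
    ext1 j
    rw [Function.apply_update (fun _ => cls) (fun j => Corolla.unit C (x j)) i z j]
    congr 1
    ext1 j
    exact gen_eq_cls (x j)
  rw [h1, action_isMonadAction h, Corolla.splice_eq, Corolla.update_unit_op,
    Corolla.update_unit_sum (fun s : Homog gr => s.1), shuffleExp_update_left]
  congr 2
  rw [Finset.sum_congr rfl fun j hj => Function.update_of_ne (Finset.mem_Ioi.1 hj).ne' _ _]
  simp [shuffleExp]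

/-- The derivation with the values `x ↦ d x + (-1) ^ |x| δ x` on generators is the map `Δ` of a
D-structure. -/
theorem isDelta_derivation (h : DirectSum.IsInternal gr) (d : N →ₗ[K] N) (δ : N →ₗ[K] FreeAlg C gr)
    (hg : ∀ i x, x ∈ gr i → (gen C gr ∘ₗ d + δ ∘ₗ signMap h) x ∈ deg C gr (i - 1)) :
    IsDelta C gr d δ (derivation h (gen C gr ∘ₗ d + δ ∘ₗ signMap h) hg) := by
  intro n x c r z hz
  rw [derivation_pure, leibniz_apply _ _ _ (fun i => (x i).1) fun i => gen_mem (x i).2.2, add_right_comm]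
  have h2 : ∀ i, (gen C gr ∘ₗ d + δ ∘ₗ signMap h) ((x i).2 : N) =
      gen C gr (d (x i).2) + (x i).1.negOnePow • ∑ t, cls (z i t) := by
    intro i
    rw [LinearMap.add_apply, LinearMap.comp_apply, LinearMap.comp_apply,
      signMap_apply h (x i).2.2, linearMap_intUnits_smul, hz]
  simp only [h2, action_gen]
  congr 1
  rw [← Finset.sum_add_distrib]
  refine Finset.sum_congr rfl fun i _ => ?_
  rw [← opMap_apply, MultilinearMap.map_update_add, smul_add]
  congr 1
  · rw [opMap_apply, ← action_gen h]
    congr 3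
    exact (funext fun j => Function.apply_update (fun _ => gen C gr)
      (fun j => ((x j).2 : N)) i (d (x i).2) j).symm
  · rw [intUnits_smul_eq K, intUnits_smul_eq K, MultilinearMap.map_update_smul,
      MultilinearMap.map_update_sum, ← intUnits_smul_eq K, ← intUnits_smul_eq K,
      negOnePow_smul_smul, Finset.smul_sum]
    refine Finset.sum_congr rfl fun t _ => ?_
    rw [opMap_apply, action_update_cls, negOnePow_smul_smul, sum_Iic_eq]

end FreeAlg

/-! ## The differential of the augmented bar construction -/

namespace LTree

variable {K : Type u} [Field K] {C : DGOperad.{u, v} K} {M : Type w} [AddCommGroup M] [Module K M]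

section

variable {gr : ℤ → Submodule K M}

theorem inner_ofCorolla (z : Corolla C (LTree C gr)) :
    (ofCorolla z).inner = ∑ q, (z.inp q).inner + 1 := inner_node _ _ _

theorem intDeg_ofCorolla (z : Corolla C (LTree C gr)) :
    (ofCorolla z).intDeg = ∑ q, (z.inp q).intDeg + z.op.1 := intDeg_node _ _ _

theorem splitExp_graft {k : ℕ} (z : Fin k → Corolla C (LTree C gr)) (c : C.HOp k) :
    splitExp (Corolla.graft z c).inp (Corolla.graft z c).op.1 =
      ∑ i, ∑ q, ((z i).inp q).intDeg + (∑ i, (z i).op.1 + c.1) +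
        (∑ i, shuffleExp (fun q => ((z i).inp q).intDeg) (fun q => ((z i).inp q).inner) +
          shuffleExp (fun i => ∑ q, ((z i).inp q).intDeg)
            (fun i => ∑ q, ((z i).inp q).inner)) := by
  rw [splitExp, Corolla.sum_graft, Corolla.shuffleExp_graft]
  rfl

/-- The absorbed vertex leaves its block: its e is no longer passed by the f of the trees to the
left, and its f no longer passes the e of the trees to the right. The trees above it now take part
in the shuffle one by one, which adds their own shuffle exponent. -/
theorem splitExp_splice {k : ℕ} (ch : Fin k → LTree C gr) (c : C.HOp k) (i : Fin k)
    (z : Corolla C (LTree C gr)) (hz : ch i = ofCorolla z) :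
    splitExp (Corolla.splice ch c i z).inp (Corolla.splice ch c i z).op.1 =
      splitExp ch c.1 - ∑ j ∈ Finset.Iio i, (ch j).intDeg
        - z.op.1 * ∑ j ∈ Finset.Ioi i, (ch j).inner
        + shuffleExp (fun q => (z.inp q).intDeg) (fun q => (z.inp q).inner) := by
  have h1 : (ch i).intDeg = ∑ q, (z.inp q).intDeg + z.op.1 := by rw [hz, intDeg_ofCorolla]
  have h2 : (ch i).inner = ∑ q, (z.inp q).inner + 1 := by rw [hz, inner_ofCorolla]
  have h3 : ∀ x e : ℤ, ∑ j ∈ Finset.Iio i, Function.update (fun j => (ch j).intDeg) i x j * e =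
      ∑ j ∈ Finset.Iio i, (ch j).intDeg * e := fun x e =>
    Finset.sum_congr rfl fun j hj => by rw [Function.update_of_ne (Finset.mem_Iio.1 hj).ne]
  simp only [← Finset.sum_mul] at h3
  rw [splitExp, splitExp, Corolla.sum_splice, Corolla.splice_op_fst, Corolla.splice_eq,
    Corolla.shuffleExp_graft, Corolla.update_unit_shuffleExp, Corolla.update_unit_sum,
    Corolla.update_unit_sum, shuffleExp_update_right, h3, shuffleExp_update_left, h1, h2]
  ring

theorem edgeContr_mem (t : LTree C gr) : t.edgeContr ∈ bideg C gr (t.inner - 1) t.intDeg := by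
  induction t with
  | leaf a => rw [edgeContr]; exact Submodule.zero_mem _
  | node k ch c ih =>
    rw [edgeContr]
    refine Submodule.sum_mem _ fun i _ => Submodule.add_mem _ ?_ ?_
    · rw [intUnits_smul_eq K]
      refine Submodule.smul_mem _ _ ?_
      convert atChild_mem_bideg ch c i (ih i) using 2
      · rw [inner_node]; ring
      · rw [intDeg_node]; ring
    · rcases hi : ch i with a | ⟨m, u, b⟩
      · rw [rootEdge]; exact Submodule.zero_mem _
      · rw [rootEdge, intUnits_smul_eq K]
        refine Submodule.smul_mem _ _ (single_mem_bideg_of_eq _ ?_ ?_)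
        · rw [inner_ofCorolla, Corolla.sum_splice inner, hi, inner_node, inner_node]
          ring
        · rw [intDeg_ofCorolla, Corolla.sum_splice intDeg, hi, intDeg_node, intDeg_node,
            Corolla.splice_op_fst]
          ring

end

variable (A : DGAlgebra C M)

theorem inner_eq_zero {t : LTree C A.gr} (h : t.isLeaf = true) : t.inner = 0 := by
  cases t with
  | leaf a => rw [inner]
  | node k ch c => simp [isLeaf] at h

theorem intDeg_eq {t : LTree C A.gr} (h : t.isLeaf = true) : t.intDeg = t.leafLabel.1 := by
  cases t with
  | leaf a => rw [intDeg, leafLabel]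
  | node k ch c => simp [isLeaf] at h

theorem leafContr_mem (t : LTree C A.gr) :
    t.leafContr A ∈ bideg C A.gr (t.inner - 1) t.intDeg := by
  induction t with
  | leaf a => rw [leafContr]; exact Submodule.zero_mem _
  | node k ch c ih =>
    rw [leafContr]
    refine Submodule.add_mem _ (Submodule.sum_mem _ fun i _ => ?_) ?_
    · rw [intUnits_smul_eq K]
      refine Submodule.smul_mem _ _ ?_
      convert atChild_mem_bideg ch c i (ih i) using 2
      · rw [inner_node]; ring
      · rw [intDeg_node]; ring
    · split_ifs with h
      · refine single_mem_bideg_of_eq _ ?_ ?_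
        · rw [inner_node, Finset.sum_eq_zero fun i _ => inner_eq_zero A (h i), inner]
          ring
        · rw [intDeg_node, intDeg, Finset.sum_congr rfl fun i _ => intDeg_eq A (h i)]
      · exact Submodule.zero_mem _

theorem labelDiff_mem (t : LTree C A.gr) :
    t.labelDiff A ∈ bideg C A.gr t.inner (t.intDeg - 1) := by
  induction t with
  | leaf a =>
    rw [labelDiff]
    exact single_mem_bideg_of_eq _ (by rw [inner, inner]) (by rw [intDeg, intDeg])
  | node k ch c ih =>
    rw [labelDiff]
    refine Submodule.add_mem _ (Submodule.sum_mem _ fun i _ => ?_) ?_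
    · rw [intUnits_smul_eq K]
      refine Submodule.smul_mem _ _ ?_
      convert atChild_mem_bideg ch c i (ih i) using 2
      · rw [inner_node]; ring
      · rw [intDeg_node]; ring
    · rw [intUnits_smul_eq K]
      refine Submodule.smul_mem _ _ (single_mem_bideg_of_eq _ ?_ ?_)
      · rw [inner_node, inner_node]
      · rw [intDeg_node, intDeg_node]
        simp only [DGOperad.dH]
        ring

end LTree

namespace AugBar

variable {K : Type u} [Field K] {C : DGOperad.{u, v} K} {M : Type w} [AddCommGroup M] [Module K M]
  (A : DGAlgebra C M)

theorem mk_diff_mem (t : LTree C A.gr) : mk A (t.diff A) ∈ deg A (t.deg - 1) := by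
  have h1 := mk_mem A t.edgeContr_mem
  have h2 := mk_mem A (t.leafContr_mem A)
  have h3 := mk_mem A (t.labelDiff_mem A)
  rw [show t.inner - 1 + t.intDeg = t.deg - 1 by rw [LTree.deg]; ring] at h1 h2
  rw [show t.inner + (t.intDeg - 1) = t.deg - 1 by rw [LTree.deg]; ring] at h3
  rw [LTree.diff, map_add, map_add, map_neg, linearMap_intUnits_smul, intUnits_smul_eq K]
  exact add_mem (add_mem (neg_mem h1) h2) (Submodule.smul_mem _ _ h3)

/-- The operations of the free algebra on the augmented bar construction. -/
abbrev act (k : ℕ) : MultilinearMap K (fun _ : Fin k => FreeAlg C (deg A))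
    (C.obj k →ₗ[K] FreeAlg C (deg A)) := FreeAlg.action C (deg_isInternal A) k

theorem cls_node_update {k : ℕ} (ch : Fin k → LTree C A.gr) (c : C.HOp k) (i : Fin k)
    (t : LTree C A.gr) :
    cls A (LTree.node k (Function.update ch i t) c) =
      (LTree.splitExp (Function.update ch i t) c.1).negOnePow • joinRoot A (act A k
        (Function.update (fun j => FreeAlg.gen C (deg A) (cls A (ch j))) i
          (FreeAlg.gen C (deg A) (cls A t))) (c.2 : C.obj k)) := by
  rw [cls_node, ← FreeAlg.action_gen (deg_isInternal A)]
  congr 4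
  exact funext fun j => Function.apply_update (fun _ t => FreeAlg.gen C (deg A) (cls A t)) ch i t j

/-- For a single tree this is the splitting of the root. It extends linearly because the sign
depends only on the bidegree. -/
theorem mk_atChild {k : ℕ} (ch : Fin k → LTree C A.gr) (c : C.HOp k) (i : Fin k)
    {f : LTree C A.gr →₀ K} {p q : ℤ} (hf : f ∈ LTree.bideg C A.gr p q) :
    mk A (LTree.atChild ch c i f) =
      (∑ j, (ch j).intDeg + (q - (ch i).intDeg) + c.1 +
        shuffleExp (Function.update (fun j => (ch j).intDeg) i q)
          (Function.update (fun j => (ch j).inner) i p)).negOnePow • joinRoot A (act A k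
        (Function.update (fun j => FreeAlg.gen C (deg A) (cls A (ch j))) i
          (FreeAlg.gen C (deg A) (mk A f))) (c.2 : C.obj k)) := by
  set s := (∑ j, (ch j).intDeg + (q - (ch i).intDeg) + c.1 +
        shuffleExp (Function.update (fun j => (ch j).intDeg) i q)
          (Function.update (fun j => (ch j).inner) i p)) with hs
  have := LTree.eq_of_mem_bideg (L := mk A ∘ₗ LTree.atChildL ch c i)
    (L' := ((s.negOnePow : ℤ) : K) • (joinRoot A ∘ₗ
      (opMap (FreeAlg.action C (deg_isInternal A)) (c.2 : C.obj k)).toLinearMap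
        (fun j => FreeAlg.gen C (deg A) (cls A (ch j))) i ∘ₗ FreeAlg.gen C (deg A) ∘ₗ mk A))
    (fun t hp hq => ?_) hf
  · rw [intUnits_smul_eq K]
    exact this
  · rw [LinearMap.smul_apply, ← intUnits_smul_eq K, LinearMap.comp_apply, LTree.atChildL_apply,
      LTree.atChild_single]
    refine (cls_node_update A ch c i t).trans ?_
    rw [LTree.splitExp_update, hp, hq]
    rfl

/-- The morphism `C(B̃) → A` given by the projection to the leaves. -/
def evalLeaves : FreeAlg C (deg A) →ₗ[K] M :=
  FreeAlg.lift A.isDGAlgebra.isGradedAlgebra (leafProj A) (leafProj_mem A)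

/-- The differential of a tree in terms of pairs `(x_i, d x_i)` of successor trees and their
differentials. -/
def diffMultilinear (k : ℕ) :
    MultilinearMap K (fun _ : Fin k => AugBar A × AugBar A) (C.obj k →ₗ[K] AugBar A) :=
  -- The first summand is the join of the Leibniz rule on generators, with values dx + (-1)^|x| δx;
  -- the second contracts the root when only leaves lie above it.
  (LinearMap.compRight K (joinRoot A)).compMultilinearMap
      ((leibniz (FreeAlg.isGradedAlgebra (C := C) (deg_isInternal A)) k).compLinearMap fun _ =>
        (FreeAlg.gen C (deg A) ∘ₗ LinearMap.fst K _ _).prod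
          (FreeAlg.gen C (deg A) ∘ₗ LinearMap.snd K _ _ +
            splitRoot A ∘ₗ signMap (deg_isInternal A) ∘ₗ LinearMap.fst K _ _))
    + (LinearMap.compRight K (leafIncl A ∘ₗ evalLeaves A ∘ₗ
        signMap (FreeAlg.deg_isInternal (deg_isInternal A)))).compMultilinearMap
      ((FreeAlg.pureM C (deg A) k).compLinearMap fun _ => LinearMap.fst K _ _)

theorem diffMultilinear_apply {k : ℕ} (p : Fin k → AugBar A × AugBar A) (c : C.obj k) :
    diffMultilinear A k p c =
      joinRoot A (leibniz (FreeAlg.isGradedAlgebra (deg_isInternal A)) k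
        (fun i => (FreeAlg.gen C (deg A) (p i).1, FreeAlg.gen C (deg A) (p i).2 +
          splitRoot A (signMap (deg_isInternal A) (p i).1))) c) +
      leafIncl A (evalLeaves A (signMap (FreeAlg.deg_isInternal (deg_isInternal A))
        (FreeAlg.pure (deg A) (fun i => (p i).1) c))) := rfl

end AugBar

namespace AugBar

variable {K : Type u} [Field K] {C : DGOperad.{u, v} K} {M : Type w} [AddCommGroup M] [Module K M]
  (A : DGAlgebra C M)

/-- Contracting an edge at the root means splitting off the root of the upper tree, inserting the
result in the free algebra and joining again. The summand one in the exponent anticipates the sign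
of the edge contractions in the differential. For a leaf both sides vanish. -/
theorem mk_rootEdge {k : ℕ} (ch : Fin k → LTree C A.gr) (c : C.HOp k) (i : Fin k) :
    mk A (LTree.rootEdge ch c i (ch i)) =
      (LTree.splitExp ch c.1 + ∑ j ∈ Finset.Iic i, (ch j).deg + 1).negOnePow • joinRoot A (act A k
        (Function.update (fun j => FreeAlg.gen C (deg A) (cls A (ch j))) i
          (splitRoot A (cls A (ch i)))) (c.2 : C.obj k)) := by
  rcases hi : ch i with a | ⟨m, u, b⟩
  · rw [LTree.rootEdge, map_zero, splitRoot_leaf, ← opMap_apply, MultilinearMap.map_update_zero,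
      map_zero, smul_zero]
  · have h1 : FreeAlg.pure (deg A) (fun q => cls A (u q)) (b.2 : C.obj m) =
        FreeAlg.cls (Corolla.map (clsH A) ⟨m, u, b⟩) := rfl
    have h2 := FreeAlg.action_update_cls (deg_isInternal A) (fun j => clsH A (ch j)) c i
      (Corolla.map (clsH A) ⟨m, u, b⟩)
    rw [← Corolla.map_splice] at h2
    have h3 : FreeAlg.cls (Corolla.map (clsH A) (Corolla.splice ch c i ⟨m, u, b⟩)) =
        FreeAlg.pure (deg A) (fun q => cls A ((Corolla.splice ch c i ⟨m, u, b⟩).inp q))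
          ((Corolla.splice ch c i ⟨m, u, b⟩).op.2 : C.obj _) := rfl
    rw [splitRoot_node, intUnits_smul_eq K (Int.negOnePow (LTree.splitExp u b.1)), ← opMap_apply,
      MultilinearMap.map_update_smul, opMap_apply, ← intUnits_smul_eq K, h1]
    refine Eq.trans ?_ (congrArg (fun y => _ • joinRoot A (_ • y)) h2.symm)
    rw [h3, linearMap_intUnits_smul, linearMap_intUnits_smul, joinRoot_pure, LTree.rootEdge,
      linearMap_intUnits_smul, negOnePow_smul_smul, negOnePow_smul_smul, negOnePow_smul_smul]
    refine congrArg (· • cls A _) ?_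
    have hu : LTree.splitExp u b.1 = (ch i).intDeg +
        shuffleExp (fun q => (u q).intDeg) (fun q => (u q).inner) := by
      rw [hi, LTree.intDeg_node, LTree.splitExp]
    have h4 : ∀ s : Finset (Fin k), ∑ j ∈ s, (ch j).deg =
        ∑ j ∈ s, (ch j).inner + ∑ j ∈ s, (ch j).intDeg := fun s => Finset.sum_add_distrib
    have h5 : ∑ j ∈ Finset.Ioi i, (clsH A (ch j)).1 = ∑ j ∈ Finset.Ioi i, (ch j).deg := rfl
    have h6 : (Corolla.map (clsH A) (⟨m, u, b⟩ : Corolla C (LTree C A.gr))).op.1 = b.1 := rfl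
    rw [LTree.splitExp_splice ch c i ⟨m, u, b⟩ hi, hu, h5, h6, h4, h4, sum_Iic_eq, sum_Iic_eq]
    refine negOnePow_eq_of_eq_add (-(LTree.splitExp ch c.1 + 1 + (ch i).intDeg +
      shuffleExp (fun q => (u q).intDeg) (fun q => (u q).inner))) ?_
    ring

/-- The projection to the leaves kills every tree with an inner vertex, so evaluation vanishes
unless all successors are leaves. In that case there is nothing to shuffle, and the splitting sign
equals the degree sign; the two cancel. -/
theorem mk_leafTerm {k : ℕ} (ch : Fin k → LTree C A.gr) (c : C.HOp k) :
    mk A (if ∀ i, (ch i).isLeaf = true then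
      Finsupp.single (LTree.leaf ⟨(∑ i, (ch i).leafLabel.1) + c.1,
        A.θ k (fun i => ((ch i).leafLabel.2 : M)) c.2,
        A.isDGAlgebra.θ_mem k _ _ _ _ (fun i => (ch i).leafLabel.2.2) c.2.2⟩) 1 else 0) =
      (LTree.splitExp ch c.1).negOnePow • leafIncl A (evalLeaves A
        (signMap (FreeAlg.deg_isInternal (deg_isInternal A))
          (FreeAlg.pure (deg A) (fun i => cls A (ch i)) (c.2 : C.obj k)))) := by
  rw [signMap_apply _ (FreeAlg.pure_mem (fun i => cls_mem A (ch i)) c.2.2), linearMap_intUnits_smul,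
    linearMap_intUnits_smul, evalLeaves, FreeAlg.lift_pure, negOnePow_smul_smul]
  split_ifs with h
  · have h1 : ∀ i, leafProj A (cls A (ch i)) = (ch i).leafLabel.2 := by
      intro i
      have := h i
      rcases hi : ch i with a | ⟨m, u, b⟩
      · rw [leafProj_leaf, LTree.leafLabel]
      · rw [hi, LTree.isLeaf] at this
        exact absurd this (by simp)
    have h2 : shuffleExp (fun i => (ch i).intDeg) (fun i => (ch i).inner) = 0 := by
      simp [shuffleExp, fun i => LTree.inner_eq_zero A (h i)]
    have h3 : ∀ i, (ch i).deg = (ch i).intDeg := fun i => by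
      rw [LTree.deg, LTree.inner_eq_zero A (h i), zero_add]
    simp only [h1, h3, LTree.splitExp, h2]
    rw [Int.negOnePow_even _ ⟨∑ i, (ch i).intDeg + c.1, by ring⟩, one_smul]
    exact (leafIncl_apply A ⟨(∑ i, (ch i).leafLabel.1) + c.1,
        A.θ k (fun i => ((ch i).leafLabel.2 : M)) c.2,
        A.isDGAlgebra.θ_mem k _ _ _ _ (fun i => (ch i).leafLabel.2.2) c.2.2⟩).symm
  · push Not at h
    obtain ⟨i, hi⟩ := h
    have h1 : leafProj A (cls A (ch i)) = 0 := by
      rcases hi' : ch i with a | ⟨m, u, b⟩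
      · rw [hi', LTree.isLeaf] at hi
        exact absurd rfl hi
      · rw [leafProj_node]
    rw [MultilinearMap.map_coord_zero _ i h1, LinearMap.zero_apply, map_zero, map_zero, smul_zero]

theorem mk_diff_leaf (a : Homog A.gr) :
    mk A ((LTree.leaf a).diff A) = leafIncl A (A.d a.2) := by
  rw [LTree.diff, LTree.edgeContr, LTree.leafContr, LTree.labelDiff, LTree.inner, Int.negOnePow_zero,
    one_smul, neg_zero, zero_add, zero_add]
  exact (leafIncl_apply A ⟨a.1 - 1, A.d a.2, A.isDGAlgebra.isDG.d_mem _ _ a.2.2⟩).symm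

/-- The heart of the proof: up to the splitting sign, the tree differential is the Leibniz rule for
dx + (-1)^|x| δx together with the evaluation of leaves. The four local identities below treat
contractions inside a successor tree, label differentials inside it, the differential of the root
label, and contractions of edges at the root. -/
theorem mk_diff_node {k : ℕ} (ch : Fin k → LTree C A.gr) (c : C.HOp k) :
    mk A ((LTree.node k ch c).diff A) = (LTree.splitExp ch c.1).negOnePow •
      diffMultilinear A k (fun i => (cls A (ch i), mk A ((ch i).diff A))) (c.2 : C.obj k) := by
  rw [diffMultilinear_apply, leibniz_apply _ _ _ (fun i => (ch i).deg)
    (fun i => FreeAlg.gen_mem (cls_mem A (ch i))), smul_add, ← mk_leafTerm]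
  have hs : ∀ i, signMap (deg_isInternal A) (cls A (ch i)) = (ch i).deg.negOnePow • cls A (ch i) :=
    fun i => signMap_apply _ (cls_mem A (ch i))
  have hd : ∀ i, mk A ((ch i).diff A) = - mk A (ch i).edgeContr + mk A ((ch i).leafContr A) +
      (ch i).inner.negOnePow • mk A ((ch i).labelDiff A) := fun i => by
    rw [LTree.diff, map_add, map_add, map_neg, linearMap_intUnits_smul]
  set U : Fin k → FreeAlg C (deg A) → AugBar A := fun i y => joinRoot A (act A k
    (Function.update (fun j => FreeAlg.gen C (deg A) (cls A (ch j))) i y) (c.2 : C.obj k)) with hU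
  have hUadd : ∀ i y y', U i (y + y') = U i y + U i y' := fun i y y' => by
    simp only [hU]
    rw [← opMap_apply, MultilinearMap.map_update_add, map_add]
    rfl
  have hUsmul : ∀ i (r : K) y, U i (r • y) = r • U i y := fun i r y => by
    simp only [hU]
    rw [← opMap_apply, MultilinearMap.map_update_smul, map_smul]
    rfl
  have hUneg : ∀ i y, U i (- y) = - U i y := fun i y => by
    rw [← neg_one_smul K, hUsmul, neg_one_smul]
  have hUsgn : ∀ i (s : ℤ) y, U i (s.negOnePow • y) = s.negOnePow • U i y := fun i s y => by
    rw [intUnits_smul_eq K, hUsmul, ← intUnits_smul_eq K]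
  set E := LTree.splitExp ch c.1 with hEdef
  have hsum : ∀ s : Finset (Fin k), ∑ j ∈ s, (ch j).deg =
      ∑ j ∈ s, (ch j).inner + ∑ j ∈ s, (ch j).intDeg := fun s => Finset.sum_add_distrib
  -- The tree sign counts only the e of the earlier trees. The missing f come from the splitting
  -- sign, in which the `i`-th tree now has one e less to be passed.
  have hch : ∀ i (f : LTree C A.gr →₀ K), f ∈ LTree.bideg C A.gr ((ch i).inner - 1) (ch i).intDeg →
      (∑ j ∈ Finset.Iio i, (ch j).inner).negOnePow • mk A (LTree.atChild ch c i f) =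
        (E + ∑ j ∈ Finset.Iio i, (ch j).deg).negOnePow • U i (FreeAlg.gen C (deg A) (mk A f)) := by
    intro i f hf
    rw [mk_atChild A ch c i hf, negOnePow_smul_smul]
    refine congrArg (· • U i _) (negOnePow_eq_of_eq_add (-∑ j ∈ Finset.Iio i, (ch j).intDeg) ?_)
    rw [hsum, hEdef, LTree.splitExp, Function.update_eq_self_iff.2 rfl, shuffleExp_update_right]
    ring
  -- The e of the root compensates for the label degree lowered by one, and the e of the trees
  -- further right compensate for the change of the shuffle. The e of the `i`-th tree itself are the
  -- sign in its own differential.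
  have hlab : ∀ i, ((LTree.node k ch c).inner + ∑ j ∈ Finset.Iio i, (ch j).intDeg).negOnePow •
      mk A (LTree.atChild ch c i ((ch i).labelDiff A)) =
        (E + (∑ j ∈ Finset.Iio i, (ch j).deg + (ch i).inner)).negOnePow •
          U i (FreeAlg.gen C (deg A) (mk A ((ch i).labelDiff A))) := by
    intro i
    rw [mk_atChild A ch c i ((ch i).labelDiff_mem A), negOnePow_smul_smul]
    refine congrArg (· • U i _) (negOnePow_eq_of_eq_add 0 ?_)
    rw [hsum, hEdef, LTree.splitExp, LTree.inner_node, Function.update_eq_self_iff.2 rfl,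
      shuffleExp_update_left, sum_eq_Iio_add_Ioi (fun j => (ch j).inner) i]
    ring
  have hdc : ((LTree.node k ch c).inner + ∑ j, (ch j).intDeg).negOnePow •
      mk A (Finsupp.single (LTree.node k ch (C.dH c)) 1) =
        (E + ∑ j, (ch j).deg).negOnePow • joinRoot A (act A k
          (fun j => FreeAlg.gen C (deg A) (cls A (ch j))) (C.d k c.2)) := by
    refine (congrArg (fun y => _ • y) (cls_node A ch (C.dH c))).trans ?_
    rw [negOnePow_smul_smul, FreeAlg.action_gen]
    refine congrArg (· • joinRoot A _) (negOnePow_eq_of_eq_add 0 ?_)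
    rw [hsum, hEdef, LTree.splitExp, LTree.splitExp, LTree.inner_node]
    simp only [DGOperad.dH]
    ring
  have hroot : ∀ i, mk A (LTree.rootEdge ch c i (ch i)) =
      -((E + (∑ j ∈ Finset.Iio i, (ch j).deg + (ch i).deg)).negOnePow •
        U i (splitRoot A (cls A (ch i)))) := fun i => by
    rw [mk_rootEdge, Int.negOnePow_succ, sum_Iic_eq, Units.neg_smul]
  have hV : ∀ i, joinRoot A (FreeAlg.action C (deg_isInternal A) k
      (Function.update (fun j => FreeAlg.gen C (deg A) (cls A (ch j))) i
        (FreeAlg.gen C (deg A) (mk A ((ch i).diff A)) +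
          splitRoot A (signMap (deg_isInternal A) (cls A (ch i))))) (c.2 : C.obj k)) =
      -U i (FreeAlg.gen C (deg A) (mk A (ch i).edgeContr)) +
        U i (FreeAlg.gen C (deg A) (mk A ((ch i).leafContr A))) +
        (ch i).inner.negOnePow • U i (FreeAlg.gen C (deg A) (mk A ((ch i).labelDiff A))) +
        (ch i).deg.negOnePow • U i (splitRoot A (cls A (ch i))) := by
    intro i
    rw [hd, hs, linearMap_intUnits_smul, map_add, map_add, map_neg, linearMap_intUnits_smul,
      ← hUsgn, ← hUsgn, ← hUneg, ← hUadd, ← hUadd, ← hUadd]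
  rw [LTree.diff, LTree.edgeContr, LTree.leafContr, LTree.labelDiff]
  simp only [map_add, map_neg, map_sum, linearMap_intUnits_smul, hch _ _ (ch _).edgeContr_mem,
    hch _ _ ((ch _).leafContr_mem A), hroot, smul_add, Finset.smul_sum, hlab, hdc, hV, smul_neg,
    negOnePow_smul_smul, Finset.sum_add_distrib, Finset.sum_neg_distrib, neg_add, neg_neg]
  abel

/-! ### The differential is well defined -/

theorem diffMultilinear_act {k : ℕ} (σ : Equiv.Perm (Fin k)) (p : Fin k → AugBar A × AugBar A)
    (c : C.HOp k) (e : Fin k → ℤ) (hp : ∀ i, (p i).1 ∈ deg A (e i))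
    (hp' : ∀ i, (p i).2 ∈ deg A (e i - 1)) :
    diffMultilinear A k p (C.act σ c.2) =
      (koszulExp σ e).negOnePow • diffMultilinear A k (fun i => p (σ i)) (c.2 : C.obj k) := by
  rw [diffMultilinear_apply, diffMultilinear_apply, smul_add, FreeAlg.pure_perm σ _ _ e hp,
    leibniz_perm _ σ _ _ e (fun i => FreeAlg.gen_mem (hp i)), linearMap_intUnits_smul,
    linearMap_intUnits_smul, linearMap_intUnits_smul, linearMap_intUnits_smul]
  intro i
  refine add_mem (FreeAlg.gen_mem (hp' i)) (splitRoot_mem A _ _ ?_)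
  rw [signMap_apply _ (hp i), intUnits_smul_eq K]
  exact Submodule.smul_mem _ _ (hp i)

/-- Relations at the root hold because `diffMultilinear` is linear in the operation and equivariant;
relations further up are treated by induction. -/
theorem linearCombination_mk_diff {f : LTree C A.gr →₀ K} (hf : LTree.Rel C A.gr f) :
    Finsupp.linearCombination K (fun t => mk A (LTree.diff A t)) f = 0 := by
  induction hf with
  | leaf_add i a b =>
    simp only [map_sub, map_add, Finsupp.linearCombination_single, one_smul, mk_diff_leaf,
      Submodule.coe_add, sub_self]
  | leaf_smul i r a =>
    simp only [map_sub, map_smul, Finsupp.linearCombination_single, one_smul, mk_diff_leaf,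
      Submodule.coe_smul, sub_self]
  | node_add k ch q a b =>
    simp only [map_sub, map_add, Finsupp.linearCombination_single, one_smul, mk_diff_node,
      Submodule.coe_add, smul_add, sub_self]
  | node_smul k ch q r a =>
    simp only [map_sub, map_smul, Finsupp.linearCombination_single, one_smul, mk_diff_node,
      Submodule.coe_smul]
    rw [intUnits_smul_eq K, intUnits_smul_eq K, smul_comm, sub_self]
  | perm k ch c σ =>
    rw [map_sub, linearMap_intUnits_smul, Finsupp.linearCombination_single,
      Finsupp.linearCombination_single, one_smul, one_smul, mk_diff_node, mk_diff_node,
      negOnePow_smul_smul, sub_eq_zero]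
    have h := diffMultilinear_act A σ (fun i => (cls A (ch i), mk A ((ch i).diff A))) c
      (fun i => (ch i).deg) (fun i => cls_mem A (ch i)) (fun i => mk_diff_mem A (ch i))
    refine (congrArg _ h).trans ?_
    rw [negOnePow_smul_smul]
    congr 1
    exact negOnePow_add_eq_of_eq (LTree.negOnePow_splitExp_perm ch c.1 σ)
  | context k ch c i f h ih =>
    obtain ⟨p, q, hpq⟩ := h.exists_mem_bideg
    -- In a context the differential depends linearly on the pair (class, class of the differential)
    -- of the replaced tree. For a relation the first entry is zero, and the second is zero by
    -- induction.
    have h0 : ∀ f, ((mk A).prod (Finsupp.linearCombination K fun t => mk A (LTree.diff A t))) f =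
        (mk A f, Finsupp.linearCombination K (fun t => mk A (LTree.diff A t)) f) := fun _ => rfl
    set s : ℤ := ∑ j, (ch j).intDeg + (q - (ch i).intDeg) + c.1 +
      shuffleExp (Function.update (fun j => (ch j).intDeg) i q)
        (Function.update (fun j => (ch j).inner) i p) with hs
    have h1 := LTree.eq_of_mem_bideg
      (L := Finsupp.linearCombination K (fun t => mk A (LTree.diff A t)) ∘ₗ LTree.atChildL ch c i)
      (L' := ((s.negOnePow : ℤ) : K) •
        (((LinearMap.applyₗ (c.2 : C.obj k)).compMultilinearMap
          (diffMultilinear A k)).toLinearMap (fun j => (cls A (ch j), mk A ((ch j).diff A))) i ∘ₗ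
          (mk A).prod (Finsupp.linearCombination K (fun t => mk A (LTree.diff A t)))))
      (fun t hp hq => ?_) hpq
    · rw [LinearMap.smul_apply, LinearMap.comp_apply, LinearMap.comp_apply, h0, ih, mk_eq_zero A h, Prod.mk_zero_zero, map_zero, smul_zero] at h1
      exact h1
    · have h2 : (fun j => (cls A (Function.update ch i t j),
          mk A ((Function.update ch i t j).diff A))) =
          Function.update (fun j => (cls A (ch j), mk A ((ch j).diff A))) i
            (cls A t, mk A (t.diff A)) :=
        funext fun j => Function.apply_update (fun _ t => (cls A t, mk A (t.diff A))) ch i t j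
      rw [LinearMap.smul_apply, LinearMap.comp_apply, LinearMap.comp_apply, LTree.atChildL_apply,
        LTree.atChild_single, Finsupp.linearCombination_single, one_smul, mk_diff_node,
        LTree.splitExp_update, hp, hq, ← hs, ← intUnits_smul_eq K, h2, h0, Finsupp.linearCombination_single, one_smul]
      rfl

theorem exists_differential : ∃ d : AugBar A →ₗ[K] AugBar A, IsDifferential A d :=
  (isPresentation_cls A).exists_linearMap _ fun _ hf => linearCombination_mk_diff A hf

/-- The differential of the augmented bar construction. -/
def differential : AugBar A →ₗ[K] AugBar A := (exists_differential A).choose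

theorem isDifferential : IsDifferential A (differential A) := (exists_differential A).choose_spec

theorem differential_mem (m : ℤ) (x : AugBar A) (hx : x ∈ deg A m) :
    differential A x ∈ deg A (m - 1) := by
  have : deg A m ≤ (deg A (m - 1)).comap (differential A) := by
    refine Submodule.span_le.2 ?_
    rintro _ ⟨t, rfl, rfl⟩
    rw [SetLike.mem_coe, Submodule.mem_comap, isDifferential A t]
    exact mk_diff_mem A t
  exact this hx

theorem differential_leafIncl (a : M) : differential A (leafIncl A a) = leafIncl A (A.d a) := by
  have : differential A ∘ₗ leafIncl A = leafIncl A ∘ₗ A.d := by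
    refine linearMap_ext_of_span (span_iUnion_of_isInternal A.isDGAlgebra.isDG.internal) fun a => ?_
    rw [LinearMap.comp_apply, leafIncl_apply, isDifferential A, mk_diff_leaf, LinearMap.comp_apply]
  exact LinearMap.congr_fun this a

/-- The values of `Δ` on the generators. -/
def deltaGen : AugBar A →ₗ[K] FreeAlg C (deg A) :=
  FreeAlg.gen C (deg A) ∘ₗ differential A + splitRoot A ∘ₗ signMap (deg_isInternal A)

theorem deltaGen_apply {i : ℤ} {x : AugBar A} (hx : x ∈ deg A i) :
    deltaGen A x = FreeAlg.gen C (deg A) (differential A x) + i.negOnePow • splitRoot A x := by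
  rw [deltaGen, LinearMap.add_apply, LinearMap.comp_apply, LinearMap.comp_apply,
    signMap_apply _ hx, linearMap_intUnits_smul]

theorem deltaGen_mem (i : ℤ) (x : AugBar A) (hx : x ∈ deg A i) :
    deltaGen A x ∈ FreeAlg.deg C (deg A) (i - 1) := by
  rw [deltaGen_apply A hx, intUnits_smul_eq K]
  exact add_mem (FreeAlg.gen_mem (differential_mem A i x hx))
    (Submodule.smul_mem _ _ (splitRoot_mem A i x hx))

/-- The map `Δ`. -/
def delta : FreeAlg C (deg A) →ₗ[K] FreeAlg C (deg A) :=
  FreeAlg.derivation (deg_isInternal A) (deltaGen A) (deltaGen_mem A)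

/-- With d available as a linear map, the pairs (x, dx) turn `diffMultilinear` into the derivation Δ
followed by the join, plus evaluation. The signs of splitting and joining cancel. -/
theorem differential_joinRoot {i : ℤ} {y : FreeAlg C (deg A)} (hy : y ∈ FreeAlg.deg C (deg A) i) :
    differential A (joinRoot A y) =
      joinRoot A (delta A y) + i.negOnePow • leafIncl A (evalLeaves A y) := by
  have : differential A ∘ₗ joinRoot A = joinRoot A ∘ₗ delta A + leafIncl A ∘ₗ evalLeaves A ∘ₗ
      signMap (FreeAlg.deg_isInternal (deg_isInternal A)) := by
    refine FreeAlg.linearMap_ext_of_span (span_cls A) fun n t c => ?_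
    rw [LinearMap.comp_apply, joinRoot_pure, linearMap_intUnits_smul, isDifferential A,
      mk_diff_node, negOnePow_smul_self, diffMultilinear_apply]
    simp only [← isDifferential A _]
    rw [LinearMap.add_apply, LinearMap.comp_apply, delta, FreeAlg.derivation_pure]
    rfl
  rw [← linearMap_intUnits_smul, ← linearMap_intUnits_smul, ← signMap_apply
    (FreeAlg.deg_isInternal (deg_isInternal A)) hy]
  exact LinearMap.congr_fun this y

end AugBar

/-! ### The differential squares to zero and the D-structure -/

namespace AugBar

variable {K : Type u} [Field K] {C : DGOperad.{u, v} K} {M : Type w} [AddCommGroup M] [Module K M]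
  (A : DGAlgebra C M)

theorem delta_gen (x : AugBar A) : delta A (FreeAlg.gen C (deg A) x) = deltaGen A x :=
  FreeAlg.derivation_gen _ _ _ x

theorem delta_action (n : ℕ) (y : Fin n → FreeAlg C (deg A)) (c : C.obj n) :
    delta A (act A n y c) =
      leibniz (FreeAlg.isGradedAlgebra (deg_isInternal A)) n (fun i => (y i, delta A (y i))) c :=
  FreeAlg.derivation_action _ _ _ n y c

theorem delta_mem (i : ℤ) (y : FreeAlg C (deg A)) (hy : y ∈ FreeAlg.deg C (deg A) i) :
    delta A y ∈ FreeAlg.deg C (deg A) (i - 1) :=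
  FreeAlg.derivation_mem _ _ _ i y hy

/-- Leaves stay leaves under d. For other trees the evaluation term of `differential_joinRoot` is a
leaf and is killed. -/
theorem splitRoot_differential (x : AugBar A) :
    splitRoot A (differential A x) = delta A (splitRoot A x) := by
  have : splitRoot A ∘ₗ differential A = delta A ∘ₗ splitRoot A := by
    refine linearMap_ext_of_span (span_cls A) fun t => ?_
    rw [LinearMap.comp_apply, LinearMap.comp_apply]
    cases t with
    | leaf a =>
      rw [← leafIncl_apply, differential_leafIncl, splitRoot_leafIncl, splitRoot_leafIncl, map_zero]
    | node k ch c =>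
      conv_lhs => rw [← joinRoot_splitRoot_node]
      rw [differential_joinRoot A (splitRoot_mem A _ _ (cls_mem A _)), map_add,
        linearMap_intUnits_smul, splitRoot_leafIncl, smul_zero, add_zero, splitRoot_joinRoot]
  exact LinearMap.congr_fun this x

theorem evalLeaves_gen (x : AugBar A) : evalLeaves A (FreeAlg.gen C (deg A) x) = leafProj A x :=
  FreeAlg.lift_gen _ _ _ x

theorem evalLeaves_deltaGen (x : AugBar A) :
    evalLeaves A (deltaGen A x) = A.d (leafProj A x) := by
  have : evalLeaves A ∘ₗ deltaGen A = A.d ∘ₗ leafProj A := by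
    refine linearMap_ext_of_span (span_cls A) fun t => ?_
    rw [LinearMap.comp_apply, LinearMap.comp_apply, deltaGen_apply A (cls_mem A t), map_add,
      evalLeaves_gen, linearMap_intUnits_smul]
    cases t with
    | leaf a =>
      rw [splitRoot_leaf, map_zero, smul_zero, add_zero, ← leafIncl_apply, differential_leafIncl,
        leafProj_leafIncl, leafProj_leafIncl]
    | node k ch c =>
      rw [leafProj_node, map_zero]
      -- For a tree with an inner root, the leaf part of its differential is the evaluation of δ
      -- with a sign of degree one less; it cancels the δ term of Δ.
      have h := splitRoot_mem A _ _ (cls_mem A (LTree.node k ch c))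
      conv_lhs => enter [1]; rw [← joinRoot_splitRoot_node]
      rw [differential_joinRoot A h, map_add, leafProj_joinRoot, linearMap_intUnits_smul,
        leafProj_leafIncl, zero_add, Int.negOnePow_sub, Int.negOnePow_one, mul_neg, mul_one,
        Units.neg_smul, neg_add_cancel]
  exact LinearMap.congr_fun this x

/-- Evaluation is an algebra morphism and the differential of A is a derivation, so agreement on
generators suffices. -/
theorem evalLeaves_delta (y : FreeAlg C (deg A)) :
    evalLeaves A (delta A y) = A.d (evalLeaves A y) := by
  have : evalLeaves A ∘ₗ delta A = A.d ∘ₗ evalLeaves A := by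
    refine FreeAlg.linearMap_ext_of_span (span_cls A) fun n t c => ?_
    have h := A.isDGAlgebra.d_θ n (fun i => leafProj A (cls A (t i))) c.2 (fun i => (t i).deg)
      (fun i => leafProj_mem A _ _ (cls_mem A (t i)))
    have hact : ∀ y (c : C.obj n), evalLeaves A (FreeAlg.action C (deg_isInternal A) n y c) =
        A.θ n (fun i => evalLeaves A (y i)) c :=
      fun y c => FreeAlg.lift_action _ _ _ (deg_isInternal A) n y c
    have hu : ∀ i, (fun j => evalLeaves A (Function.update
        (fun j => FreeAlg.gen C (deg A) (cls A (t j))) i (deltaGen A (cls A (t i))) j)) =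
        Function.update (fun j => leafProj A (cls A (t j))) i (A.d (leafProj A (cls A (t i)))) := by
      intro i
      ext1 j
      rw [Function.apply_update (fun _ => evalLeaves A), evalLeaves_deltaGen]
      simp only [evalLeaves_gen]
    rw [LinearMap.comp_apply, LinearMap.comp_apply, delta, FreeAlg.derivation_pure,
      leibniz_apply _ _ _ (fun i => (t i).deg) (fun i => FreeAlg.gen_mem (cls_mem A (t i))),
      evalLeaves, FreeAlg.lift_pure, h, ← evalLeaves]
    simp only [map_add, map_sum, linearMap_intUnits_smul, hact, hu, evalLeaves_gen]
  exact LinearMap.congr_fun this y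

/-- Besides ddx there are δdx and Δδx, equal by `splitRoot_differential`; their signs are those of
degrees differing by one. -/
theorem delta_delta_gen (x : AugBar A) :
    delta A (delta A (FreeAlg.gen C (deg A) x)) =
      FreeAlg.gen C (deg A) (differential A (differential A x)) := by
  have : delta A ∘ₗ delta A ∘ₗ FreeAlg.gen C (deg A) =
      FreeAlg.gen C (deg A) ∘ₗ differential A ∘ₗ differential A := by
    refine linearMap_ext_of_span (span_cls A) fun t => ?_
    have h := cls_mem A t
    simp only [LinearMap.comp_apply]
    rw [delta_gen, deltaGen_apply A h, map_add, delta_gen, linearMap_intUnits_smul,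
      deltaGen_apply A (differential_mem A _ _ h), splitRoot_differential, Int.negOnePow_sub,
      Int.negOnePow_one, mul_neg, mul_one, Units.neg_smul, neg_add_cancel_right]
  exact LinearMap.congr_fun this x

/-- Assumed only for the trees that occur, so that it can be used inside the induction proving dd =
0. -/
theorem delta_delta_pure {n : ℕ} (t : Fin n → LTree C A.gr) (c : C.obj n)
    (h : ∀ i, differential A (differential A (cls A (t i))) = 0) :
    delta A (delta A (FreeAlg.pure (deg A) (fun i => cls A (t i)) c)) = 0 := by
  rw [← FreeAlg.action_gen (deg_isInternal A), leibniz_leibniz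
    (FreeAlg.isGradedAlgebra (deg_isInternal A)) (delta_mem A) (delta_action A) _ c
    (fun i => (t i).deg) (fun i => FreeAlg.gen_mem (cls_mem A (t i)))]
  refine Finset.sum_eq_zero fun i _ => ?_
  rw [delta_delta_gen, h, map_zero, ← opMap_apply, MultilinearMap.map_update_zero]

theorem differential_differential (x : AugBar A) : differential A (differential A x) = 0 := by
  have key : ∀ t, differential A (differential A (cls A t)) = 0 := by
    intro t
    induction t with
    | leaf a =>
      rw [← leafIncl_apply, differential_leafIncl, differential_leafIncl,
        A.isDGAlgebra.isDG.d_d, map_zero]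
    | node k ch c ih =>
      have h := FreeAlg.pure_mem (C := C) (fun i => cls_mem A (ch i)) c.2.2
      -- The joined part is ΔΔ of the successor trees, zero by induction. The two leaf parts are
      -- both the differential of A applied to the evaluation, with opposite signs.
      rw [cls_node, linearMap_intUnits_smul, linearMap_intUnits_smul, differential_joinRoot A h,
        map_add, differential_joinRoot A (delta_mem A _ _ h), delta_delta_pure A ch _ ih, map_zero,
        zero_add, linearMap_intUnits_smul, differential_leafIncl, evalLeaves_delta,
        Int.negOnePow_sub, Int.negOnePow_one, mul_neg, mul_one, Units.neg_smul, neg_add_cancel,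
        smul_zero]
  have : differential A ∘ₗ differential A = 0 := linearMap_ext_of_span (span_cls A) key
  exact LinearMap.congr_fun this x

theorem delta_delta (y : FreeAlg C (deg A)) : delta A (delta A y) = 0 := by
  have : delta A ∘ₗ delta A = 0 := FreeAlg.linearMap_ext_of_span (span_cls A) fun n t c =>
    delta_delta_pure A t _ fun _ => differential_differential A _
  exact LinearMap.congr_fun this y

theorem isDGModule : IsDGModule (deg A) (differential A) :=
  ⟨deg_isInternal A, differential_mem A, differential_differential A⟩

theorem isDelta : IsDelta C (deg A) (differential A) (splitRoot A) (delta A) :=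
  FreeAlg.isDelta_derivation (deg_isInternal A) (differential A) (splitRoot A) (deltaGen_mem A)

theorem isDGAlgebra_delta : IsDGAlgebra C (FreeAlg.deg C (deg A)) (delta A) (act A) where
  isDG := ⟨FreeAlg.deg_isInternal (deg_isInternal A), delta_mem A, delta_delta A⟩
  θ_mem := FreeAlg.action_mem (deg_isInternal A)
  d_θ n x c e hx := by
    rw [delta_action, leibniz_apply _ _ _ e hx]
  θ_one := FreeAlg.action_one (deg_isInternal A)
  θ_assoc := FreeAlg.action_assoc (deg_isInternal A)
  θ_perm := FreeAlg.action_perm (deg_isInternal A)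

theorem splitsRoot : SplitsRoot A (splitRoot A) := by
  refine ⟨splitRoot_leaf A, fun k t c => ?_⟩
  rw [splitRoot_node, LTree.splitExp, LTree.intDeg_node]

theorem isDStructure : IsDStructure C (deg A) (differential A) (splitRoot A) :=
  ⟨isDGModule A, splitRoot_mem A, delta A, act A, isDelta A,
    FreeAlg.action_isMonadAction (deg_isInternal A), isDGAlgebra_delta A⟩

end AugBar

/-! ## The bar construction -/

theorem IsDGAlgebra.of_linearEquiv {K : Type u} [Field K] {C : DGOperad.{u, v} K} {B B' : Type*}
    [AddCommGroup B] [Module K B] [AddCommGroup B'] [Module K B'] {gr : ℤ → Submodule K B}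
    {gr' : ℤ → Submodule K B'} {d : B →ₗ[K] B} {d' : B' →ₗ[K] B'}
    {θ : ∀ n : ℕ, MultilinearMap K (fun _ : Fin n => B) (C.obj n →ₗ[K] B)}
    {θ' : ∀ n : ℕ, MultilinearMap K (fun _ : Fin n => B') (C.obj n →ₗ[K] B')}
    (h : IsDGAlgebra C gr' d' θ') (Φ : B ≃ₗ[K] B')
    (hgr : ∀ m, (gr m).map (Φ : B →ₗ[K] B') = gr' m) (hd : ∀ x, Φ (d x) = d' (Φ x))
    (hθ : ∀ (n : ℕ) (y : Fin n → B) (c : C.obj n), Φ (θ n y c) = θ' n (fun i => Φ (y i)) c) :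
    IsDGAlgebra C gr d θ := by
  have hmem : ∀ m x, Φ x ∈ gr' m ↔ x ∈ gr m := by
    intro m x
    rw [← hgr, Submodule.mem_map]
    exact ⟨fun ⟨y, hy, hyx⟩ => Φ.injective hyx ▸ hy, fun hx => ⟨x, hx, rfl⟩⟩
  -- The grading is the image of the other one under an order isomorphism of submodule lattices, so
  -- independence and supremum carry over.
  have hgr' : gr = fun m => Submodule.orderIsoMapComap Φ.symm (gr' m) := by
    ext m x
    rw [Submodule.orderIsoMapComap_apply, ← hmem, Submodule.mem_map]
    exact ⟨fun hx => ⟨Φ x, hx, Φ.symm_apply_apply x⟩, fun ⟨y, hy, hyx⟩ => by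
      rw [← hyx]
      exact (Φ.apply_symm_apply y).symm ▸ hy⟩
  have hu : ∀ {n : ℕ} (x : Fin n → B) (i : Fin n) (y : B),
      (fun j => Φ (Function.update x i y j)) = Function.update (fun j => Φ (x j)) i (Φ y) :=
    fun x i y => funext fun j => Function.apply_update (fun _ => Φ) x i y j
  refine ⟨⟨?_, fun m x hx => ?_, fun x => ?_⟩, fun n x c e q hx hc => ?_, fun n x c e hx => ?_,
    fun x => ?_, fun k n x b c e eb hx hb => ?_, fun n x c e σ hx => ?_⟩
  · rw [DirectSum.isInternal_submodule_iff_iSupIndep_and_iSup_eq_top, hgr']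
    refine ⟨h.isDG.internal.submodule_iSupIndep.map_orderIso _, ?_⟩
    rw [← OrderIso.map_iSup, h.isDG.internal.submodule_iSup_eq_top, OrderIso.map_top]
  · rw [← hmem, hd]
    exact h.isDG.d_mem m _ ((hmem m x).2 hx)
  · refine Φ.injective ?_
    rw [hd, hd, h.isDG.d_d, map_zero]
  · rw [← hmem, hθ]
    exact h.θ_mem n _ c e q (fun i => (hmem _ _).2 (hx i)) hc
  · refine Φ.injective ?_
    rw [hd, hθ, h.d_θ n _ c e fun i => (hmem _ _).2 (hx i), map_add, map_sum]
    simp only [linearMap_intUnits_smul (Φ : B →ₗ[K] B'), ← LinearEquiv.coe_coe]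
    simp only [LinearEquiv.coe_coe, hθ, hu, hd]
  · refine Φ.injective ?_
    rw [hθ, h.θ_one]
  · refine Φ.injective ?_
    have := h.θ_assoc k n (fun i j => Φ (x i j)) b c e eb (fun i j => (hmem _ _).2 (hx i j)) hb
    rw [← LinearEquiv.coe_coe, linearMap_intUnits_smul, LinearEquiv.coe_coe, hθ, hθ]
    simp only [hθ]
    exact this
  · refine Φ.injective ?_
    rw [← LinearEquiv.coe_coe, linearMap_intUnits_smul, LinearEquiv.coe_coe, hθ, hθ,
      h.θ_perm n _ c e σ fun i => (hmem _ _).2 (hx i)]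

namespace AugBar

variable {K : Type u} [Field K] {C : DGOperad.{u, v} K} {M : Type w} [AddCommGroup M] [Module K M]
  (A : DGAlgebra C M)

theorem joinRoot_mem (m : ℤ) (y : FreeAlg C (deg A)) (hy : y ∈ FreeAlg.deg C (deg A) m) :
    joinRoot A y ∈ deg A (m + 1) := by
  have : FreeAlg.deg C (deg A) m ≤ (deg A (m + 1)).comap (joinRoot A) := by
    refine Submodule.span_le.2 ?_
    rintro _ ⟨z, rfl, rfl⟩
    rw [SetLike.mem_coe, Submodule.mem_comap]
    -- The inputs are arbitrary homogeneous elements; working modulo the target degree reduces the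
    -- claim to inputs that are classes of trees.
    have := multilinearMap_eq_of_mem_span
      (((deg A ((∑ i, (z.inp i).1) + z.op.1 + 1)).mkQ ∘ₗ joinRoot A).compMultilinearMap
        ((LinearMap.applyₗ (z.op.2 : C.obj z.arity)).compMultilinearMap
          (FreeAlg.pureM C (deg A) z.arity))) 0
      (fun i => {y | ∃ t : LTree C A.gr, t.deg = (z.inp i).1 ∧ y = cls A t}) ?_
      (fun i => ((z.inp i).2 : AugBar A)) (fun i => (z.inp i).2.2)
    · exact (Submodule.Quotient.mk_eq_zero _).1 this
    · intro x hx
      choose t ht hxt using hx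
      obtain rfl := funext hxt
      refine (Submodule.Quotient.mk_eq_zero _).2 ?_
      have h1 : joinRoot A (FreeAlg.pure (deg A) (fun i => cls A (t i)) (z.op.2 : C.obj z.arity)) ∈
          deg A ((∑ i, (z.inp i).1) + z.op.1 + 1) := by
        rw [joinRoot_pure, intUnits_smul_eq K]
        refine Submodule.smul_mem _ _ ?_
        have h2 := cls_mem A (LTree.node z.arity t z.op)
        rwa [LTree.deg_node, Finset.sum_congr rfl fun i _ => ht i] at h2
      exact h1
  exact this hy

end AugBar

namespace Bar

variable {K : Type u} [Field K] {C : DGOperad.{u, v} K} {M : Type w} [AddCommGroup M] [Module K M]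
  (A : DGAlgebra C M)

theorem leaves_le_ker : AugBar.leaves A ≤ LinearMap.ker (AugBar.splitRoot A) := by
  refine Submodule.span_le.2 ?_
  rintro _ ⟨a, rfl⟩
  exact AugBar.splitRoot_leaf A a

theorem proj_joinRoot_splitRoot (x : AugBar A) :
    proj A (AugBar.joinRoot A (AugBar.splitRoot A x)) = proj A x := by
  conv_rhs => rw [← AugBar.leafIncl_leafProj_add A x, map_add]
  have h : proj A (AugBar.leafIncl A (AugBar.leafProj A x)) = 0 :=
    (Submodule.Quotient.mk_eq_zero _).2 (AugBar.leafIncl_mem_leaves A _)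
  rw [h, zero_add]

/-- The isomorphism of the bar construction with the free algebra on the augmented bar construction
which splits off the root. -/
def rootEquiv : Bar A ≃ₗ[K] FreeAlg C (AugBar.deg A) :=
  LinearEquiv.ofLinearMap ((AugBar.leaves A).liftQ (AugBar.splitRoot A) (leaves_le_ker A))
    (proj A ∘ₗ AugBar.joinRoot A)
    (LinearMap.ext fun y => AugBar.splitRoot_joinRoot A y)
    (Submodule.linearMap_qext _ (LinearMap.ext fun x => proj_joinRoot_splitRoot A x))

theorem rootEquiv_proj (x : AugBar A) : rootEquiv A (proj A x) = AugBar.splitRoot A x := rfl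

theorem map_rootEquiv_deg (m : ℤ) :
    (deg A m).map (rootEquiv A : Bar A →ₗ[K] FreeAlg C (AugBar.deg A)) =
      FreeAlg.deg C (AugBar.deg A) m := by
  rw [deg]
  refine le_antisymm ?_ fun y hy => ?_
  · rintro _ ⟨_, ⟨x, hx, rfl⟩, rfl⟩
    have := AugBar.splitRoot_mem A _ x hx
    rwa [add_sub_cancel_right] at this
  · exact ⟨proj A (AugBar.joinRoot A y), ⟨_, AugBar.joinRoot_mem A m y hy, rfl⟩,
      AugBar.splitRoot_joinRoot A y⟩

/-- The differential of the bar construction. -/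
def differential : Bar A →ₗ[K] Bar A :=
  (rootEquiv A).symm.toLinearMap ∘ₗ AugBar.delta A ∘ₗ (rootEquiv A).toLinearMap

theorem rootEquiv_differential (x : Bar A) :
    rootEquiv A (differential A x) = AugBar.delta A (rootEquiv A x) :=
  (rootEquiv A).apply_symm_apply _

/-- The differential is transported from Δ; it is induced by d because δ intertwines d and Δ. -/
theorem isDifferential : IsDifferential A (differential A) := by
  refine ⟨AugBar.differential A, AugBar.isDifferential A, fun x => (rootEquiv A).injective ?_⟩
  rw [rootEquiv_differential, rootEquiv_proj, rootEquiv_proj, AugBar.splitRoot_differential]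

/-- The operations of the bar construction. -/
def act (n : ℕ) : MultilinearMap K (fun _ : Fin n => Bar A) (C.obj n →ₗ[K] Bar A) :=
  (LinearMap.compRight K (rootEquiv A).symm.toLinearMap).compMultilinearMap
    ((AugBar.act A n).compLinearMap fun _ => (rootEquiv A).toLinearMap)

theorem rootEquiv_act (n : ℕ) (y : Fin n → Bar A) (c : C.obj n) :
    rootEquiv A (act A n y c) = AugBar.act A n (fun i => rootEquiv A (y i)) c :=
  (rootEquiv A).apply_symm_apply _

theorem isGrafting : IsGrafting A (act A) := by
  intro k z c
  refine (rootEquiv A).injective ?_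
  rw [rootEquiv_act, ← LinearEquiv.coe_coe, linearMap_intUnits_smul, LinearEquiv.coe_coe]
  simp only [rootEquiv_proj]
  have h1 : ∀ z : Corolla C (LTree C A.gr), AugBar.splitRoot A (AugBar.cls A (LTree.ofCorolla z)) =
      (LTree.splitExp z.inp z.op.1).negOnePow • FreeAlg.cls (Corolla.map (AugBar.clsH A) z) :=
    fun z => AugBar.splitRoot_node A z.inp z.op
  have h2 := FreeAlg.action_isMonadAction (AugBar.deg_isInternal A) k
    (fun i => Corolla.map (AugBar.clsH A) (z i)) c
  simp only [h1]
  rw [← opMap_apply, multilinearMap_negOnePow_smul, opMap_apply, Corolla.map_graft,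
    negOnePow_smul_smul]
  refine (congrArg _ h2).trans ?_
  rw [negOnePow_smul_smul]
  refine congrArg (· • FreeAlg.cls _) ?_
  have h3 : (fun i => ∑ q, (((Corolla.map (AugBar.clsH A) (z i)).inp q)).1) =
      fun i => ∑ q, ((z i).inp q).inner + ∑ q, ((z i).inp q).intDeg :=
    funext fun i => Finset.sum_add_distrib
  have h4 : (fun i => (Corolla.map (AugBar.clsH A) (z i)).op.1) = fun i => (z i).op.1 := rfl
  have h5 : (fun i => (LTree.ofCorolla (z i)).intDeg) =
      fun i => ∑ q, ((z i).inp q).intDeg + (z i).op.1 :=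
    funext fun i => LTree.intDeg_ofCorolla (z i)
  have h6 : (fun i => (LTree.ofCorolla (z i)).inner - 1) = fun i => ∑ q, ((z i).inp q).inner :=
    funext fun i => by rw [LTree.inner_ofCorolla, add_sub_cancel_right]
  rw [h3, h4, h5, h6, LTree.splitExp_graft, shuffleExp_add_right, shuffleExp_add_left]
  simp only [LTree.splitExp, Finset.sum_add_distrib]
  -- Two terms occur twice on the side of the trees: the degree of `c`, from the dropped root
  -- generators and from the splitting sign, and the shuffle of the f of the successor trees past
  -- the e, from the grafting sign and again from the splitting sign.
  refine negOnePow_eq_of_eq_add (-(c.1 + shuffleExp (fun i => ∑ q, ((z i).inp q).intDeg)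
            (fun i => ∑ q, ((z i).inp q).inner))) ?_
  ring

end Bar

end

/-! ### The proposition -/

theorem mainTheorem5 {K : Type u} [Field K] (C : DGOperad.{u, v} K) {M : Type w}
    [AddCommGroup M] [Module K M] (A : DGAlgebra C M) :
    ∃ (d : AugBar A →ₗ[K] AugBar A) (δ : AugBar A →ₗ[K] FreeAlg C (AugBar.deg A)),
      AugBar.IsDifferential A d ∧
      AugBar.SplitsRoot A δ ∧
      IsDStructure C (AugBar.deg A) d δ ∧
      ∃ (Δ : FreeAlg C (AugBar.deg A) →ₗ[K] FreeAlg C (AugBar.deg A))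
        (θ : ∀ n : ℕ, MultilinearMap K (fun _ : Fin n => FreeAlg C (AugBar.deg A))
          (C.obj n →ₗ[K] FreeAlg C (AugBar.deg A)))
        (dB : Bar A →ₗ[K] Bar A)
        (θB : ∀ n : ℕ, MultilinearMap K (fun _ : Fin n => Bar A) (C.obj n →ₗ[K] Bar A))
        (Φ : Bar A ≃ₗ[K] FreeAlg C (AugBar.deg A)),
        -- `(C(B̃), Δ, θ)` is the quasi-free algebra of the D-structure
        IsDelta C (AugBar.deg A) d δ Δ ∧
        IsMonadAction C (AugBar.deg A) θ ∧
        IsDGAlgebra C (FreeAlg.deg C (AugBar.deg A)) Δ θ ∧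
        -- `(B, dB, θB)` is the bar construction
        Bar.IsDifferential A dB ∧
        Bar.IsGrafting A θB ∧
        IsDGAlgebra C (Bar.deg A) dB θB ∧
        -- `δ` is the projection to `B`, followed by an isomorphism of DG-`C`-algebras
        (∀ x, Φ (Bar.proj A x) = δ x) ∧
        (∀ m : ℤ, (Bar.deg A m).map (Φ : Bar A →ₗ[K] FreeAlg C (AugBar.deg A)) =
          FreeAlg.deg C (AugBar.deg A) m) ∧
        (∀ y, Φ (dB y) = Δ (Φ y)) ∧
        (∀ (n : ℕ) (y : Fin n → Bar A) (c : C.obj n),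
          Φ (θB n y c) = θ n (fun i => Φ (y i)) c) :=
  ⟨AugBar.differential A, AugBar.splitRoot A, AugBar.isDifferential A, AugBar.splitsRoot A,
    AugBar.isDStructure A, AugBar.delta A, AugBar.act A, Bar.differential A, Bar.act A,
    Bar.rootEquiv A, AugBar.isDelta A, FreeAlg.action_isMonadAction (AugBar.deg_isInternal A),
    AugBar.isDGAlgebra_delta A, Bar.isDifferential A, Bar.isGrafting A,
    (AugBar.isDGAlgebra_delta A).of_linearEquiv (Bar.rootEquiv A) (Bar.map_rootEquiv_deg A)
      (Bar.rootEquiv_differential A) (Bar.rootEquiv_act A),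
    Bar.rootEquiv_proj A, Bar.map_rootEquiv_deg A, Bar.rootEquiv_differential A,
    Bar.rootEquiv_act A⟩
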